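/- Let $\Sigma=\{0,1\}$. "Polynomial time" refers to deterministic machines; tuples of strings are encoded as strings in a standard way, and $\phi$, $R$, $V$ below are applied to such encodings. For an integer $k\ge 0$, a $k$-round rational interactive protocol $\Pi$ consists of polynomial-time computable functions $V:\Sigma^*\to\Sigma^*$, $R:\Sigma^*\to[0,1]$ (with values written as finite binary fractions) and $\phi:\Sigma^*\to\Sigma^*$, and of polynomials $p$, $\ell$. On input $x$, Arthur draws private, independent strings $r_1,\dots,r_k$ uniformly from $\{0,1\}^{\ell(|x|)}$. In round $i+1$ $(0\le i<k)$ Merlin sends a string $m_{i+1}$ of length at most $p(|x|)$, and Arthur replies with $$a_{i+1}=V(x;\,m_1,a_1,\dots,m_i,a_i,m_{i+1};\,r_1,\dots,r_{i+1}).$$ The reward is $R(x;m_1,r_1,\dots,m_k,r_k)$ and the computed value is $\phi(x;m_1,a_1,\dots,a_{k-1},m_k)$. For a transcript $\tau_i=(x;m_1,a_1,\dots,m_i,a_i)$ that is consistent with at least one choice of Arthur's random strings, let $E_k(\tau_k)$ be the expectation of the reward conditional on $\tau_k$ (that is, over the random strings consistent with $\tau_k$, uniformly), and for $i<k$ let $$E_i(\tau_i)=\max_{m}\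 \mathbb E\big[E_{i+1}(\tau_i,m,a_{i+1})\,\big|\,\tau_i\big],$$ where $m$ ranges over the strings of length at most $p(|x|)$ and $a_{i+1}$ is Arthur's reply to $m$. Merlin is rational if every message $m_{i+1}$ that he sends, for $i=0,\dots,k-1$, attains this maximum for the current transcript $\tau_i$. The protocol $\Pi$ computes $f:\Sigma^*\to\Sigma^*$ if for every $x$, every rational behaviour of Merlin and every outcome of Arthur's random strings, the computed value is $f(x)$. Let $\mathrm{FRMA}[k]$ be the set of functions $f:\Sigma^*\to\Sigma^*$ computed by some $k$-round rational interactive protocol, and let $\mathrm{DRMA}[k]$ be the set of languages $S\subseteq\Sigma^*$ whose characteristic function $\mathbb I_S$ (with values the one-letter strings $0$ and $1$) is in $\mathrm{FRMA}[k]$. Let $\mathrm P^{\mathrm{FRMA}[k]}$ be the class of languages that can be decided in polynomial time by a deterministic machine with oracle access to some function $f\in\mathrm{FRMA}[k]$, where an oracle call with query $q$ costs $1+|q|+|f(q)|$ steps. **Theorem.** For every integer $k\ge 0$, $$\mathrm P^{\mathrm{FRMA}[k]}=\mathrm{DRMA}[k].$$ -/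

import Mathlib

open scoped BigOperators

namespace RationalProofs

/-! ## Polynomial time, with and without an oracle -/

/-- Strings over the alphabet `Σ = {0,1}`. -/
abbrev Str : Type := List Bool

/-- Programs of a deterministic multi-stack machine. A program mentions finitely many registers,
each of which is a stack of bits (a tape is a pair of stacks), and control flow is structured.
`query q a` asks the oracle about the content of register `q` and stores the answer in register
`a`. -/
inductive Prog : Type
  | skip : Prog
  | push (r : ℕ) (b : Bool) : Prog
  | pop (r : ℕ) : Prog
  | seq (p q : Prog) : Prog
  | ifTop (r : ℕ) (p q : Prog) : Prog
  | whileNonempty (r : ℕ) (p : Prog) : Prog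
  | query (q a : ℕ) : Prog

/-- The contents of all registers. -/
abbrev Store : Type := ℕ → Str

/-- `Runs O p s s' t`: with oracle `O`, the program `p` started in the store `s` halts in the store
`s'` after exactly `t` steps. Elementary instructions and tests take one step. An oracle call also
pays for writing the query and for reading the answer (so that a long answer cannot be fed back to
the oracle free of charge). -/
inductive Runs (O : Str → Str) : Prog → Store → Store → ℕ → Prop
  | skip (s : Store) : Runs O Prog.skip s s 1
  | push (r : ℕ) (b : Bool) (s : Store) :
      Runs O (Prog.push r b) s (Function.update s r (b :: s r)) 1
  | pop (r : ℕ) (s : Store) :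
      Runs O (Prog.pop r) s (Function.update s r (s r).tail) 1
  | seq {p q : Prog} {s s' s'' : Store} {t t' : ℕ} :
      Runs O p s s' t → Runs O q s' s'' t' → Runs O (Prog.seq p q) s s'' (t + t')
  | ifTop_true {r : ℕ} {p q : Prog} {s s' : Store} {t : ℕ} :
      (s r).head? = some true → Runs O p s s' t → Runs O (Prog.ifTop r p q) s s' (t + 1)
  | ifTop_false {r : ℕ} {p q : Prog} {s s' : Store} {t : ℕ} :
      (s r).head? ≠ some true → Runs O q s s' t → Runs O (Prog.ifTop r p q) s s' (t + 1)
  | while_done {r : ℕ} {p : Prog} {s : Store} :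
      s r = [] → Runs O (Prog.whileNonempty r p) s s 1
  | while_step {r : ℕ} {p : Prog} {s s' s'' : Store} {t t' : ℕ} :
      s r ≠ [] → Runs O p s s' t → Runs O (Prog.whileNonempty r p) s' s'' t' →
      Runs O (Prog.whileNonempty r p) s s'' (t + t' + 1)
  | query (q a : ℕ) (s : Store) :
      Runs O (Prog.query q a) s (Function.update s a (O (s q)))
        (1 + (s q).length + (O (s q)).length)

/-- The initial store: the input is in register `0`, all other registers are empty. -/
def initStore (x : Str) : Store := Function.update (fun _ => []) 0 x

/-- `f` is computable in polynomial time by a deterministic machine with oracle `O`; the output is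
left in register `0`. -/
def PolyTimeWith (O f : Str → Str) : Prop :=
  ∃ (p : Prog) (q : Polynomial ℕ), ∀ x : Str, ∃ (s : Store) (t : ℕ),
    Runs O p (initStore x) s t ∧ s 0 = f x ∧ t ≤ q.eval x.length

/-- `f` is computable in polynomial time: the only "oracle" answers every query with the empty
string, so that a query does no more than clear a register. -/
def PolyTime (f : Str → Str) : Prop := PolyTimeWith (fun _ => []) f

/-- The number with binary expansion `b₀.b₁b₂…bₙ`. -/
def binaryFraction : Str → ℚ
  | [] => 0
  | b :: bs => (if b then 1 else 0) + binaryFraction bs / 2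

/-- `R` is computable in polynomial time, its values being written as finite binary fractions. -/
def PolyTimeRat (R : Str → ℚ) : Prop :=
  ∃ g : Str → Str, PolyTime g ∧ ∀ s, R s = binaryFraction (g s)

/-- A tuple of strings written as one string: a bit `b` of a component becomes `1b`, and each
component is closed by a `0`. -/
def encode (l : List Str) : Str :=
  l.flatMap fun s => (s.flatMap fun b => [true, b]) ++ [false]

/-- The characteristic function of a language, with values `1` and `0`. -/
noncomputable def indicator (S : Language Bool) (x : Str) : Str :=
  open Classical in if x ∈ S then [true] else [false]

/-- The class `P^C` for a class `C` of functions: the languages that are decided in polynomial time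
by a deterministic machine with some `f ∈ C` as its oracle. -/
def POracle (C : Set (Str → Str)) : Set (Language Bool) :=
  {S | ∃ f ∈ C, PolyTimeWith f (indicator S)}

/-! ## Rational interactive proofs -/

/-- A `k`-round rational interactive protocol. On input `x`, Merlin's messages are the strings of
length at most `msgLen |x|`, and Arthur's private random string of each round is uniform on
`{0,1} ^ (coinLen |x|)`. (The length of Arthur's messages is then polynomial in `|x|` because `V` is
computable in polynomial time.) -/
structure Protocol (k : ℕ) where
  /-- computes Arthur's messages -/
  V : Str → Str
  /-- the reward function -/
  R : Str → ℚ
  /-- the value function -/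
  φ : Str → Str
  V_polyTime : PolyTime V
  R_polyTime : PolyTimeRat R
  R_mem : ∀ s, R s ∈ Set.Icc (0 : ℚ) 1
  φ_polyTime : PolyTime φ
  msgLen : Polynomial ℕ
  coinLen : Polynomial ℕ

/-- The completed rounds `(m₁, a₁), …, (mᵢ, aᵢ)`. -/
abbrev History : Type := List (Str × Str)

/-- The transcript `m₁, a₁, …, mᵢ, aᵢ`. -/
def History.flat (h : History) : List Str := h.flatMap fun p => [p.1, p.2]

namespace Protocol

variable {k : ℕ} (P : Protocol k) (x : Str)

/-- The possible values of Arthur's random strings `r₁, …, r_k`. -/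
abbrev Coins : Type := Fin k → Fin (P.coinLen.eval x.length) → Bool

variable {x} in
/-- The list `r₁, …, r_k`. -/
def coinList (ω : P.Coins x) : List Str := List.ofFn fun i => List.ofFn (ω i)

/-- The messages that Merlin may send. -/
noncomputable def messages : Finset Str :=
  (List.finite_length_le Bool (P.msgLen.eval x.length)).toFinset

theorem messages_nonempty : (P.messages x).Nonempty := ⟨[], by simp [messages]⟩

/-- Arthur's reply `aᵢ₊₁ = V(x; m₁, a₁, …, mᵢ, aᵢ, m; r₁, …, rᵢ₊₁)` to the message `m` sent after
the history `h` of `i` rounds. -/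
def arthur (h : History) (m : Str) (ω : P.Coins x) : Str :=
  P.V (encode (x :: h.flat ++ [m] ++ (P.coinList ω).take (h.length + 1)))

/-- The random strings with which Arthur would have sent precisely the messages recorded in `h`. -/
def consistent (h : History) : Finset (P.Coins x) :=
  Finset.univ.filter fun ω =>
    ∀ i : Fin h.length, (h.get i).2 = P.arthur x (h.take i) (h.get i).1 ω

/-- The reward `R(x; m₁, r₁, …, m_k, r_k)`. -/
def reward (h : History) (ω : P.Coins x) : ℚ :=
  P.R (encode (x :: (h.zip (P.coinList ω)).flatMap fun p => [p.1.1, p.2]))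

/-- The value `φ(x; m₁, a₁, …, a_{k-1}, m_k)` computed in the protocol. -/
def computedValue (h : History) : Str := P.φ (encode (x :: h.flat.dropLast))

open scoped BigOperators in
/-- The expected reward, conditional on the history `h` after which `n` rounds remain, when Merlin
maximizes it from now on. The conditional expectation given `h` is the average over the random
strings consistent with `h`. -/
noncomputable def optimum : ℕ → History → ℚ
  | 0, h => 𝔼 ω ∈ P.consistent x h, P.reward x h ω
  | n + 1, h => (P.messages x).sup' (P.messages_nonempty x) fun m =>
      𝔼 ω ∈ P.consistent x h, optimum n (h ++ [(m, P.arthur x h m ω)])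

/-- The expected reward, conditional on the history `h`, when Merlin sends `m` next, `n` further
rounds follow, and Merlin maximizes the expected reward in all of them. -/
noncomputable def messageValue (n : ℕ) (h : History) (m : Str) : ℚ :=
  𝔼 ω ∈ P.consistent x h, P.optimum x n (h ++ [(m, P.arthur x h m ω)])

/-- `h` is a complete history of `k` rounds between Arthur and a rational Merlin: Arthur's messages
come from some choice of his random strings, and each message `mᵢ₊₁` of Merlin is admissible and
maximizes the expected reward conditional on the first `i` rounds. -/
def IsRationalPlay (h : History) : Prop :=
  h.length = k ∧ (P.consistent x h).Nonempty ∧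
    ∀ i : Fin h.length, (h.get i).1 ∈ P.messages x ∧
      ∀ m ∈ P.messages x,
        P.messageValue x (k - (i + 1)) (h.take i) m ≤
          P.messageValue x (k - (i + 1)) (h.take i) (h.get i).1

/-- `f` is computed in the protocol: whenever Merlin is rational, the computed value is `f x`. -/
def Computes (f : Str → Str) : Prop :=
  ∀ (x : Str) (h : History), P.IsRationalPlay x h → P.computedValue x h = f x

end Protocol

/-- The functions computed in some `k`-round rational interactive protocol. -/
def FRMA (k : ℕ) : Set (Str → Str) := {f | ∃ P : Protocol k, P.Computes f}

/-- The languages whose characteristic function is computed in some `k`-round rational interactive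
protocol. -/
def DRMA (k : ℕ) : Set (Language Bool) := {S | indicator S ∈ FRMA k}

end RationalProofs

namespace RationalProofs

open Function

/-! One inclusion is immediate: the characteristic function itself serves as the oracle. For the
other, let a polynomial-time machine decide `S` with an oracle `f` that the `k`-round protocol `P`
computes. Its adaptive computation is packed into one polynomial-time function `Q`. Given the input,
a counter and a list of claimed answers, `Q` returns the next query while the counter stays below
the number of queries, and the decision once it has reached that number (`exists_query_function`).
With `k = 0` the oracle is itself computable in polynomial time and can be eliminated.

For `k ≥ 1` Merlin's first message lists claimed answers to all queries, together with his first
messages in the corresponding runs of `P`. Arthur's first random string selects an index `u`, and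
Arthur runs `P` on the query that the earlier claims determine. If the value of this run is the
claimed answer, the reward is `(2 + R)` times a weight that decreases geometrically in the index;
otherwise it is `0`. The final value depends only on `x` and the first message, so it suffices that
every optimal first message contains correct answers.

Two facts give this. Firstly, a claim `y ≠ f q` has optimal value strictly below `2 +` the optimum
of `P` (`gopt_claim_lt`): either Merlin stays rational for `P` and forfeits everything, or he
deviates and loses in `P`. A correct claim attains that bound (`gopt_claim_eq`). Secondly, these
values are rationals with a common denominator of polynomially many bits, so the loss is at least
some `δ` that is only exponentially small (`gopt_claim_add_le`). The weights fall so fast that at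
the first wrong answer this loss outweighs any gain at later indices (`exists_messageValue_lt`).
Earlier indices cannot help, because the queries there are the true ones and honest claims are
optimal.

The parallel run reduces to a single run of `P` because Arthur's reply reveals `u`, and `u` is read
from bits disjoint from those used for `P`. Hence conditional expectations given the transcript are
those of `P` (`mem_consistent_iff`, `optimum_eq`). -/

theorem polynomial_eval_mono (q : Polynomial ℕ) {m n : ℕ} (h : m ≤ n) : q.eval m ≤ q.eval n := by
  induction q using Polynomial.induction_on' with
  | add p q hp hq => simpa using add_le_add hp hq
  | monomial k a => simpa using Nat.mul_le_mul_left a (Nat.pow_le_pow_left h k)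

/-! ## Runs of programs -/

/-- All registers that a program mentions lie below its bound. -/
def Prog.bound : Prog → ℕ
  | skip => 0
  | push r _ => r + 1
  | pop r => r + 1
  | seq p q => max p.bound q.bound
  | ifTop r p q => max (r + 1) (max p.bound q.bound)
  | whileNonempty r p => max (r + 1) p.bound
  | query q a => max (q + 1) (a + 1)

theorem Runs.length_le {O : Str → Str} {p : Prog} {s s' : Store} {t : ℕ} (h : Runs O p s s' t)
    (r : ℕ) : (s' r).length ≤ (s r).length + t := by
  induction h with
  | skip s => simp
  | push r' b s => by_cases hr : r = r' <;> simp [hr]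
  | pop r' s => by_cases hr : r = r' <;> simp [hr]; omega
  | seq _ _ ih₁ ih₂ => omega
  | ifTop_true _ _ ih => omega
  | ifTop_false _ _ ih => omega
  | while_done => omega
  | while_step _ _ _ ih₁ ih₂ => omega
  | query q a s => by_cases hr : r = a <;> simp [hr]; omega

/-- A run depends only on, and changes only, the registers below the bound of the program. -/
theorem Runs.frame {O : Str → Str} {p : Prog} {s s' : Store} {t n : ℕ} (h : Runs O p s s' t)
    (hn : p.bound ≤ n) {s₁ : Store} (hs : ∀ r < n, s₁ r = s r) :
    ∃ s₁', Runs O p s₁ s₁' t ∧ (∀ r < n, s₁' r = s' r) ∧ ∀ r, n ≤ r → s₁' r = s₁ r := by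
  induction h generalizing s₁ with
  | skip s => exact ⟨s₁, .skip _, hs, fun _ _ => rfl⟩
  | push r' b s =>
    have hr' : r' < n := hn
    refine ⟨_, .push _ _ _, fun r hr => ?_, fun r hr => ?_⟩
    · by_cases h : r = r'
      · subst h; simp [hs r hr]
      · simp [h, hs r hr]
    · rw [update_of_ne (by omega)]
  | pop r' s =>
    have hr' : r' < n := hn
    refine ⟨_, .pop _ _, fun r hr => ?_, fun r hr => ?_⟩
    · by_cases h : r = r'
      · subst h; simp [hs r hr]
      · simp [h, hs r hr]
    · rw [update_of_ne (by omega)]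
  | seq _ _ ih₁ ih₂ =>
    simp only [Prog.bound, max_le_iff] at hn
    obtain ⟨s₂, h₁, h₂, h₃⟩ := ih₁ hn.1 hs
    obtain ⟨s₃, g₁, g₂, g₃⟩ := ih₂ hn.2 h₂
    exact ⟨s₃, h₁.seq g₁, g₂, fun r hr => (g₃ r hr).trans (h₃ r hr)⟩
  | ifTop_true hr _ ih =>
    simp only [Prog.bound, max_le_iff] at hn
    obtain ⟨s₂, h₁, h₂, h₃⟩ := ih hn.2.1 hs
    exact ⟨s₂, .ifTop_true (by rwa [hs _ (by omega)]) h₁, h₂, h₃⟩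
  | ifTop_false hr _ ih =>
    simp only [Prog.bound, max_le_iff] at hn
    obtain ⟨s₂, h₁, h₂, h₃⟩ := ih hn.2.2 hs
    exact ⟨s₂, .ifTop_false (by rwa [hs _ (by omega)]) h₁, h₂, h₃⟩
  | while_done hr =>
    simp only [Prog.bound, max_le_iff] at hn
    exact ⟨s₁, .while_done (by rwa [hs _ (by omega)]), hs, fun _ _ => rfl⟩
  | while_step hr _ _ ih₁ ih₂ =>
    have hn' := hn
    simp only [Prog.bound, max_le_iff] at hn
    obtain ⟨s₂, h₁, h₂, h₃⟩ := ih₁ hn.2 hs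
    obtain ⟨s₃, g₁, g₂, g₃⟩ := ih₂ hn' h₂
    exact ⟨s₃, .while_step (by rwa [hs _ (by omega)]) h₁ g₁, g₂,
      fun r hr => (g₃ r hr).trans (h₃ r hr)⟩
  | query q a s =>
    simp only [Prog.bound, max_le_iff] at hn
    have hq : s₁ q = s q := hs q (by omega)
    refine ⟨_, by rw [← hq]; exact .query q a s₁, fun r hr => ?_, fun r hr => ?_⟩
    · by_cases h : r = a
      · subst h; simp [hq]
      · simp [h, hs r hr]
    · rw [update_of_ne (by omega)]

/-- Without an oracle, the program `p` leads from `s` to `s'` in at most `b` steps. -/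
def Exec (p : Prog) (s s' : Store) (b : ℕ) : Prop := ∃ t ≤ b, Runs (fun _ => []) p s s' t

theorem Exec.mono {p : Prog} {s s' : Store} {b b' : ℕ} (h : Exec p s s' b) (hb : b ≤ b') :
    Exec p s s' b' := by
  obtain ⟨t, ht, h⟩ := h
  exact ⟨t, ht.trans hb, h⟩

theorem Exec.congr {p : Prog} {s s' s'' : Store} {b : ℕ} (h : Exec p s s' b) (hs : s' = s'') :
    Exec p s s'' b := hs ▸ h

theorem Exec.length_le {p : Prog} {s s' : Store} {b : ℕ} (h : Exec p s s' b) (r : ℕ) :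
    (s' r).length ≤ (s r).length + b := by
  obtain ⟨t, ht, h⟩ := h
  exact (h.length_le r).trans (by omega)

theorem Exec.seq {p q : Prog} {s s' s'' : Store} {b b' : ℕ} (h : Exec p s s' b)
    (h' : Exec q s' s'' b') : Exec (.seq p q) s s'' (b + b') := by
  obtain ⟨t, ht, h⟩ := h
  obtain ⟨t', ht', h'⟩ := h'
  exact ⟨_, add_le_add ht ht', h.seq h'⟩

theorem Exec.push (r : ℕ) (b : Bool) (s : Store) :
    Exec (.push r b) s (update s r (b :: s r)) 1 := ⟨1, le_rfl, .push _ _ _⟩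

theorem Exec.pop (r : ℕ) (s : Store) : Exec (.pop r) s (update s r (s r).tail) 1 :=
  ⟨1, le_rfl, .pop _ _⟩

theorem Exec.ifTop_true {r : ℕ} {p q : Prog} {s s' : Store} {b : ℕ}
    (hr : (s r).head? = some true) (h : Exec p s s' b) : Exec (.ifTop r p q) s s' (b + 1) := by
  obtain ⟨t, ht, h⟩ := h
  exact ⟨_, by omega, .ifTop_true hr h⟩

theorem Exec.ifTop_false {r : ℕ} {p q : Prog} {s s' : Store} {b : ℕ}
    (hr : (s r).head? ≠ some true) (h : Exec q s s' b) : Exec (.ifTop r p q) s s' (b + 1) := by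
  obtain ⟨t, ht, h⟩ := h
  exact ⟨_, by omega, .ifTop_false hr h⟩

theorem Exec.while_done {r : ℕ} {p : Prog} {s : Store} (hr : s r = []) :
    Exec (.whileNonempty r p) s s 1 := ⟨1, le_rfl, .while_done hr⟩

theorem Exec.while_step {r : ℕ} {p : Prog} {s s' s'' : Store} {b b' : ℕ} (hr : s r ≠ [])
    (h : Exec p s s' b) (h' : Exec (.whileNonempty r p) s' s'' b') :
    Exec (.whileNonempty r p) s s'' (b + b' + 1) := by
  obtain ⟨t, ht, h⟩ := h
  obtain ⟨t', ht', h'⟩ := h'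
  exact ⟨_, by omega, .while_step hr h h'⟩

namespace Prog

/-- Empties a register. -/
def clear (r : ℕ) : Prog := whileNonempty r (pop r)

/-- Empties the registers `1, …, n`. -/
def clearUpTo : ℕ → Prog
  | 0 => skip
  | n + 1 => seq (clearUpTo n) (clear (n + 1))

/-- Empties the register `r` from the top, running `body b` for each bit `b`. -/
def drain (r : ℕ) (body : Bool → Prog) : Prog :=
  whileNonempty r (seq (ifTop r (body true) (body false)) (pop r))

/-- Moves the content of `r`, reversed, to the top of `r'`. -/
def shift (r r' : ℕ) : Prog := drain r fun b => push r' b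

/-- Moves the content of `r`, reversed, to the tops of both `r'` and `r''`. -/
def shiftBoth (r r' r'' : ℕ) : Prog := drain r fun b => seq (push r' b) (push r'' b)

/-- Moves the content of `r`, reversed, with each bit `b` replaced by `1b`, to the top of `r'`. -/
def shiftMarked (r r' : ℕ) : Prog := drain r fun b => seq (push r' b) (push r' true)

end Prog

theorem exec_clear (r : ℕ) (s : Store) :
    Exec (.clear r) s (update s r []) (2 * (s r).length + 1) := by
  generalize hl : s r = l
  induction l generalizing s with
  | nil => rw [← hl, update_eq_self]; exact (Exec.while_done hl).mono (by simp)
  | cons b l ih =>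
    have := ih (update s r (s r).tail) (by simp [hl])
    rw [update_idem] at this
    exact (Exec.while_step (by simp [hl]) (.pop r s) this).mono (by simp; omega)

theorem exec_clearUpTo (n L : ℕ) (s : Store) (hL : ∀ r, 0 < r → r ≤ n → (s r).length ≤ L) :
    Exec (.clearUpTo n) s (fun r => if 0 < r ∧ r ≤ n then [] else s r) (n * (2 * L + 1) + 1) := by
  induction n with
  | zero =>
    refine ⟨1, by omega, ?_⟩
    have hs : (fun r => if 0 < r ∧ r ≤ 0 then [] else s r) = s :=
      funext fun r => if_neg (by omega)
    rw [hs]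
    exact .skip s
  | succ n ih =>
    have h := (ih fun r h₁ h₂ => hL r h₁ (by omega)).seq (exec_clear (n + 1) _)
    have hl := hL (n + 1) (by omega) le_rfl
    have hs : update (fun r => if 0 < r ∧ r ≤ n then [] else s r) (n + 1) [] =
        fun r => if 0 < r ∧ r ≤ n + 1 then [] else s r := by
      ext1 r
      by_cases hr : r = n + 1
      · simp [hr]
      · rw [update_of_ne hr]
        have : r ≤ n + 1 ↔ r ≤ n := by omega
        simp [this]
    rw [hs] at h
    refine h.mono ?_
    simp only [add_le_iff_nonpos_right, nonpos_iff_eq_zero, one_ne_zero, and_false, if_false]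
    nlinarith

/-- Hypothesis `hg` says that the body neither reads nor changes `r`, so the loop is a fold over the
content of `r`. Each bit costs `c` for the body and one step each for the branch, the `pop` and the
loop test. -/
theorem exec_drain {r c : ℕ} {body : Bool → Prog} (g : Bool → Store → Store)
    (hbody : ∀ b s, Exec (body b) s (g b s) c)
    (hg : ∀ b s v, g b (update s r v) = update (g b s) r v) (s : Store) :
    Exec (.drain r body) s (update ((s r).foldl (fun s b => g b s) s) r [])
      ((c + 3) * (s r).length + 1) := by
  have hgr : ∀ b s, g b s r = s r := fun b s => by
    have := hg b s (s r)
    rw [update_eq_self] at this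
    rw [this, update_self]
  generalize hl : s r = l
  induction l generalizing s with
  | nil => simp only [List.foldl_nil]; rw [← hl, update_eq_self]; exact (Exec.while_done hl).mono (by simp)
  | cons b l ih =>
    have h₁ : Exec (.ifTop r (body true) (body false)) s (g b s) (c + 1) := by
      cases b
      · exact .ifTop_false (by simp [hl]) (hbody false s)
      · exact .ifTop_true (by simp [hl]) (hbody true s)
    have h₂ := ih (update (g b s) r l) (by simp)
    have hf : ∀ (l' : List Bool) (s : Store) (v : Str),
        l'.foldl (fun s b => g b s) (update s r v) =
          update (l'.foldl (fun s b => g b s) s) r v := by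
      intro l'
      induction l' with
      | nil => intro s v; rfl
      | cons b l' ih => intro s v; simp only [List.foldl_cons, hg, ih]
    rw [hf, update_idem] at h₂
    have h₃ : Exec (.pop r) (g b s) (update (g b s) r l) 1 := by
      have := Exec.pop r (g b s)
      rwa [hgr, hl] at this
    refine (Exec.while_step (by simp [hl]) (h₁.seq h₃) h₂).mono ?_
    simp only [List.length_cons]
    nlinarith

theorem exec_shift {r r' : ℕ} (h : r' ≠ r) (s : Store) :
    Exec (.shift r r') s (update (update s r' ((s r).reverse ++ s r')) r [])
      (4 * (s r).length + 1) := by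
  have := exec_drain (fun b s => update s r' (b :: s r')) (fun b s => .push r' b s)
    (fun b s v => by rw [update_of_ne h, update_comm h]) s
  have key : ∀ (l : List Bool) (s : Store),
      List.foldl (fun s b => update s r' (b :: s r')) s l = update s r' (l.reverse ++ s r') := by
    intro l
    induction l with
    | nil => intro s; simp
    | cons b l ih => intro s; simp [ih]
  rw [key] at this
  exact this

theorem exec_shiftBoth {r r' r'' : ℕ} (h : r' ≠ r) (h' : r'' ≠ r) (h'' : r' ≠ r'') (s : Store) :
    Exec (.shiftBoth r r' r'') s
      (update (update (update s r' ((s r).reverse ++ s r')) r'' ((s r).reverse ++ s r'')) r [])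
      (5 * (s r).length + 1) := by
  have := exec_drain (r := r) (fun b s => update (update s r' (b :: s r')) r'' (b :: s r''))
    (fun b s => by
      have := (Exec.push r' b s).seq (Exec.push r'' b _)
      rwa [update_of_ne h''.symm] at this)
    (fun b s v => by
      rw [update_of_ne h, update_comm h.symm, update_of_ne h', update_comm h'.symm]) s
  have key : ∀ (l : List Bool) (s : Store),
      List.foldl (fun s b => update (update s r' (b :: s r')) r'' (b :: s r'')) s l =
        update (update s r' (l.reverse ++ s r')) r'' (l.reverse ++ s r'') := by
    intro l
    induction l with
    | nil => intro s; simp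
    | cons b l ih =>
      intro s
      simp only [List.foldl_cons, ih]
      ext1 i
      by_cases hi : i = r''
      · subst hi; simp
      · by_cases hi' : i = r'
        · subst hi'; simp [h'']
        · simp [hi, hi']
  rw [key] at this
  exact this

theorem exec_shiftMarked {r r' : ℕ} (h : r' ≠ r) (s : Store) :
    Exec (.shiftMarked r r') s
      (update (update s r' (((s r).reverse.flatMap fun b => [true, b]) ++ s r')) r [])
      (5 * (s r).length + 1) := by
  have := exec_drain (r := r) (fun b s => update s r' (true :: b :: s r'))
    (fun b s => by
      have := (Exec.push r' b s).seq (Exec.push r' true _)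
      rwa [update_self, update_idem] at this)
    (fun b s v => by rw [update_of_ne h, update_comm h]) s
  have key : ∀ (l : List Bool) (s : Store),
      List.foldl (fun s b => update s r' (true :: b :: s r')) s l =
        update s r' ((l.reverse.flatMap fun b => [true, b]) ++ s r') := by
    intro l
    induction l with
    | nil => intro s; simp
    | cons b l ih => intro s; simp [ih]
  rw [key] at this
  exact this

/-! ## Polynomial-time computable functions of encoded arguments -/

/-- `f` is computable in polynomial time from the encoding `e` of its argument, by a program that
leaves no traces: it needs the registers `1, …, n - 1` to be empty, replaces the content of
register `0`, and restores all other registers. -/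
def PolyTimeOn {α : Type*} (e f : α → Str) : Prop :=
  ∃ (n : ℕ) (p : Prog) (q : Polynomial ℕ), ∀ (a : α) (s : Store), s 0 = e a →
    (∀ r, 0 < r → r < n → s r = []) → Exec p s (update s 0 (f a)) (q.eval (e a).length)

section

variable {α β : Type*} {e f g : α → Str}

/-- The frame property lets the program run beside foreign data in high registers. Its own registers
hold at most as many bits as it took steps, so clearing them afterwards is cheap. This turns an
arbitrary program into one that leaves no traces and can be composed. -/
theorem polyTimeOn_of_runs (h : ∃ (p : Prog) (q : Polynomial ℕ), ∀ a : α, ∃ (s : Store) (t : ℕ),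
    Runs (fun _ => []) p (initStore (e a)) s t ∧ s 0 = f a ∧ t ≤ q.eval (e a).length) :
    PolyTimeOn e f := by
  obtain ⟨p, q, h⟩ := h
  refine ⟨p.bound + 1, .seq p (.clearUpTo p.bound), q + (p.bound * (2 * q + 1) + 1),
    fun a s hs hc => ?_⟩
  obtain ⟨s', t, hr, hf, ht⟩ := h a
  obtain ⟨s₁, h₁, h₂, h₃⟩ := hr.frame (n := p.bound + 1) (Nat.le_succ _) (s₁ := s) (by
    intro r hr
    by_cases h0 : r = 0
    · subst h0; simp [hs, initStore]
    · rw [hc r (by omega) hr, initStore, update_of_ne h0])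
  have h₄ := exec_clearUpTo p.bound (q.eval (e a).length) s₁ (by
    intro r hr hr'
    have := h₁.length_le r
    rw [hc r hr (by omega)] at this
    simp only [List.length_nil] at this
    omega)
  have h₅ : (fun r => if 0 < r ∧ r ≤ p.bound then [] else s₁ r) = update s 0 (f a) := by
    ext1 r
    by_cases h0 : r = 0
    · subst h0; simp [← hf, h₂]
    · rw [update_of_ne h0]
      split_ifs with hr
      · rw [hc r hr.1 (by omega)]
      · exact h₃ r (by omega)
  rw [h₅] at h₄
  refine (Exec.seq ⟨t, ht, h₁⟩ h₄).mono ?_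
  simp

theorem PolyTime.on {f : Str → Str} (h : PolyTime f) : PolyTimeOn id f := polyTimeOn_of_runs h

theorem PolyTimeOn.polyTime {f : Str → Str} (h : PolyTimeOn id f) : PolyTime f := by
  obtain ⟨n, p, q, h⟩ := h
  refine ⟨p, q, fun x => ?_⟩
  obtain ⟨t, ht, h⟩ := h x (initStore x) (by simp [initStore])
    (fun r hr _ => by simp [initStore, hr.ne'])
  exact ⟨_, t, h, by simp, ht⟩

/-- The values of a function computable in polynomial time have polynomial length. -/
theorem PolyTimeOn.length_le (h : PolyTimeOn e f) :
    ∃ q : Polynomial ℕ, ∀ a, (f a).length ≤ q.eval (e a).length := by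
  obtain ⟨n, p, q, h⟩ := h
  refine ⟨Polynomial.X + q, fun a => ?_⟩
  have := (h a (initStore (e a)) (by simp [initStore])
    (fun r hr _ => by simp [initStore, hr.ne'])).length_le 0
  simpa [initStore] using this

theorem PolyTimeOn.self (e : α → Str) : PolyTimeOn e e := by
  refine ⟨0, .skip, 1, fun a s hs _ => ⟨1, by simp, ?_⟩⟩
  rw [← hs, update_eq_self]
  exact .skip s

theorem PolyTimeOn.comp' {e' g : β → Str} {f : α → β} (hg : PolyTimeOn e' g)
    (hf : PolyTimeOn e fun a => e' (f a)) : PolyTimeOn e fun a => g (f a) := by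
  obtain ⟨q', hq'⟩ := hf.length_le
  obtain ⟨n₁, p₁, q₁, h₁⟩ := hf
  obtain ⟨n₂, p₂, q₂, h₂⟩ := hg
  refine ⟨max n₁ n₂, .seq p₁ p₂, q₁ + q₂.comp q', fun a s hs hc => ?_⟩
  have h₃ := h₁ a s hs fun r hr hr' => hc r hr (lt_max_of_lt_left hr')
  have h₄ := h₂ (f a) (update s 0 (e' (f a))) (by simp) fun r hr hr' => by
    rw [update_of_ne hr.ne']; exact hc r hr (lt_max_of_lt_right hr')
  rw [update_idem] at h₄
  refine (h₃.seq h₄).mono ?_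
  simpa using polynomial_eval_mono q₂ (hq' a)

theorem PolyTimeOn.comp {g : Str → Str} (hg : PolyTimeOn id g) (hf : PolyTimeOn e f) :
    PolyTimeOn e fun a => g (f a) := PolyTimeOn.comp' (e' := id) hg hf

theorem PolyTimeOn.congr (hf : PolyTimeOn e f) (h : ∀ a, f a = g a) : PolyTimeOn e g :=
  funext h ▸ hf

theorem PolyTimeOn.of_prog {f : Str → Str} (p : Prog) (q : Polynomial ℕ) (n : ℕ)
    (h : ∀ s : Store, (∀ r, 0 < r → r < n → s r = []) →
      Exec p s (update s 0 (f (s 0))) (q.eval (s 0).length)) : PolyTimeOn id f :=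
  ⟨n, p, q, fun a s hs hc => by
    have := h s hc
    rw [hs] at this
    exact this⟩

theorem PolyTimeOn.cons (b : Bool) (hf : PolyTimeOn e f) : PolyTimeOn e fun a => b :: f a :=
  (PolyTimeOn.of_prog (.push 0 b) 1 0 fun s _ => (Exec.push 0 b s).mono (by simp)).comp
    (g := fun x => b :: x) hf

theorem PolyTimeOn.tail (hf : PolyTimeOn e f) : PolyTimeOn e fun a => (f a).tail :=
  (PolyTimeOn.of_prog (.pop 0) 1 0 fun s _ => (Exec.pop 0 s).mono (by simp)).comp
    (g := List.tail) hf

theorem PolyTimeOn.nil (e : α → Str) : PolyTimeOn e fun _ => [] :=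
  (PolyTimeOn.of_prog (.clear 0) (2 * Polynomial.X + 1) 0
    fun s _ => (exec_clear 0 s).mono (by simp)).comp (g := fun _ => []) (.self e)

theorem PolyTimeOn.const (e : α → Str) (l : Str) : PolyTimeOn e fun _ => l := by
  induction l with
  | nil => exact .nil e
  | cons b l ih => exact ih.cons b

/-- One program computes `g` in register `0` and the reverse of `f` in a high register. -/
theorem PolyTimeOn.both (hf : PolyTimeOn e f) (hg : PolyTimeOn e g) :
    ∃ N, ∀ n, N ≤ n → ∃ (p : Prog) (q : Polynomial ℕ), ∀ (a : α) (s : Store), s 0 = e a →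
      (∀ r, 0 < r → r < n + 3 → s r = []) →
      Exec p s (update (update s 0 (g a)) (n + 2) (f a).reverse) (q.eval (e a).length) := by
  obtain ⟨q', hq'⟩ := hf.length_le
  obtain ⟨n₁, p₁, q₁, h₁⟩ := hf
  obtain ⟨n₂, p₂, q₂, h₂⟩ := hg
  refine ⟨max 1 (max n₁ n₂), fun n hn => ?_⟩
  simp only [max_le_iff] at hn
  refine ⟨.seq (.shift 0 n) (.seq (.shiftBoth n 0 (n + 1)) (.seq p₁ (.seq (.shift 0 (n + 2))
    (.seq (.shift (n + 1) n) (.seq (.shift n 0) p₂))))),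
    (4 * Polynomial.X + 1) + ((5 * Polynomial.X + 1) + (q₁ + ((4 * q' + 1) +
      ((4 * Polynomial.X + 1) + ((4 * Polynomial.X + 1) + q₂))))), fun a s hs hc => ?_⟩
  have en := hc n (by omega) (by omega)
  have en1 := hc (n + 1) (by omega) (by omega)
  have en2 := hc (n + 2) (by omega) (by omega)
  have n0 : n ≠ 0 := by omega
  -- `T x y z w` has `x, y, z, w` in the registers `0, n, n + 1, n + 2` and agrees with `s`
  -- elsewhere. The input is copied to `n + 1`, `f` is computed and parked in `n + 2`, and the input
  -- is moved back for `g`.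
  set T : Str → Str → Str → Str → Store := fun x y z w r =>
    if r = 0 then x else if r = n then y else if r = n + 1 then z else if r = n + 2 then w else s r
    with hT
  have hs' : s = T (e a) [] [] [] := by
    ext1 r
    simp only [hT]
    split_ifs with h0 hn hn1 hn2 <;> simp_all
  have u0 : ∀ x y z w v, update (T x y z w) 0 v = T v y z w := by
    intro x y z w v
    ext1 r
    by_cases h : r = 0
    · rw [h, update_self]; simp [hT]
    · rw [update_of_ne h]; simp only [hT, if_neg h]
  have un : ∀ x y z w v, update (T x y z w) n v = T x v z w := by
    intro x y z w v
    ext1 r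
    by_cases h : r = n
    · rw [h, update_self]; simp [hT, n0]
    · rw [update_of_ne h]; simp only [hT, if_neg h]
  have un1 : ∀ x y z w v, update (T x y z w) (n + 1) v = T x y v w := by
    intro x y z w v
    ext1 r
    by_cases h : r = n + 1
    · rw [h, update_self]; simp [hT]
    · rw [update_of_ne h]; simp only [hT, if_neg h]
  have un2 : ∀ x y z w v, update (T x y z w) (n + 2) v = T x y z v := by
    intro x y z w v
    ext1 r
    by_cases h : r = n + 2
    · rw [h, update_self]; simp [hT]
    · rw [update_of_ne h]; simp only [hT, if_neg h]
  have v0 : ∀ x y z w, T x y z w 0 = x := by intros; simp [hT]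
  have vn : ∀ x y z w, T x y z w n = y := by intros; simp [hT, n0]
  have vn1 : ∀ x y z w, T x y z w (n + 1) = z := by intros; simp [hT]
  have vn2 : ∀ x y z w, T x y z w (n + 2) = w := by intros; simp [hT]
  have vr : ∀ x y z w r, 0 < r → r < n → T x y z w r = [] := by
    intro x y z w r h h'
    simp only [hT]
    rw [if_neg (by omega), if_neg (by omega), if_neg (by omega), if_neg (by omega)]
    exact hc r h (by omega)
  have a₁ := exec_shift (r := 0) (r' := n) n0 (T (e a) [] [] [])
  rw [v0, vn, un, u0, List.append_nil] at a₁
  have a₂ := exec_shiftBoth (r := n) (r' := 0) (r'' := n + 1) n0.symm (by simp) (by simp)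
    (T [] (e a).reverse [] [])
  rw [v0, vn, vn1, u0, un1, un, List.append_nil, List.reverse_reverse] at a₂
  have a₃ := h₁ a (T (e a) [] (e a) []) (v0 _ _ _ _) (fun r h h' => vr _ _ _ _ r h (by omega))
  rw [u0] at a₃
  have a₄ := exec_shift (r := 0) (r' := n + 2) (by simp) (T (f a) [] (e a) [])
  rw [v0, vn2, un2, u0, List.append_nil] at a₄
  have a₅ := exec_shift (r := n + 1) (r' := n) (by simp) (T [] [] (e a) (f a).reverse)
  rw [vn, vn1, un, un1, List.append_nil] at a₅
  have a₆ := exec_shift (r := n) (r' := 0) n0.symm (T [] (e a).reverse [] (f a).reverse)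
  rw [vn, v0, u0, un, List.append_nil, List.reverse_reverse] at a₆
  have a₇ := h₂ a (T (e a) [] [] (f a).reverse) (v0 _ _ _ _)
    (fun r h h' => vr _ _ _ _ r h (by omega))
  rw [u0] at a₇
  have := a₁.seq (a₂.seq (a₃.seq (a₄.seq (a₅.seq (a₆.seq a₇)))))
  have hfin : update (update s 0 (g a)) (n + 2) (f a).reverse = T (g a) [] [] (f a).reverse := by
    rw [hs', u0, un2]
  rw [hfin, hs']
  refine this.mono ?_
  have := hq' a
  simp
  omega

theorem PolyTimeOn.append (hf : PolyTimeOn e f) (hg : PolyTimeOn e g) :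
    PolyTimeOn e fun a => f a ++ g a := by
  obtain ⟨q', hq'⟩ := hf.length_le
  obtain ⟨n, h⟩ := hf.both hg
  obtain ⟨p, q, h⟩ := h n le_rfl
  refine ⟨n + 3, .seq p (.shift (n + 2) 0), q + (4 * q' + 1), fun a s hs hc => ?_⟩
  have h₂ := exec_shift (r := n + 2) (r' := 0) (by simp)
    (update (update s 0 (g a)) (n + 2) (f a).reverse)
  have h₃ := (h a s hs hc).seq h₂
  have hfin : update (update (update (update s 0 (g a)) (n + 2) (f a).reverse) 0 (f a ++ g a))
      (n + 2) [] = update s 0 (f a ++ g a) := by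
    rw [update_comm (a := n + 2) (b := 0) (by simp), update_idem, update_idem,
      update_comm (by simp), ← hc (n + 2) (by simp) (by simp), update_eq_self]
  simp only [update_self, List.reverse_reverse, ne_eq,
    not_false_eq_true, update_of_ne, (show (0 : ℕ) ≠ n + 2 by omega), hfin] at h₃
  refine h₃.mono ?_
  simpa using hq' a

/-! ### Pairs -/

/-- The string that `encode` makes of a tuple with first component `a` and the other components
encoded by `b`. -/
def pr (a b : Str) : Str := (a.flatMap fun b => [true, b]) ++ false :: b

theorem encode_nil : encode [] = [] := rfl

theorem encode_cons (a : Str) (l : List Str) : encode (a :: l) = pr a (encode l) := by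
  simp [encode, pr]

theorem encode_append (l l' : List Str) : encode (l ++ l') = encode l ++ encode l' := by
  simp [encode]

/-- The first component of a pair. -/
def p1 : Str → Str
  | true :: b :: l => b :: p1 l
  -- A malformed string; the value is what `Prog.fst` produces, where the missing bit after the
  -- marker is read as `false`.
  | [true] => [false]
  | _ => []

/-- The second component of a pair. -/
def p2 : Str → Str
  | true :: _ :: l => p2 l
  | false :: l => l
  | _ => []

@[simp] theorem p1_pr (a b : Str) : p1 (pr a b) = a := by
  induction a with
  | nil => rfl
  | cons x a ih => exact congrArg (x :: ·) ih

@[simp] theorem p2_pr (a b : Str) : p2 (pr a b) = b := by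
  induction a with
  | nil => rfl
  | cons x a ih => exact ih

@[simp] theorem p1_nil : p1 [] = [] := rfl

@[simp] theorem p2_nil : p2 [] = [] := rfl

theorem pr_append (a b c : Str) : pr a b ++ c = pr a (b ++ c) := by
  simp [pr]

theorem length_flatMap_mark (a : Str) : (a.flatMap fun b => [true, b]).length = 2 * a.length := by
  induction a with
  | nil => rfl
  | cons x a ih => simp [ih]; omega

@[simp] theorem length_pr (a b : Str) : (pr a b).length = 2 * a.length + 1 + b.length := by
  simp only [pr, List.length_append, length_flatMap_mark, List.length_cons]
  omega

/-- The `+ 1` is needed only for the malformed string `[true]`. -/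
theorem length_p1_add_length_p2_le (z : Str) :
    2 * (p1 z).length + (p2 z).length ≤ z.length + 1 := by
  induction z using p1.induct with
  | case1 b l ih => simp [p1, p2]; omega
  | case2 => simp [p1, p2]
  | case3 z h h' =>
    match z, h, h' with
    | [], _, _ => simp
    | false :: l, _, _ => simp [p1, p2]; omega
    | [true], _, h => exact (h rfl).elim
    | true :: b :: l, h, _ => exact (h b l rfl).elim

theorem length_p2_le (z : Str) : (p2 z).length ≤ z.length := by
  have := length_p1_add_length_p2_le z
  match z with
  | [] => simp
  | false :: l => simp [p2]
  | [true] => simp [p2]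
  | true :: b :: l =>
    simp only [p1, List.length_cons] at this ⊢
    omega

theorem PolyTimeOn.pr (hf : PolyTimeOn e f) (hg : PolyTimeOn e g) :
    PolyTimeOn e fun a => pr (f a) (g a) := by
  have hm : PolyTimeOn id fun z => z.flatMap fun b => [true, b] := by
    refine .of_prog (.seq (.shift 0 1) (.shiftMarked 1 0)) (9 * Polynomial.X + 2) 2 fun s hs => ?_
    have e₁ := hs 1 (by simp) (by simp)
    have h₁ := exec_shift (r := 0) (r' := 1) (by simp) s
    rw [e₁, List.append_nil] at h₁
    have h₂ := exec_shiftMarked (r := 1) (r' := 0) (by simp) (update (update s 1 (s 0).reverse) 0 [])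
    have hfin : update (update (update (update s 1 (s 0).reverse) 0 []) 0
        ((s 0).flatMap fun b => [true, b])) 1 [] = update s 0 ((s 0).flatMap fun b => [true, b]) := by
      rw [update_idem, update_comm (by simp), update_idem, ← e₁, update_eq_self]
    have h₃ := h₁.seq h₂
    simp only [update_self, ne_eq, one_ne_zero, not_false_eq_true, update_of_ne, List.append_nil,
      List.reverse_reverse, hfin, List.length_reverse] at h₃
    refine h₃.mono ?_
    simp; omega
  exact (hm.comp hf).append (hg.cons false)

theorem encode_singleton (a : Str) : encode [a] = RationalProofs.pr a [] := encode_cons a []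

theorem iterate_p2_encode (l : List Str) (i : ℕ) : p2^[i] (encode l) = encode (l.drop i) := by
  induction i with
  | zero => rfl
  | succ i ih =>
    rw [iterate_succ_apply', ih, ← List.tail_drop]
    cases l.drop i with
    | nil => rfl
    | cons a l => rw [encode_cons, p2_pr, List.tail_cons]

/-- The component with index `i` of an encoded tuple. -/
def nth (i : ℕ) (z : Str) : Str := p1 (p2^[i] z)

theorem nth_encode (l : List Str) (i : ℕ) : nth i (encode l) = l.getD i [] := by
  rw [nth, iterate_p2_encode, List.getD_eq_getElem?_getD, ← List.head?_drop]
  cases l.drop i with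
  | nil => rfl
  | cons a l => rw [encode_cons, p1_pr, List.head?_cons, Option.getD_some]

end

namespace Prog

/-- Computes the first component of a pair. -/
def fst : Prog :=
  seq (whileNonempty 0 (ifTop 0
    (seq (pop 0) (seq (ifTop 0 (push 1 true) (push 1 false)) (pop 0))) (clear 0)))
    (shift 1 0)

/-- Computes the second component of a pair. -/
def snd : Prog :=
  seq (whileNonempty 0 (ifTop 0 (seq (pop 0) (pop 0)) (seq (pop 0) (shift 0 1)))) (shift 1 0)

end Prog

section

variable {α β σ : Type*} {e f g : α → Str}

theorem PolyTimeOn.p1 (hf : PolyTimeOn e f) : PolyTimeOn e fun a => p1 (f a) := by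
  have loop : ∀ (z : Str) (s : Store), s 0 = z →
      Exec (.whileNonempty 0 (.ifTop 0 (.seq (.pop 0)
        (.seq (.ifTop 0 (.push 1 true) (.push 1 false)) (.pop 0))) (.clear 0))) s
        (update (update s 1 ((RationalProofs.p1 z).reverse ++ s 1)) 0 []) (6 * z.length + 6) := by
    intro z
    induction z using p1.induct with
    | case1 b l ih =>
      intro s hs
      have hb : Exec (.ifTop 0 (.push 1 true) (.push 1 false)) (update s 0 (b :: l))
          (update (update s 0 (b :: l)) 1 (b :: s 1)) 2 := by
        cases b
        · exact .ifTop_false (by simp) (.push 1 false _)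
        · exact .ifTop_true (by simp) (.push 1 true _)
      have h₁ := Exec.pop 0 s
      rw [hs, List.tail_cons] at h₁
      have h₂ := Exec.pop 0 (update (update s 0 (b :: l)) 1 (b :: s 1))
      have h₃ := ih (update (update (update s 0 (b :: l)) 1 (b :: s 1)) 0
        (update (update s 0 (b :: l)) 1 (b :: s 1) 0).tail) (by simp)
      refine ((Exec.while_step (by simp [hs]) (.ifTop_true (by simp [hs])
        (h₁.seq (hb.seq h₂))) h₃).mono (b' := _) ?_).congr ?_
      · simp only [List.length_cons]; omega
      · ext1 r
        by_cases r0 : r = 0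
        · simp [r0]
        by_cases r1 : r = 1
        · simp [r1, RationalProofs.p1]
        simp [r0, r1]
    | case2 =>
      intro s hs
      have h₁ := Exec.pop 0 s
      rw [hs, List.tail_cons] at h₁
      have h₂ := h₁.seq ((Exec.ifTop_false (r := 0) (p := .push 1 true) (by simp)
        (.push 1 false _)).seq (.pop 0 _))
      refine ((Exec.while_step (by simp [hs]) (.ifTop_true (by simp [hs]) h₂)
        (.while_done (by simp))).mono (b' := _) ?_).congr ?_
      · simp
      · ext1 r
        by_cases r0 : r = 0
        · simp [r0]
        by_cases r1 : r = 1
        · simp [r1, RationalProofs.p1]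
        simp [r0, r1]
    | case3 z h h' =>
      intro s hs
      match z, h, h', hs with
      | [], _, _, hs =>
        refine ((Exec.while_done hs).mono (by simp)).congr ?_
        simp only [p1_nil, List.reverse_nil, List.nil_append, update_eq_self]
        rw [← hs, update_eq_self]
      | false :: l, _, _, hs =>
        refine ((Exec.while_step (by simp [hs]) (.ifTop_false (by simp [hs]) (exec_clear 0 s))
          (.while_done (by simp))).mono (b' := _) ?_).congr ?_
        · simp [hs]; omega
        · simp [RationalProofs.p1]
      | [true], _, h, _ => exact (h rfl).elim
      | true :: b :: l, h, _, _ => exact (h b l rfl).elim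
  refine (PolyTimeOn.of_prog (f := RationalProofs.p1) .fst (10 * Polynomial.X + 11) 2
    fun s hs => ?_).comp hf
  have h₂ := (loop _ s rfl).seq (exec_shift (r := 1) (r' := 0) (by simp) _)
  have e₁ := hs 1 (by simp) (by simp)
  refine (h₂.mono (b' := _) ?_).congr ?_
  · have := length_p1_add_length_p2_le (s 0)
    simp [e₁]
    omega
  · ext1 r
    by_cases r0 : r = 0
    · simp [r0, e₁]
    by_cases r1 : r = 1
    · simp [r1, e₁]
    simp [r0, r1]

theorem PolyTimeOn.p2 (hf : PolyTimeOn e f) : PolyTimeOn e fun a => p2 (f a) := by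
  have loop : ∀ (z : Str) (s : Store), s 0 = z →
      Exec (.whileNonempty 0 (.ifTop 0 (.seq (.pop 0) (.pop 0)) (.seq (.pop 0) (.shift 0 1)))) s
        (update (update s 1 ((RationalProofs.p2 z).reverse ++ s 1)) 0 []) (4 * z.length + 5) := by
    intro z
    induction z using p2.induct with
    | case1 b l ih =>
      intro s hs
      have h₁ := (Exec.pop 0 s).seq (.pop 0 _)
      have h₃ := ih (update (update s 0 (s 0).tail) 0 (update s 0 (s 0).tail 0).tail)
        (by simp [hs])
      refine ((Exec.while_step (by simp [hs]) (.ifTop_true (by simp [hs]) h₁)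
        h₃).mono (b' := _) ?_).congr ?_
      · simp only [List.length_cons]; omega
      · ext1 r
        by_cases r0 : r = 0
        · simp [r0]
        by_cases r1 : r = 1
        · simp [r1, RationalProofs.p2]
        simp [r0, r1]
    | case2 l =>
      intro s hs
      have h₁ := (Exec.pop 0 s).seq (exec_shift (r := 0) (r' := 1) (by simp) _)
      refine ((Exec.while_step (by simp [hs]) (.ifTop_false (by simp [hs]) h₁)
        (.while_done (by simp))).mono (b' := _) ?_).congr ?_
      · simp [hs]; omega
      · ext1 r
        by_cases r0 : r = 0
        · simp [r0]
        by_cases r1 : r = 1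
        · simp [r1, hs, RationalProofs.p2]
        simp [r0, r1]
    | case3 z h h' =>
      intro s hs
      match z, h, h', hs with
      | [], _, _, hs =>
        refine ((Exec.while_done hs).mono (by simp)).congr ?_
        simp only [p2_nil, List.reverse_nil, List.nil_append, update_eq_self]
        rw [← hs, update_eq_self]
      | [true], _, _, hs =>
        refine ((Exec.while_step (by simp [hs]) (.ifTop_true (by simp [hs])
          ((Exec.pop 0 s).seq (.pop 0 _))) (.while_done (by simp [hs]))).mono (b' := _) ?_).congr ?_
        · simp
        · simp [RationalProofs.p2, hs]
      | false :: l, _, h, _ => exact (h l rfl).elim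
      | true :: b :: l, h, _, _ => exact (h b l rfl).elim
  refine (PolyTimeOn.of_prog (f := RationalProofs.p2) .snd (8 * Polynomial.X + 10) 2
    fun s hs => ?_).comp hf
  have h₂ := (loop _ s rfl).seq (exec_shift (r := 1) (r' := 0) (by simp) _)
  have e₁ := hs 1 (by simp) (by simp)
  refine (h₂.mono (b' := _) ?_).congr ?_
  · have := length_p1_add_length_p2_le (s 0)
    simp [e₁]
    omega
  · ext1 r
    by_cases r0 : r = 0
    · simp [r0, e₁]
    by_cases r1 : r = 1
    · simp [r1, e₁]
    simp [r0, r1]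

/-! ### Decisions -/

open Classical in
/-- The predicate `P` is decidable in polynomial time. -/
def PolyTimeDec (e : α → Str) (P : α → Prop) : Prop :=
  PolyTimeOn e fun a => if P a then [true] else []

/-- The outcome of the test waits in a high register while the input is restored to register `0`; it
is erased before the chosen branch starts. -/
theorem PolyTimeOn.ite {P : α → Prop} [DecidablePred P] (hP : PolyTimeDec e P)
    (hf : PolyTimeOn e f) (hg : PolyTimeOn e g) : PolyTimeOn e fun a => if P a then f a else g a := by
  obtain ⟨N, h⟩ := PolyTimeOn.both hP (.self e)
  obtain ⟨n₁, p₁, q₁, h₁⟩ := hf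
  obtain ⟨n₂, p₂, q₂, h₂⟩ := hg
  obtain ⟨p, q, h⟩ := h (max N (max n₁ n₂)) (le_max_left _ _)
  set n := max N (max n₁ n₂) with hn
  have hn₁ : n₁ ≤ n := by omega
  have hn₂ : n₂ ≤ n := by omega
  refine ⟨n + 3, .seq p (.ifTop (n + 2) (.seq (.clear (n + 2)) p₁) (.seq (.clear (n + 2)) p₂)),
    q + (4 + q₁ + q₂), fun a s hs hc => ?_⟩
  have hclear : update (update (update s 0 (e a)) (n + 2) (if P a then [true] else []).reverse)
      (n + 2) [] = s := by
    rw [update_idem, ← hs, update_eq_self, ← hc (n + 2) (by simp) (by simp), update_eq_self]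
  have h₃ := exec_clear (n + 2) (update (update s 0 (e a)) (n + 2) (if P a then [true] else []).reverse)
  rw [hclear] at h₃
  have h₄ := h a s hs hc
  by_cases hPa : P a
  · simp only [hPa, if_true] at h₃ h₄ ⊢
    refine (h₄.seq (Exec.ifTop_true (by simp) (h₃.seq (h₁ a s hs fun r h h' =>
      hc r h (by omega))))).mono ?_
    simp; omega
  · simp only [hPa, if_false] at h₃ h₄ ⊢
    refine (h₄.seq (Exec.ifTop_false (by simp) (h₃.seq (h₂ a s hs fun r h h' =>
      hc r h (by omega))))).mono ?_
    simp; omega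

theorem PolyTimeDec.congr {P Q : α → Prop} (hP : PolyTimeDec e P) (h : ∀ a, P a ↔ Q a) :
    PolyTimeDec e Q := by
  have : P = Q := funext fun a => propext (h a)
  rwa [← this]

theorem PolyTimeDec.not {P : α → Prop} (hP : PolyTimeDec e P) : PolyTimeDec e fun a => ¬ P a := by
  classical
  refine PolyTimeOn.congr (.ite hP (.const e []) (.const e [true])) fun a => ?_
  by_cases h : P a <;> simp [h]

theorem PolyTimeDec.and {P Q : α → Prop} (hP : PolyTimeDec e P) (hQ : PolyTimeDec e Q) :
    PolyTimeDec e fun a => P a ∧ Q a := by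
  classical
  refine PolyTimeOn.congr (.ite hP hQ (.const e [])) fun a => ?_
  by_cases h : P a <;> by_cases h' : Q a <;> simp [h, h']

theorem PolyTimeDec.iff {P Q : α → Prop} (hP : PolyTimeDec e P) (hQ : PolyTimeDec e Q) :
    PolyTimeDec e fun a => P a ↔ Q a := by
  classical
  refine PolyTimeOn.congr (.ite hP hQ hQ.not) fun a => ?_
  by_cases h : P a <;> by_cases h' : Q a <;> simp [h, h']

theorem PolyTimeOn.head_true (hf : PolyTimeOn e f) :
    PolyTimeDec e fun a => (f a).head? = some true := by
  classical
  refine PolyTimeOn.congr ((PolyTimeOn.of_prog (f := fun x => if x.head? = some true then [true] else [])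
    (.ifTop 0 (.seq (.clear 0) (.push 0 true)) (.clear 0)) (2 * Polynomial.X + 3) 0
    fun s hs => ?_).comp hf) ?_
  · by_cases h : (s 0).head? = some true
    · have := (exec_clear 0 s).seq (.push 0 true _)
      rw [update_self, update_idem] at this
      rw [if_pos h]
      exact (Exec.ifTop_true h this).mono (by simp; omega)
    · rw [if_neg h]
      exact (Exec.ifTop_false h (exec_clear 0 s)).mono (by simp)
  · intro a; congr

theorem PolyTimeOn.eq_nil (hf : PolyTimeOn e f) : PolyTimeDec e fun a => f a = [] := by
  classical
  refine PolyTimeOn.congr ((PolyTimeOn.of_prog (f := fun x => if x = [] then [true] else [])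
    (.seq (.push 1 true) (.seq (.whileNonempty 0 (.seq (.clear 0) (.pop 1))) (.shift 1 0)))
    (2 * Polynomial.X + 11) 2 fun s hs => ?_).comp hf) ?_
  · have e₁ := hs 1 (by simp) (by simp)
    have h₁ := Exec.push 1 true s
    rw [e₁] at h₁
    by_cases h : s 0 = []
    · have h₂ := h₁.seq ((Exec.while_done (r := 0) (p := .seq (.clear 0) (.pop 1)) (by simp [h])).seq
        (exec_shift (r := 1) (r' := 0) (by simp) _))
      refine (h₂.mono (b' := _) ?_).congr ?_
      · simp
      · rw [if_pos h]
        ext1 r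
        by_cases r0 : r = 0
        · simp [r0, h]
        by_cases r1 : r = 1
        · simp [r1, e₁]
        simp [r0, r1]
    · have h₂ := h₁.seq ((Exec.while_step (r := 0) (by simp [h]) ((exec_clear 0 _).seq (.pop 1 _))
        (.while_done (by simp))).seq (exec_shift (r := 1) (r' := 0) (by simp) _))
      refine (h₂.mono (b' := _) ?_).congr ?_
      · simp; omega
      · rw [if_neg h]
        ext1 r
        by_cases r0 : r = 0
        · simp [r0]
        by_cases r1 : r = 1
        · simp [r1, e₁]
        simp [r0, r1]
  · intro a; congr

/-! ### Iteration -/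

/-- The counter sits in a high register and loses one bit per pass. The bound `B` on all
intermediate states cannot be dropped: a polynomial-time step may double the length of its argument.
-/
theorem PolyTimeOn.iterate {eσ : σ → Str} {step : σ → σ} {init : α → σ} {cnt : α → Str}
    (hstep : PolyTimeOn eσ fun s => eσ (step s)) (hinit : PolyTimeOn e fun a => eσ (init a))
    (hcnt : PolyTimeOn e cnt) (B : Polynomial ℕ)
    (hB : ∀ a i, i ≤ (cnt a).length → (eσ (step^[i] (init a))).length ≤ B.eval (e a).length) :
    PolyTimeOn e fun a => eσ (step^[(cnt a).length] (init a)) := by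
  obtain ⟨q', hq'⟩ := hcnt.length_le
  obtain ⟨N, h⟩ := hcnt.both hinit
  obtain ⟨n₁, p₁, q₁, h₁⟩ := hstep
  obtain ⟨p, q, h⟩ := h (max N n₁) (le_max_left _ _)
  set n := max N n₁ with hn
  have hn₁ : n₁ ≤ n := by omega
  have loop : ∀ (L : ℕ) (l : Str) (st : σ) (s : Store), s 0 = eσ st →
      (∀ r, 0 < r → r < n₁ → s r = []) → s (n + 2) = l →
      (∀ i ≤ l.length, (eσ (step^[i] st)).length ≤ L) →
      Exec (.whileNonempty (n + 2) (.seq (.pop (n + 2)) p₁)) s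
        (update (update s 0 (eσ (step^[l.length] st))) (n + 2) [])
        (l.length * (q₁.eval L + 2) + 1) := by
    intro L l
    induction l with
    | nil =>
      intro st s hs hc hl hL
      refine ((Exec.while_done hl).mono (by simp)).congr ?_
      rw [List.length_nil, iterate_zero, id, ← hs, update_eq_self, ← hl, update_eq_self]
    | cons b l ih =>
      intro st s hs hc hl hL
      have h₂ := Exec.pop (n + 2) s
      rw [hl, List.tail_cons] at h₂
      have h₃ := h₁ st (update s (n + 2) l) (by simpa using hs) (fun r hr hr' => by
        rw [update_of_ne (by omega)]; exact hc r hr hr')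
      have h₄ := ih (step st) (update (update s (n + 2) l) 0 (eσ (step st))) (by simp)
        (fun r hr hr' => by
          rw [update_of_ne (by omega), update_of_ne (by omega)]; exact hc r hr hr') (by simp)
        (fun i hi => by simpa using hL (i + 1) (by simpa using hi))
      refine ((Exec.while_step (by simp [hl]) (h₂.seq h₃) h₄).mono (b' := _) ?_).congr ?_
      · have := polynomial_eval_mono q₁ (hL 0 (by simp))
        simp only [iterate_zero, id] at this
        simp only [List.length_cons]
        nlinarith
      · rw [update_idem, List.length_cons, iterate_succ_apply, update_comm (by simp), update_idem,
          update_comm (by simp)]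
  refine ⟨n + 3, .seq p (.whileNonempty (n + 2) (.seq (.pop (n + 2)) p₁)),
    q + (q' * (q₁.comp B + 2) + 1), fun a s hs hc => ?_⟩
  have h₂ := h a s hs hc
  have h₃ := loop (B.eval (e a).length) (cnt a).reverse (init a)
    (update (update s 0 (eσ (init a))) (n + 2) (cnt a).reverse) (by simp) (fun r hr hr' => by
      rw [update_of_ne (by omega), update_of_ne (by omega)]; exact hc r hr (by omega)) (by simp)
      (by simpa using hB a)
  refine ((h₂.seq h₃).mono (b' := _) ?_).congr ?_
  · have := Nat.mul_le_mul_right (q₁.eval (B.eval (e a).length) + 2) (hq' a)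
    simpa using this
  · rw [update_comm (a := n + 2) (b := 0) (by simp), update_idem, update_idem, List.length_reverse,
      update_comm (by simp), ← hc (n + 2) (by simp) (by simp), update_eq_self]

/-! ### Derived functions -/

/-- A pair of strings as a string. -/
def encPair (x : Str × Str) : Str := pr x.1 x.2

theorem polyTimeOn_encPair_fst : PolyTimeOn encPair fun x => x.1 := by
  simpa [encPair] using (PolyTimeOn.self encPair).p1

theorem polyTimeOn_encPair_snd : PolyTimeOn encPair fun x => x.2 := by
  simpa [encPair] using (PolyTimeOn.self encPair).p2

theorem PolyTimeOn.zeros (hf : PolyTimeOn e f) :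
    PolyTimeOn e fun a => List.replicate (f a).length false := by
  obtain ⟨q, hq⟩ := hf.length_le
  have hi : ∀ i, (fun x : Str => false :: x)^[i] [] = List.replicate i false := by
    intro i
    induction i with
    | zero => rfl
    | succ i ih => rw [iterate_succ_apply', ih, List.replicate_succ]
  have := PolyTimeOn.iterate (eσ := id) (step := fun x => false :: x) (init := fun _ => [])
    ((PolyTimeOn.self id).cons false) (.nil e) hf q
    (fun a i h => by simpa [hi] using h.trans (hq a))
  simpa [hi] using this

theorem PolyTimeOn.zeros_mul (hf : PolyTimeOn e f) (hg : PolyTimeOn e g) :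
    PolyTimeOn e fun a => List.replicate ((f a).length * (g a).length) false := by
  obtain ⟨q, hq⟩ := hf.length_le
  obtain ⟨q', hq'⟩ := hg.length_le
  have hi : ∀ n i, (fun x : Str × Str => (x.1, x.1 ++ x.2))^[i] (List.replicate n false, []) =
      (List.replicate n false, List.replicate (n * i) false) := by
    intro n i
    induction i with
    | zero => rfl
    | succ i ih => rw [iterate_succ_apply', ih, ← List.replicate_add]; congr 2; ring
  have := PolyTimeOn.iterate (eσ := encPair) (step := fun x => (x.1, x.1 ++ x.2))
    (init := fun a => (List.replicate (f a).length false, []))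
    (polyTimeOn_encPair_fst.pr (polyTimeOn_encPair_fst.append polyTimeOn_encPair_snd))
    (hf.zeros.pr (.nil e)) hg (2 * q + 1 + q * q')
    (fun a i h => by
      have := Nat.mul_le_mul (hq a) (h.trans (hq' a))
      have := hq a
      simp [hi, encPair]; omega)
  simpa [hi, encPair] using this.p2

theorem PolyTimeOn.zeros_poly (hf : PolyTimeOn e f) (q : Polynomial ℕ) :
    PolyTimeOn e fun a => List.replicate (q.eval (f a).length) false := by
  induction q using Polynomial.induction_on' with
  | add p q hp hq =>
    refine PolyTimeOn.congr (hp.append hq) fun a => ?_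
    rw [Polynomial.eval_add, List.replicate_add]
  | monomial n c =>
    simp only [Polynomial.eval_monomial]
    induction n with
    | zero => simpa using PolyTimeOn.const e (List.replicate c false)
    | succ n ih => simpa [pow_succ, mul_assoc] using ih.zeros_mul hf

theorem iterate_tail (l : Str) (n : ℕ) : List.tail^[n] l = l.drop n := by
  induction n with
  | zero => rfl
  | succ n ih => rw [iterate_succ_apply', ih, List.tail_drop]

theorem PolyTimeOn.drop (hf : PolyTimeOn e f) (hg : PolyTimeOn e g) :
    PolyTimeOn e fun a => (g a).drop (f a).length := by
  obtain ⟨q, hq⟩ := hg.length_le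
  have := PolyTimeOn.iterate (eσ := id) (step := List.tail) (init := g)
    (PolyTimeOn.self id).tail hg hf q
    (fun a i h => by have := hq a; simp [iterate_tail]; omega)
  simpa [iterate_tail] using this

theorem PolyTimeOn.iterate_p2 (hf : PolyTimeOn e f) (hg : PolyTimeOn e g) :
    PolyTimeOn e fun a => RationalProofs.p2^[(f a).length] (g a) := by
  obtain ⟨q, hq⟩ := hg.length_le
  have hl : ∀ i l, (RationalProofs.p2^[i] l).length ≤ l.length := by
    intro i l
    induction i with
    | zero => rfl
    | succ i ih =>
      rw [iterate_succ_apply']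
      exact (length_p2_le _).trans ih
  have := PolyTimeOn.iterate (eσ := id) (step := RationalProofs.p2) (init := g)
    (PolyTimeOn.self id).p2 hg hf q (fun a i h => (hl i _).trans (hq a))
  simpa using this

theorem PolyTimeOn.take_one (hf : PolyTimeOn e f) : PolyTimeOn e fun a => (f a).take 1 := by
  classical
  have := PolyTimeOn.ite hf.eq_nil (.nil e) (.ite hf.head_true (.const e [true]) (.const e [false]))
  convert this using 2 with a
  rcases f a with _ | ⟨_ | _, l⟩ <;> simp

theorem PolyTimeOn.take (hf : PolyTimeOn e f) (hg : PolyTimeOn e g) :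
    PolyTimeOn e fun a => (g a).take (f a).length := by
  obtain ⟨q, hq⟩ := hg.length_le
  have hi : ∀ l i, (fun x : Str × Str => (x.1.tail, x.2 ++ x.1.take 1))^[i] (l, []) =
      (l.drop i, l.take i) := by
    intro l i
    induction i with
    | zero => rfl
    | succ i ih => rw [iterate_succ_apply', ih, List.tail_drop, List.take_add]
  have := PolyTimeOn.iterate (eσ := encPair) (step := fun x => (x.1.tail, x.2 ++ x.1.take 1))
    (init := fun a => (g a, []))
    (polyTimeOn_encPair_fst.tail.pr (polyTimeOn_encPair_snd.append polyTimeOn_encPair_fst.take_one))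
    (hg.pr (.nil e)) hf (2 * q + 1 + q)
    (fun a i h => by
      have := hq a
      simp [hi, encPair]; omega)
  simpa [hi, encPair] using this.p2

theorem PolyTimeOn.eq (hf : PolyTimeOn e f) (hg : PolyTimeOn e g) :
    PolyTimeDec e fun a => f a = g a := by
  classical
  obtain ⟨q, hq⟩ := hf.length_le
  obtain ⟨q', hq'⟩ := hg.length_le
  -- A step removes a common first bit and is stuck as soon as the strings disagree. Comparing
  -- emptiness separately is necessary because the test for `some true` does not tell `[]` from a
  -- leading `false`.
  set step : Str × Str → Str × Str := fun x =>
    if (x.1.head? = some true ↔ x.2.head? = some true) ∧ (x.1 = [] ↔ x.2 = []) then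
      (x.1.tail, x.2.tail) else x with hstep
  have hl : ∀ i x, (encPair (step^[i] x)).length ≤ (encPair x).length := by
    intro i x
    induction i with
    | zero => rfl
    | succ i ih =>
      rw [iterate_succ_apply']
      refine le_trans ?_ ih
      generalize step^[i] x = z
      simp only [hstep]
      split_ifs
      · simp [encPair]; omega
      · rfl
  have hfix : ∀ i x, step x = x → step^[i] x = x := fun i x h => iterate_fixed h i
  have key : ∀ x y, ((step^[x.length] (x, y)).1 = [] ∧ (step^[x.length] (x, y)).2 = []) ↔
      x = y := by
    intro x
    induction x with
    | nil => intro y; simp [eq_comm]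
    | cons b x ih =>
      intro y
      rw [List.length_cons, iterate_succ_apply]
      have hne : ∀ y, (b :: x) ≠ y → step (b :: x, y) = (b :: x, y) →
          (((step^[x.length] (step (b :: x, y))).1 = [] ∧
            (step^[x.length] (step (b :: x, y))).2 = []) ↔ b :: x = y) := by
        intro y h h'
        rw [h', hfix _ _ h']
        simp [h]
      rcases y with _ | ⟨b', y⟩
      · exact hne _ (by simp) (by simp [hstep])
      · by_cases hb : b = b'
        · subst hb
          have : step (b :: x, b :: y) = (x, y) := by simp [hstep]
          rw [this, ih, List.cons.injEq]
          simp
        · refine hne _ (by simp [hb]) ?_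
          cases b <;> cases b' <;> simp_all
  have hs : PolyTimeOn encPair fun x => encPair (step x) := by
    have h₁ := polyTimeOn_encPair_fst
    have h₂ := polyTimeOn_encPair_snd
    have := PolyTimeOn.ite ((h₁.head_true.iff h₂.head_true).and (h₁.eq_nil.iff h₂.eq_nil))
      (h₁.tail.pr h₂.tail) (h₁.pr h₂)
    convert this using 2 with x
    simp only [hstep]
    split_ifs <;> rfl
  have := PolyTimeOn.iterate (eσ := encPair) (step := step) (init := fun a => (f a, g a)) hs
    (hf.pr hg) hf (2 * q + 1 + q') (fun a i _ => (hl i _).trans (by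
      have := hq a; have := hq' a; simp [encPair]; omega))
  refine (this.p1.eq_nil.and this.p2.eq_nil).congr fun a => ?_
  simp only [encPair, p1_pr, p2_pr, key]

theorem PolyTimeOn.encode_map_range {F : ℕ → α → Str} {n : ℕ} (h : ∀ i < n, PolyTimeOn e (F i)) :
    PolyTimeOn e fun a => encode ((List.range n).map fun i => F i a) := by
  induction n with
  | zero => exact .nil e
  | succ n ih =>
    simp only [List.range_succ, List.map_append, encode_append, List.map_cons, List.map_nil,
      encode_singleton]
    exact (ih fun i hi => h i (by omega)).append ((h n (by omega)).pr (.nil e))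

end

theorem PolyTimeOn.nth {α : Type*} {e f : α → Str} (hf : PolyTimeOn e f) (i : ℕ) :
    PolyTimeOn e fun a => nth i (f a) := by
  refine PolyTimeOn.p1 ?_
  induction i with
  | zero => exact hf
  | succ i ih =>
    simp only [iterate_succ_apply']
    exact ih.p2

/-! ## Simulation of oracle machines with supplied answers -/

/-- The state of the simulation of an oracle machine: every instruction consumes fuel, `ctr` is the
number of oracle calls that are still allowed, and `ans` supplies their answers. -/
structure SimState where
  fuel : Str
  ctr : Str
  ans : Str
  reg : Store

/-- A state as a string, if only the first `n` registers are in use. -/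
def SimState.enc (n : ℕ) (σ : SimState) : Str :=
  pr σ.fuel (pr σ.ctr (pr σ.ans (encode ((List.range n).map σ.reg))))

/-- The entry with index `i` of a list of entries `(answer, message)`. -/
def entry (i : ℕ) (ans : Str) : Str := p1 (p2^[i] ans)

/-- The simulation of a program. When the fuel is exhausted the state does not change any more. An
oracle call that is not allowed exhausts the fuel and leaves the query in register `0`. -/
def sim : Prog → SimState → SimState
  | .skip, σ => σ
  | .push r b, σ =>
      if σ.fuel = [] then σ
      else ⟨σ.fuel.tail, σ.ctr, σ.ans, update σ.reg r (b :: σ.reg r)⟩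
  | .pop r, σ =>
      if σ.fuel = [] then σ
      else ⟨σ.fuel.tail, σ.ctr, σ.ans, update σ.reg r (σ.reg r).tail⟩
  | .seq p q, σ => sim q (sim p σ)
  | .ifTop r p q, σ => if (σ.reg r).head? = some true then sim p σ else sim q σ
  | .whileNonempty r p, σ =>
      -- Each genuine pass burns a unit of fuel, so as many rounds as there is fuel suffice; surplus
      -- rounds change nothing.
      (fun τ : SimState => if τ.fuel = [] ∨ τ.reg r = [] then τ
        else sim p ⟨τ.fuel.tail, τ.ctr, τ.ans, τ.reg⟩)^[σ.fuel.length] σ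
  | .query q a, σ =>
      if σ.fuel = [] then σ
      -- Wiping the other registers keeps `SimState.size` from growing when the query is copied to
      -- register `0`.
      else if σ.ctr = [] then ⟨[], [], σ.ans, update (fun _ => []) 0 (σ.reg q)⟩
      else if σ.fuel.drop (p1 (entry 0 σ.ans)).length = [] then ⟨[], σ.ctr, σ.ans, σ.reg⟩
      else ⟨(σ.fuel.drop (p1 (entry 0 σ.ans)).length).tail, σ.ctr.tail, p2 σ.ans,
        update σ.reg a (p1 (entry 0 σ.ans))⟩

theorem sim_of_fuel_nil (p : Prog) {σ : SimState} (h : σ.fuel = []) : sim p σ = σ := by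
  induction p generalizing σ with
  | skip => rfl
  | push r b => simp [sim, h]
  | pop r => simp [sim, h]
  | seq p q ihp ihq => rw [sim, ihp h, ihq h]
  | ifTop r p q ihp ihq => rw [sim, ihp h, ihq h, ite_self]
  | whileNonempty r p ih => rw [sim, h]; rfl
  | query q a => simp [sim, h]

/-- The amount of fuel and of storage in use. -/
def SimState.size (n : ℕ) (σ : SimState) : ℕ :=
  σ.fuel.length + ∑ i ∈ Finset.range n, (σ.reg i).length

theorem sum_length_update (n r : ℕ) (hr : r < n) (s : Store) (v : Str) :
    ∑ i ∈ Finset.range n, (update s r v i).length + (s r).length =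
      ∑ i ∈ Finset.range n, (s i).length + v.length := by
  have h := Finset.mem_range.2 hr
  rw [← Finset.add_sum_erase _ _ h, ← Finset.add_sum_erase _ (fun i => (s i).length) h,
    Finset.sum_congr rfl fun i hi => by rw [update_of_ne (Finset.ne_of_mem_erase hi)], update_self]
  omega

/-- A pushed bit is paid for with a unit of fuel, and a supplied answer with its length. Hence fuel
plus storage never grows, even when the supplied answers are false or of arbitrary length. -/
theorem sim_le (n : ℕ) (p : Prog) (hp : p.bound ≤ n) (σ : SimState) :
    (sim p σ).size n ≤ σ.size n ∧ (sim p σ).fuel.length ≤ σ.fuel.length ∧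
      (sim p σ).ctr.length ≤ σ.ctr.length ∧ (sim p σ).ans.length ≤ σ.ans.length := by
  induction p generalizing σ with
  | skip => simp [sim]
  | push r b =>
    rw [sim]
    split_ifs with h
    · simp
    · have hr : r < n := hp
      have := sum_length_update n r hr σ.reg (b :: σ.reg r)
      have := List.length_pos_iff.2 h
      simp [SimState.size] at *
      omega
  | pop r =>
    rw [sim]
    split_ifs with h
    · simp
    · have hr : r < n := hp
      have := sum_length_update n r hr σ.reg (σ.reg r).tail
      simp [SimState.size] at *
      omega
  | seq p q ihp ihq =>
    simp only [Prog.bound, max_le_iff] at hp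
    have h₁ := ihp hp.1 σ
    have h₂ := ihq hp.2 (sim p σ)
    simp only [sim]
    omega
  | ifTop r p q ihp ihq =>
    simp only [Prog.bound, max_le_iff] at hp
    rw [sim]
    split_ifs
    · exact ihp hp.2.1 σ
    · exact ihq hp.2.2 σ
  | whileNonempty r p ih =>
    simp only [Prog.bound, max_le_iff] at hp
    suffices h : ∀ k, ((fun τ : SimState => if τ.fuel = [] ∨ τ.reg r = [] then τ
        else sim p ⟨τ.fuel.tail, τ.ctr, τ.ans, τ.reg⟩)^[k] σ).size n ≤ σ.size n ∧
        ((fun τ : SimState => if τ.fuel = [] ∨ τ.reg r = [] then τ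
        else sim p ⟨τ.fuel.tail, τ.ctr, τ.ans, τ.reg⟩)^[k] σ).fuel.length ≤ σ.fuel.length ∧
        ((fun τ : SimState => if τ.fuel = [] ∨ τ.reg r = [] then τ
        else sim p ⟨τ.fuel.tail, τ.ctr, τ.ans, τ.reg⟩)^[k] σ).ctr.length ≤ σ.ctr.length ∧
        ((fun τ : SimState => if τ.fuel = [] ∨ τ.reg r = [] then τ
        else sim p ⟨τ.fuel.tail, τ.ctr, τ.ans, τ.reg⟩)^[k] σ).ans.length ≤ σ.ans.length from h _
    intro k
    induction k with
    | zero => simp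
    | succ k ihk =>
      rw [iterate_succ_apply']
      generalize (fun τ : SimState => if τ.fuel = [] ∨ τ.reg r = [] then τ
        else sim p ⟨τ.fuel.tail, τ.ctr, τ.ans, τ.reg⟩)^[k] σ = τ at ihk
      split_ifs
      · exact ihk
      · have := ih hp.2 ⟨τ.fuel.tail, τ.ctr, τ.ans, τ.reg⟩
        simp [SimState.size] at *
        omega
  | query q a =>
    simp only [Prog.bound, max_le_iff] at hp
    rw [sim]
    split_ifs with h h' h''
    · simp
    · have h₁ := sum_length_update n 0 (by omega) (fun _ => []) (σ.reg q)
      have h₂ := Finset.single_le_sum (f := fun i => (σ.reg i).length) (fun i _ => Nat.zero_le _)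
        (Finset.mem_range.2 (show q < n by omega))
      simp [SimState.size] at *
      omega
    · simp [SimState.size]
    · have h₁ := sum_length_update n a (by omega) σ.reg (p1 (entry 0 σ.ans))
      have h₂ := List.length_pos_iff.2 h''
      have h₃ := length_p2_le σ.ans
      simp only [SimState.size, List.length_tail, List.length_drop] at *
      omega

theorem SimState.length_enc (n : ℕ) (σ : SimState) :
    (σ.enc n).length = 2 * σ.size n + 2 * σ.ctr.length + 2 * σ.ans.length + 3 + n := by
  have : (encode ((List.range n).map σ.reg)).length =
      2 * ∑ i ∈ Finset.range n, (σ.reg i).length + n := by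
    induction n with
    | zero => rfl
    | succ n ih =>
      rw [List.range_succ, List.map_append, encode_append, List.length_append, ih,
        Finset.sum_range_succ, List.map_singleton, encode_singleton, length_pr]
      simp; omega
  simp only [enc, size, length_pr, this]
  omega

theorem length_enc_sim_le (n : ℕ) (p : Prog) (hp : p.bound ≤ n) (σ : SimState) :
    ((sim p σ).enc n).length ≤ (σ.enc n).length := by
  have := sim_le n p hp σ
  simp only [SimState.length_enc]
  omega

section PolyTime

variable {n : ℕ}

theorem polyTimeOn_fuel : PolyTimeOn (SimState.enc n) SimState.fuel := by
  simpa [SimState.enc] using (PolyTimeOn.self (SimState.enc n)).p1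

theorem polyTimeOn_ctr : PolyTimeOn (SimState.enc n) SimState.ctr := by
  simpa [SimState.enc] using (PolyTimeOn.self (SimState.enc n)).p2.p1

theorem polyTimeOn_ans : PolyTimeOn (SimState.enc n) SimState.ans := by
  simpa [SimState.enc] using (PolyTimeOn.self (SimState.enc n)).p2.p2.p1

theorem polyTimeOn_reg {i : ℕ} (hi : i < n) : PolyTimeOn (SimState.enc n) fun σ => σ.reg i := by
  simpa [SimState.enc, nth_encode, hi] using (PolyTimeOn.self (SimState.enc n)).p2.p2.p2.nth i

theorem PolyTimeOn.simState {α : Type*} {e F C A : α → Str} {R : α → Store}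
    (hF : PolyTimeOn e F) (hC : PolyTimeOn e C) (hA : PolyTimeOn e A)
    (hR : ∀ i < n, PolyTimeOn e fun a => R a i) :
    PolyTimeOn e fun a => SimState.enc n ⟨F a, C a, A a, R a⟩ :=
  hF.pr (hC.pr (hA.pr (.encode_map_range (F := fun i a => R a i) hR)))

theorem polyTimeOn_update {r : ℕ} {v : SimState → Str} (hv : PolyTimeOn (SimState.enc n) v) (i : ℕ)
    (hi : i < n) : PolyTimeOn (SimState.enc n) fun σ => update σ.reg r (v σ) i := by
  by_cases h : i = r
  · subst h; simpa using hv
  · simpa [h] using polyTimeOn_reg hi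

/-- Recursion on the fixed program: a loop becomes an application of `PolyTimeOn.iterate`, whose
size hypothesis holds because states never get longer. -/
theorem polyTimeOn_sim (p : Prog) (hp : p.bound ≤ n) :
    PolyTimeOn (SimState.enc n) fun σ => (sim p σ).enc n := by
  classical
  have hself := PolyTimeOn.self (SimState.enc n)
  induction p with
  | skip => exact hself
  | push r b =>
    simp only [sim, apply_ite (SimState.enc n)]
    exact .ite polyTimeOn_fuel.eq_nil hself (.simState polyTimeOn_fuel.tail polyTimeOn_ctr
      polyTimeOn_ans (polyTimeOn_update ((polyTimeOn_reg hp).cons b)))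
  | pop r =>
    simp only [sim, apply_ite (SimState.enc n)]
    exact .ite polyTimeOn_fuel.eq_nil hself (.simState polyTimeOn_fuel.tail polyTimeOn_ctr
      polyTimeOn_ans (polyTimeOn_update (polyTimeOn_reg hp).tail))
  | seq p q ihp ihq =>
    simp only [Prog.bound, max_le_iff] at hp
    exact (ihq hp.2).comp' (ihp hp.1)
  | ifTop r p q ihp ihq =>
    simp only [Prog.bound, max_le_iff] at hp
    simp only [sim, apply_ite (SimState.enc n)]
    exact .ite (polyTimeOn_reg hp.1).head_true (ihp hp.2.1) (ihq hp.2.2)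
  | whileNonempty r p ih =>
    simp only [Prog.bound, max_le_iff] at hp
    refine PolyTimeOn.iterate (init := id) ?_ hself polyTimeOn_fuel Polynomial.X fun σ i _ => ?_
    · simp only [apply_ite (SimState.enc n)]
      have h₁ := polyTimeOn_fuel.eq_nil.not.and (polyTimeOn_reg hp.1).eq_nil.not
      refine .ite (h₁.not.congr fun σ => by tauto) hself ((ih hp.2).comp' ?_)
      exact .simState polyTimeOn_fuel.tail polyTimeOn_ctr polyTimeOn_ans fun i hi => polyTimeOn_reg hi
    · rw [Polynomial.eval_X]
      induction i with
      | zero => rfl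
      | succ i ihi =>
        rw [iterate_succ_apply']
        refine le_trans ?_ (ihi (by omega))
        split_ifs
        · rfl
        · refine (length_enc_sim_le n p hp.2 _).trans ?_
          simp [SimState.length_enc, SimState.size]
  | query q a =>
    simp only [Prog.bound, max_le_iff] at hp
    simp only [sim, apply_ite (SimState.enc n)]
    have hy : PolyTimeOn (SimState.enc n) fun σ => p1 (entry 0 σ.ans) := polyTimeOn_ans.p1.p1
    refine .ite polyTimeOn_fuel.eq_nil hself (.ite polyTimeOn_ctr.eq_nil
      (.simState (.nil _) (.nil _) polyTimeOn_ans fun i hi => ?_)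
      (.ite (hy.drop polyTimeOn_fuel).eq_nil
        (.simState (.nil _) polyTimeOn_ctr polyTimeOn_ans fun i hi => polyTimeOn_reg hi)
        (.simState (hy.drop polyTimeOn_fuel).tail polyTimeOn_ctr.tail polyTimeOn_ans.p2
          (polyTimeOn_update hy))))
    by_cases h : i = 0
    · subst h; simpa using polyTimeOn_reg hp.1
    · simpa [h] using PolyTimeOn.nil (SimState.enc n)

end PolyTime

/-- Such a map has reached a fixed point after `μ x` rounds, so further rounds are harmless. -/
theorem iterate_eq_of_measure {σ : Type*} {g : σ → σ} {μ : σ → ℕ}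
    (h : ∀ x, g x = x ∨ μ (g x) < μ x) {m : ℕ} {x : σ} (hm : μ x ≤ m) : g^[m] x = g^[μ x] x := by
  have hfix : ∀ m x, μ x ≤ m → g (g^[m] x) = g^[m] x := by
    intro m
    induction m with
    | zero =>
      intro x hx
      exact (h x).resolve_right (by omega)
    | succ m ih =>
      intro x hx
      rcases h x with h | h
      · rw [iterate_fixed h, h]
      · rw [iterate_succ_apply]
        exact ih _ (by omega)
  obtain ⟨k, rfl⟩ := Nat.exists_eq_add_of_le' hm
  rw [iterate_add_apply]
  exact iterate_fixed (hfix _ x le_rfl) k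

/-- After one pass the prescribed number of rounds is the old fuel minus one on the left and the new
fuel on the right. Both are enough to reach the same fixed point. -/
theorem sim_while {r : ℕ} {p : Prog} {σ : SimState} (h : σ.fuel ≠ []) (h' : σ.reg r ≠ []) :
    sim (.whileNonempty r p) σ =
      sim (.whileNonempty r p) (sim p ⟨σ.fuel.tail, σ.ctr, σ.ans, σ.reg⟩) := by
  obtain ⟨b, F, hF⟩ := List.exists_cons_of_ne_nil h
  have hle : ∀ τ : SimState, (sim p ⟨τ.fuel.tail, τ.ctr, τ.ans, τ.reg⟩).fuel.length ≤
      τ.fuel.tail.length := fun τ => (sim_le _ p le_rfl _).2.1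
  simp only [sim]
  rw [hF, List.length_cons, iterate_succ_apply, if_neg (not_or.2 ⟨h, h'⟩), ← hF]
  refine iterate_eq_of_measure (μ := fun τ : SimState => τ.fuel.length) (fun τ => ?_) ?_
  · by_cases hτ : τ.fuel = [] ∨ τ.reg r = []
    · exact .inl (if_pos hτ)
    · right
      rw [if_neg hτ]
      have := List.length_pos_iff.2 (not_or.1 hτ).1
      have := hle τ
      rw [List.length_tail] at this
      omega
  · simpa [hF] using hle σ

/-- The entries of the list `ans` supply the answers of the oracle `f` to the queries `qs`. -/
def Answers (f : Str → Str) : List Str → Str → Prop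
  | [], _ => True
  | q :: qs, ans => p1 (entry 0 ans) = f q ∧ Answers f qs (p2 ans)

theorem answers_append {f : Str → Str} {l l' : List Str} {ans : Str} :
    Answers f (l ++ l') ans ↔ Answers f l ans ∧ Answers f l' (p2^[l.length] ans) := by
  induction l generalizing ans with
  | nil => simp [Answers]
  | cons q l ih => simp [Answers, ih, and_assoc]

/-- The simulation `F` leads from the store `s` to the store `s'` with `t` units of fuel and the
oracle calls `qs`. -/
def Tracks (f : Str → Str) (F : SimState → SimState) (s s' : Store) (t : ℕ) (qs : List Str) : Prop :=
  ∀ σ : SimState, σ.reg = s → t < σ.fuel.length →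
    -- The first clause treats runs in which every call is allowed and correctly answered; the
    -- second treats runs stopped at call `q` because the allowance is used up. The strict
    -- inequality `t < σ.fuel.length` leaves fuel at the end of a completed run, so that running dry
    -- is a stop signal.
    (qs.length ≤ σ.ctr.length → Answers f qs σ.ans → ∃ fuel, σ.fuel.length ≤ fuel.length + t ∧
      F σ = ⟨fuel, σ.ctr.drop qs.length, p2^[qs.length] σ.ans, s'⟩) ∧
    ∀ l q l', qs = l ++ q :: l' → σ.ctr.length = l.length → Answers f l σ.ans →
      (F σ).fuel = [] ∧ (F σ).reg 0 = q

theorem Tracks.comp {f : Str → Str} {F G : SimState → SimState} {s s' s'' : Store} {t t' : ℕ}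
    {qs qs' : List Str} (hF : Tracks f F s s' t qs) (hG : Tracks f G s' s'' t' qs')
    (hG' : ∀ σ : SimState, σ.fuel = [] → G σ = σ) :
    Tracks f (fun σ => G (F σ)) s s'' (t + t') (qs ++ qs') := by
  intro σ hσ ht
  obtain ⟨h₁, h₂⟩ := hF σ hσ (by omega)
  refine ⟨fun hl ha => ?_, fun l q l' hl hc ha => ?_⟩
  · rw [List.length_append] at hl
    rw [answers_append] at ha
    obtain ⟨fuel, hf, h₁⟩ := h₁ (by omega) ha.1
    obtain ⟨fuel', hf', h₃⟩ := (hG (F σ) (by rw [h₁]) (by rw [h₁]; simp; omega)).1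
      (by rw [h₁]; simp; omega) (by rw [h₁]; exact ha.2)
    refine ⟨fuel', ?_, h₃.trans ?_⟩
    · rw [h₁] at hf'
      simp at hf'
      omega
    · simp only [h₁, List.drop_drop, List.length_append, ← iterate_add_apply]
      rw [add_comm qs'.length]
  -- The refused call belongs to `G` in the first case. In the second it belongs to `G` as its very
  -- first call (`l₁ = []`) or to `F`; if it belongs to `F`, the fuel is gone and `G` does nothing.
  · rcases List.append_eq_append_iff.1 hl with ⟨l₁, rfl, hl₁⟩ | ⟨l₁, rfl, hl₁⟩
    · rw [answers_append] at ha
      rw [List.length_append] at hc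
      obtain ⟨fuel, hf, h₁⟩ := h₁ (by omega) ha.1
      refine (hG _ (by rw [h₁]) (by rw [h₁]; simp; omega)).2 l₁ q l' hl₁ ?_ ?_
      · rw [h₁]; simp; omega
      · rw [h₁]; exact ha.2
    · rcases l₁ with _ | ⟨q', l₁⟩
      · rw [List.append_nil] at h₁
        obtain ⟨fuel, hf, h₁⟩ := h₁ (by simp [hc]) ha
        simp only [List.nil_append] at hl₁
        refine (hG _ (by rw [h₁]) (by rw [h₁]; simp; omega)).2 [] q l' (by simp [hl₁]) ?_ trivial
        rw [h₁]; simp [hc]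
      · simp only [List.cons_append, List.cons.injEq] at hl₁
        obtain ⟨rfl, -⟩ := hl₁
        obtain ⟨h₃, h₄⟩ := h₂ l q l₁ rfl hc ha
        simp only [hG' _ h₃]
        exact ⟨h₃, h₄⟩

theorem Tracks.of_eq {f : Str → Str} {F G : SimState → SimState} {s s' : Store} {t : ℕ}
    {qs : List Str} (h : Tracks f F s s' t qs)
    (hFG : ∀ σ, σ.reg = s → σ.fuel ≠ [] → F σ = G σ) : Tracks f G s s' t qs := by
  intro σ hσ ht
  rw [← hFG σ hσ (List.length_pos_iff.1 (by omega))]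
  exact h σ hσ ht

theorem Tracks.mono {f : Str → Str} {F : SimState → SimState} {s s' : Store} {t t' : ℕ}
    {qs : List Str} (h : Tracks f F s s' t qs) (ht : t ≤ t') : Tracks f F s s' t' qs := by
  intro σ hσ ht'
  obtain ⟨h₁, h₂⟩ := h σ hσ (by omega)
  refine ⟨fun h₃ h₄ => ?_, h₂⟩
  obtain ⟨fuel, h₅, h₆⟩ := h₁ h₃ h₄
  exact ⟨fuel, by omega, h₆⟩

theorem Tracks.of_no_query {f : Str → Str} {F : SimState → SimState} {s s' : Store} {t : ℕ}
    (h : ∀ σ : SimState, σ.reg = s → t < σ.fuel.length → ∃ fuel,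
      σ.fuel.length ≤ fuel.length + t ∧ F σ = ⟨fuel, σ.ctr, σ.ans, s'⟩) :
    Tracks f F s s' t [] := by
  intro σ hσ ht
  exact ⟨fun _ _ => h σ hσ ht, fun l q l' hl => by simp at hl⟩

/-- This extracts the query list from a genuine run. The number of queries and the lengths of their
answers are bounded by the running time because an oracle call pays for both. -/
theorem Runs.tracks {f : Str → Str} {p : Prog} {s s' : Store} {t : ℕ} (h : Runs f p s s' t) :
    ∃ qs : List Str, qs.length ≤ t ∧ (∀ q ∈ qs, (f q).length ≤ t) ∧ Tracks f (sim p) s s' t qs := by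
  induction h with
  | skip s =>
    exact ⟨[], by simp, by simp, .of_no_query fun σ hσ _ => ⟨σ.fuel, by simp, by simp [sim, ← hσ]⟩⟩
  | push r b s =>
    refine ⟨[], by simp, by simp, .of_no_query fun σ hσ ht => ⟨σ.fuel.tail, by simp; omega, ?_⟩⟩
    rw [sim, if_neg (List.length_pos_iff.1 (by omega)), hσ]
  | pop r s =>
    refine ⟨[], by simp, by simp, .of_no_query fun σ hσ ht => ⟨σ.fuel.tail, by simp; omega, ?_⟩⟩
    rw [sim, if_neg (List.length_pos_iff.1 (by omega)), hσ]
  | @seq p q _ _ _ _ _ _ _ ih₁ ih₂ =>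
    obtain ⟨qs₁, h₁, h₂, h₃⟩ := ih₁
    obtain ⟨qs₂, g₁, g₂, g₃⟩ := ih₂
    refine ⟨qs₁ ++ qs₂, by simp; omega, fun q hq => ?_, h₃.comp g₃ fun σ => sim_of_fuel_nil _⟩
    rcases List.mem_append.1 hq with hq | hq
    · exact (h₂ q hq).trans (by omega)
    · exact (g₂ q hq).trans (by omega)
  | ifTop_true hr _ ih =>
    obtain ⟨qs, h₁, h₂, h₃⟩ := ih
    exact ⟨qs, by omega, fun q hq => (h₂ q hq).trans (by omega),
      (h₃.of_eq fun σ hσ _ => by rw [sim, hσ, if_pos hr]).mono (by omega)⟩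
  | ifTop_false hr _ ih =>
    obtain ⟨qs, h₁, h₂, h₃⟩ := ih
    exact ⟨qs, by omega, fun q hq => (h₂ q hq).trans (by omega),
      (h₃.of_eq fun σ hσ _ => by rw [sim, hσ, if_neg hr]).mono (by omega)⟩
  | while_done hr =>
    refine ⟨[], by simp, by simp, .of_no_query fun σ hσ _ => ⟨σ.fuel, by simp, ?_⟩⟩
    rw [sim]
    refine (iterate_fixed ?_ _).trans (by rw [← hσ])
    exact if_pos (.inr (hσ ▸ hr))
  | @while_step r p s s' s'' t t' hr _ _ ih₁ ih₂ =>
    obtain ⟨qs₁, h₁, h₂, h₃⟩ := ih₁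
    obtain ⟨qs₂, g₁, g₂, g₃⟩ := ih₂
    refine ⟨qs₁ ++ qs₂, by simp; omega, fun q hq => ?_, ?_⟩
    · rcases List.mem_append.1 hq with hq | hq
      · exact (h₂ q hq).trans (by omega)
      · exact (g₂ q hq).trans (by omega)
    · have h₄ : Tracks f (fun σ => sim p ⟨σ.fuel.tail, σ.ctr, σ.ans, σ.reg⟩) s s' (t + 1) qs₁ := by
        intro σ hσ ht
        obtain ⟨k₁, k₂⟩ := h₃ ⟨σ.fuel.tail, σ.ctr, σ.ans, σ.reg⟩ hσ (by simp; omega)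
        refine ⟨fun h h' => ?_, k₂⟩
        obtain ⟨fuel, k₃, k₄⟩ := k₁ h h'
        simp only [List.length_tail] at k₃
        exact ⟨fuel, by omega, k₄⟩
      refine ((h₄.comp g₃ fun σ => sim_of_fuel_nil _).of_eq fun σ hσ h => ?_).mono (by omega)
      exact (sim_while h (hσ ▸ hr)).symm
  | query q a s =>
    refine ⟨[s q], by simp [add_assoc], by simp, fun σ hσ ht => ⟨fun hl ha => ?_, ?_⟩⟩
    · rw [List.length_singleton] at hl
      obtain ⟨ha, -⟩ := ha
      have hd : (σ.fuel.drop (f (s q)).length) ≠ [] := by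
        rw [← List.length_pos_iff, List.length_drop]; omega
      refine ⟨(σ.fuel.drop (f (s q)).length).tail, by simp; omega, ?_⟩
      rw [sim, if_neg (List.length_pos_iff.1 (by omega)), if_neg (List.length_pos_iff.1 (by omega)),
        ha, if_neg hd, hσ]
      simp
    · intro l q' l' hl hc _
      rcases l with _ | ⟨_, l⟩
      · simp only [List.nil_append, List.cons.injEq] at hl
        rw [sim, if_neg (List.length_pos_iff.1 (by omega)), if_pos (List.length_eq_zero_iff.1 hc)]
        simp [← hl.1, hσ]
      · simp at hl

/-- An oracle machine that decides `S` in polynomial time, as an adaptive sequence of queries. -/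
theorem exists_query_function {f : Str → Str} {S : Language Bool}
    (h : PolyTimeWith f (indicator S)) : ∃ (Q : Str → Str) (N : Polynomial ℕ), PolyTimeOn id Q ∧
      (∀ x u ans, (Q (pr x (pr u ans))).length ≤ N.eval x.length) ∧
      ∀ x, ∃ qs : List Str, qs.length ≤ N.eval x.length ∧
        (∀ q ∈ qs, (f q).length ≤ N.eval x.length) ∧
        ∀ ans, (∀ l q l' u, qs = l ++ q :: l' → Answers f l ans → u.length = l.length →
            Q (pr x (pr u ans)) = q) ∧
          (Answers f qs ans → ∀ u, N.eval x.length ≤ u.length →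
            Q (pr x (pr u ans)) = indicator S x) := by
  obtain ⟨p, q, h⟩ := h
  set n := p.bound + 1 with hn
  set fuel : Str → Str := fun x => List.replicate ((q + 1 : Polynomial ℕ).eval x.length) false
    with hfuel
  refine ⟨fun z => (sim p ⟨fuel (p1 z), p1 (p2 z), p2 (p2 z), initStore (p1 z)⟩).reg 0,
    -- The fuel is `q + 1`, one more than the running time, as `Tracks` demands; `X` accounts for
    -- the input, since fuel plus storage bounds the length of register `0` at the end.
    q + 1 + Polynomial.X, ?_, fun x u ans => ?_, fun x => ?_⟩
  · have hz := PolyTimeOn.self (id : Str → Str)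
    refine (polyTimeOn_reg (n := n) (i := 0) (by omega)).comp' ((polyTimeOn_sim p (by omega)).comp'
      (.simState (hz.p1.zeros_poly _) hz.p2.p1 hz.p2.p2 fun i _ => ?_))
    by_cases h : i = 0
    · subst h; simpa [initStore] using hz.p1
    · simpa [initStore, h] using PolyTimeOn.nil (id : Str → Str)
  · simp only [p1_pr, p2_pr]
    have h₁ := (sim_le n p (by omega) ⟨fuel x, u, ans, initStore x⟩).1
    have h₂ := Finset.single_le_sum
      (f := fun i => ((sim p ⟨fuel x, u, ans, initStore x⟩).reg i).length)
      (fun i _ => Nat.zero_le _) (Finset.mem_range.2 (show 0 < n by omega))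
    have h₃ := sum_length_update n 0 (by omega) (fun _ => []) x
    simp [SimState.size, initStore, hfuel] at *
    omega
  · obtain ⟨s, t, hr, hs, ht⟩ := h x
    obtain ⟨qs, h₁, h₂, h₃⟩ := hr.tracks
    refine ⟨qs, by simp; omega, fun q' hq' => (h₂ q' hq').trans (by simp; omega), fun ans =>
      ⟨fun l q' l' u hqs ha hu => ?_, fun ha u hu => ?_⟩⟩
    · simp only [p1_pr, p2_pr]
      exact ((h₃ _ rfl (by simp [hfuel]; omega)).2 l q' l' hqs hu ha).2
    · simp only [p1_pr, p2_pr]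
      simp only [Polynomial.eval_add, Polynomial.eval_X, Polynomial.eval_one] at hu
      obtain ⟨F, -, h₄⟩ := (h₃ ⟨fuel x, u, ans, initStore x⟩ rfl (by simp [hfuel]; omega)).1
        (by simp; omega) ha
      rw [h₄, ← hs]

/-- The hypothesis `0 ≤ c` covers the empty set, over which an expectation is `0`. -/
theorem expect_le_const_add {ι : Type*} {s : Finset ι} {F G : ι → ℚ} {c : ℚ} (hc : 0 ≤ c)
    (h : ∀ i ∈ s, F i ≤ c + G i) : 𝔼 i ∈ s, F i ≤ c + 𝔼 i ∈ s, G i := by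
  rcases s.eq_empty_or_nonempty with rfl | hs
  · simpa using hc
  · calc 𝔼 i ∈ s, F i ≤ 𝔼 i ∈ s, (c + G i) := Finset.expect_le_expect h
      _ = c + 𝔼 i ∈ s, G i := by rw [Finset.expect_add_distrib, Finset.expect_const hs]

theorem expect_lt_const_add {ι : Type*} {s : Finset ι} (hs : s.Nonempty) {F G : ι → ℚ} {c : ℚ}
    (h : ∀ i ∈ s, F i < c + G i) : 𝔼 i ∈ s, F i < c + 𝔼 i ∈ s, G i :=
  calc 𝔼 i ∈ s, F i < 𝔼 i ∈ s, (c + G i) := by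
        rw [Finset.expect_eq_sum_div_card, Finset.expect_eq_sum_div_card]
        exact div_lt_div_of_pos_right (Finset.sum_lt_sum_of_nonempty hs h)
          (by exact_mod_cast hs.card_pos)
    _ = c + 𝔼 i ∈ s, G i := by rw [Finset.expect_add_distrib, Finset.expect_const hs]

namespace Protocol

variable {k : ℕ} (P : Protocol k) (x : Str)

/-! ## Other reward functions -/

/-- The optimal expected value, as in `Protocol.optimum`, of an arbitrary reward `rew`. -/
noncomputable def gopt (rew : History → P.Coins x → ℚ) : ℕ → History → ℚ
  | 0, h => 𝔼 ω ∈ P.consistent x h, rew h ω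
  | n + 1, h => (P.messages x).sup' (P.messages_nonempty x) fun m =>
      𝔼 ω ∈ P.consistent x h, gopt rew n (h ++ [(m, P.arthur x h m ω)])

/-- The reward for the claim that `y` is the computed value. -/
def claimReward (y : Str) (h : History) (ω : P.Coins x) : ℚ :=
  if P.computedValue x h = y then 2 + P.reward x h ω else 0

/-- The history is the beginning of a play with a rational Merlin. -/
def IsRationalPrefix (h : History) : Prop :=
  (P.consistent x h).Nonempty ∧
    ∀ i : Fin h.length, (h.get i).1 ∈ P.messages x ∧
      ∀ m ∈ P.messages x,
        P.messageValue x (k - (i + 1)) (h.take i) m ≤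
          P.messageValue x (k - (i + 1)) (h.take i) (h.get i).1

variable {x}

theorem mem_messages {m : Str} : m ∈ P.messages x ↔ m.length ≤ P.msgLen.eval x.length := by
  simp [messages]

theorem consistent_nil : P.consistent x [] = Finset.univ := by
  simp [consistent]

theorem mem_consistent {h : History} {ω : P.Coins x} : ω ∈ P.consistent x h ↔
    ∀ i (hi : i < h.length), h[i].2 = P.arthur x (h.take i) h[i].1 ω := by
  simp [consistent, Fin.forall_iff]

theorem forall_getElem_concat {α : Type*} {l : List α} {a : α} {p : ℕ → List α → α → Prop} :
    (∀ i (hi : i < (l ++ [a]).length), p i ((l ++ [a]).take i) (l ++ [a])[i]) ↔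
      (∀ i (hi : i < l.length), p i (l.take i) l[i]) ∧ p l.length l a := by
  constructor
  · intro h
    refine ⟨fun i hi => ?_, ?_⟩
    · have := h i (by simp; omega)
      rwa [List.getElem_append_left hi, List.take_append_of_le_length hi.le] at this
    · have := h l.length (by simp)
      rwa [List.getElem_concat_length rfl, List.take_left' rfl] at this
  · rintro ⟨h₁, h₂⟩ i hi
    rw [List.length_append, List.length_singleton] at hi
    rcases Nat.lt_succ_iff_lt_or_eq.1 hi with hi' | rfl
    · rw [List.getElem_append_left hi', List.take_append_of_le_length hi'.le]
      exact h₁ i hi'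
    · rw [List.getElem_concat_length rfl, List.take_left' rfl]
      exact h₂

theorem mem_consistent_concat {h : History} {m a : Str} {ω : P.Coins x} :
    ω ∈ P.consistent x (h ++ [(m, a)]) ↔ ω ∈ P.consistent x h ∧ a = P.arthur x h m ω := by
  simp only [mem_consistent]
  exact forall_getElem_concat (p := fun _ h' b => b.2 = P.arthur x h' b.1 ω)

theorem IsRationalPrefix.concat {h : History} (hh : P.IsRationalPrefix x h) {m : Str}
    (hm : m ∈ P.messages x)
    (hmax : ∀ m' ∈ P.messages x, P.messageValue x (k - (h.length + 1)) h m' ≤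
      P.messageValue x (k - (h.length + 1)) h m) {ω : P.Coins x} (hω : ω ∈ P.consistent x h) :
    P.IsRationalPrefix x (h ++ [(m, P.arthur x h m ω)]) := by
  obtain ⟨-, h₂⟩ := hh
  refine ⟨⟨ω, P.mem_consistent_concat.2 ⟨hω, rfl⟩⟩, ?_⟩
  have := (forall_getElem_concat (l := h) (a := (m, P.arthur x h m ω))
    (p := fun i h' b => b.1 ∈ P.messages x ∧ ∀ m' ∈ P.messages x,
      P.messageValue x (k - (i + 1)) h' m' ≤ P.messageValue x (k - (i + 1)) h' b.1)).2
    ⟨fun i hi => h₂ ⟨i, hi⟩, hm, hmax⟩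
  exact fun i => this i i.2

theorem reward_nonneg (h : History) (ω : P.Coins x) : 0 ≤ P.reward x h ω := (P.R_mem _).1

theorem claimReward_le (y : Str) (h : History) (ω : P.Coins x) :
    P.claimReward x y h ω ≤ 2 + P.reward x h ω := by
  have := P.reward_nonneg h ω
  rw [claimReward]
  split_ifs
  · rfl
  · linarith

/-- No claim can earn more than `2` above the reward of `P`, for any strategy, so this passes
through averages and maxima. -/
theorem gopt_claim_le (y : Str) (n : ℕ) (h : History) :
    P.gopt x (P.claimReward x y) n h ≤ 2 + P.optimum x n h := by
  induction n generalizing h with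
  | zero => exact expect_le_const_add (by norm_num) fun ω _ => P.claimReward_le y h ω
  | succ n ih =>
    refine Finset.sup'_le _ _ fun m hm => ?_
    refine (expect_le_const_add (by norm_num) fun ω _ => ih _).trans ?_
    gcongr
    exact Finset.le_sup' (fun m => P.messageValue x n h m) hm

/-- A message that is optimal for `P` keeps the play rational, and at the end of a rational play the
wrong claim earns `0`, which is less than `2 + R`. A message that is not optimal for `P` falls short
already by `gopt_claim_le`. So the loss is strict along every strategy. -/
theorem gopt_claim_lt {f : Str → Str} (hf : P.Computes f) {y : Str} (hy : y ≠ f x) {n : ℕ}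
    {h : History} (hn : h.length + n = k) (hh : P.IsRationalPrefix x h) :
    P.gopt x (P.claimReward x y) n h < 2 + P.optimum x n h := by
  induction n generalizing h with
  | zero =>
    refine expect_lt_const_add hh.1 fun ω _ => ?_
    rw [claimReward, if_neg]
    · have := P.reward_nonneg h ω
      linarith
    · rw [hf x h ⟨hn, hh⟩]
      exact hy.symm
  | succ n ih =>
    refine (Finset.sup'_lt_iff _).2 fun m hm => ?_
    have hk : k - (h.length + 1) = n := by omega
    by_cases hmax : ∀ m' ∈ P.messages x, P.messageValue x n h m' ≤ P.messageValue x n h m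
    · refine (expect_lt_const_add hh.1 fun ω hω => ih (by simp; omega)
        (hh.concat P hm (by rwa [hk]) hω)).trans_le ?_
      gcongr
      exact Finset.le_sup' (fun m => P.messageValue x n h m) hm
    · push Not at hmax
      obtain ⟨m', hm', hlt⟩ := hmax
      refine (expect_le_const_add (by norm_num) fun ω _ => P.gopt_claim_le y n _).trans_lt ?_
      gcongr
      exact hlt.trans_le (Finset.le_sup' (fun m => P.messageValue x n h m) hm')

/-- Playing rationally for `P` makes the correct claim come true in every outcome, which attains the
bound of `gopt_claim_le`. -/
theorem gopt_claim_eq {f : Str → Str} (hf : P.Computes f) {n : ℕ}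
    {h : History} (hn : h.length + n = k) (hh : P.IsRationalPrefix x h) :
    P.gopt x (P.claimReward x (f x)) n h = 2 + P.optimum x n h := by
  induction n generalizing h with
  | zero =>
    rw [gopt, optimum, ← Finset.expect_const hh.1 (2 : ℚ), ← Finset.expect_add_distrib]
    refine Finset.expect_congr rfl fun ω _ => ?_
    rw [claimReward, if_pos (hf x h ⟨hn, hh⟩)]
  | succ n ih =>
    refine (P.gopt_claim_le _ _ _).antisymm ?_
    have hk : k - (h.length + 1) = n := by omega
    obtain ⟨m, hm, hmax⟩ := Finset.exists_max_image _ (P.messageValue x n h) (P.messages_nonempty x)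
    have h₁ : P.optimum x (n + 1) h ≤ P.messageValue x n h m := Finset.sup'_le _ _ hmax
    refine le_trans ?_ (Finset.le_sup' _ hm)
    rw [Finset.expect_congr rfl fun ω hω => ih (by simp; omega) (hh.concat P hm (by rwa [hk]) hω),
      Finset.expect_add_distrib, Finset.expect_const hh.1]
    gcongr
    exact h₁

theorem isRationalPrefix_nil : P.IsRationalPrefix x [] :=
  ⟨by rw [consistent_nil]; exact Finset.univ_nonempty, fun i => i.elim0⟩

theorem gopt_mem_Icc {rew : History → P.Coins x → ℚ} {c : ℚ}
    (hrew : ∀ h ω, rew h ω ∈ Set.Icc 0 c) (hc : 0 ≤ c) (n : ℕ) (h : History) :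
    P.gopt x rew n h ∈ Set.Icc 0 c := by
  have hE : ∀ (s : Finset (P.Coins x)) (F : P.Coins x → ℚ), (∀ ω, F ω ∈ Set.Icc 0 c) →
      𝔼 ω ∈ s, F ω ∈ Set.Icc 0 c := by
    intro s F hF
    refine ⟨Finset.expect_nonneg fun ω _ => (hF ω).1, ?_⟩
    simpa using expect_le_const_add (G := 0) hc (fun ω (_ : ω ∈ s) => by simpa using (hF ω).2)
  induction n generalizing h with
  | zero => exact hE _ _ (hrew h)
  | succ n ih =>
    obtain ⟨m, -, hm⟩ := Finset.exists_mem_eq_sup' (P.messages_nonempty x) fun m =>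
      𝔼 ω ∈ P.consistent x h, P.gopt x rew n (h ++ [(m, P.arthur x h m ω)])
    rw [gopt, hm]
    exact hE _ _ fun ω => ih _

/-- If the rewards are integers, then the optimum is an integer up to the factor that counts the
consistent random strings. -/
theorem card_mul_gopt_eq_int {rew : History → P.Coins x → ℚ} {B : ℚ}
    (hrew : ∀ h ω, h.length = k → (∀ p ∈ h, p.1 ∈ P.messages x) → ∃ z : ℤ, rew h ω * B = z)
    {n : ℕ} {h : History} (hn : h.length + n = k) (hh : ∀ p ∈ h, p.1 ∈ P.messages x) :
    ∃ z : ℤ, (P.consistent x h).card * P.gopt x rew n h * B = z := by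
  induction n generalizing h with
  | zero =>
    choose z hz using fun ω => hrew h ω hn hh
    refine ⟨∑ ω ∈ P.consistent x h, z ω, ?_⟩
    rw [gopt, ← nsmul_eq_mul, Finset.card_smul_expect, Finset.sum_mul]
    push_cast
    exact Finset.sum_congr rfl fun ω _ => hz ω
  | succ n ih =>
    obtain ⟨m, hm, hmax⟩ := Finset.exists_mem_eq_sup' (P.messages_nonempty x) fun m =>
      𝔼 ω ∈ P.consistent x h, P.gopt x rew n (h ++ [(m, P.arthur x h m ω)])
    choose z hz using fun a : Str => ih (h := h ++ [(m, a)]) (by simp; omega) (by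
      simpa [or_imp, forall_and] using ⟨fun a b => hh (a, b), hm⟩)
    classical
    refine ⟨∑ a ∈ (P.consistent x h).image (P.arthur x h m), z a, ?_⟩
    -- Random strings are grouped by Arthur's reply `a`. Each group is exactly the set consistent
    -- with the history extended by `(m, a)`, so multiplying by its size again gives an integer.
    rw [gopt, hmax, ← nsmul_eq_mul, Finset.card_smul_expect,
      ← Finset.sum_fiberwise_of_maps_to (g := P.arthur x h m)
        (t := (P.consistent x h).image (P.arthur x h m))
        (fun ω hω => Finset.mem_image_of_mem _ hω), Finset.sum_mul]
    push_cast
    refine Finset.sum_congr rfl fun a _ => ?_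
    rw [← hz]
    congr 1
    have : P.consistent x (h ++ [(m, a)]) =
        (P.consistent x h).filter fun ω => P.arthur x h m ω = a := by
      ext ω
      rw [mem_consistent_concat, Finset.mem_filter, eq_comm (a := a)]
    rw [this, ← nsmul_eq_mul]
    refine Finset.sum_eq_card_nsmul fun ω hω => ?_
    rw [(Finset.mem_filter.1 hω).2]

end Protocol

/-! ### The easy inclusion, and protocols without rounds -/

theorem binaryFraction_mul_two_pow (s : Str) : ∃ z : ℤ, binaryFraction s * 2 ^ s.length = z := by
  induction s with
  | nil => exact ⟨0, by simp [binaryFraction]⟩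
  | cons b s ih =>
    obtain ⟨z, hz⟩ := ih
    refine ⟨(if b then 2 ^ (s.length + 1) else 0) + z, ?_⟩
    rw [binaryFraction, List.length_cons, add_mul, pow_succ]
    push_cast
    rw [← hz]
    split_ifs <;> ring

theorem length_encode (l : List Str) :
    (encode l).length = (l.map fun s => 2 * s.length + 1).sum := by
  induction l with
  | nil => rfl
  | cons a l ih => rw [encode_cons, length_pr, ih, List.map_cons, List.sum_cons]

theorem dRMA_subset_pOracle (k : ℕ) : DRMA k ⊆ POracle (FRMA k) := by
  intro S hS
  refine ⟨indicator S, hS, .query 0 0, Polynomial.X + 2, fun x => ⟨_, _, .query 0 0 _, ?_, ?_⟩⟩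
  · simp [initStore]
  · have : (indicator S x).length = 1 := by
      rw [indicator]
      split_ifs <;> rfl
    simp [initStore, this]
    omega

theorem answers_encode {f : Str → Str} {l L : List Str} (h : l.length ≤ L.length) :
    Answers f l (encode L) ↔ (L.take l.length).map p1 = l.map f := by
  induction l generalizing L with
  | nil => simp [Answers]
  | cons q l ih =>
    rcases L with _ | ⟨a, L⟩
    · simp at h
    · rw [List.length_cons, List.length_cons] at h
      rw [Answers, encode_cons, p2_pr, ih (by omega)]
      simp [entry]

/-- A deterministic polynomial-time oracle can be dispensed with. -/
theorem polyTimeOn_indicator_of_oracle {f : Str → Str} {S : Language Bool}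
    (hf : PolyTimeOn id f) (h : PolyTimeWith f (indicator S)) : PolyTimeOn id (indicator S) := by
  obtain ⟨Q, N, hQ, hQN, hqs⟩ := exists_query_function h
  obtain ⟨F, hF⟩ := hf.length_le
  set eσ : Str × Str × Str → Str := fun z => pr z.1 (pr z.2.1 z.2.2) with heσ
  -- The state consists of the input, a unary counter and the answers so far; a step asks `Q` for
  -- the next query and appends its answer, with an empty message in the entry.
  set step : Str × Str × Str → Str × Str × Str := fun z =>
    (z.1, false :: z.2.1, z.2.2 ++ pr (pr (f (Q (eσ z))) []) []) with hstep
  have h₁ : PolyTimeOn eσ fun z => z.1 := by simpa [heσ] using (PolyTimeOn.self eσ).p1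
  have h₂ : PolyTimeOn eσ fun z => z.2.1 := by simpa [heσ] using (PolyTimeOn.self eσ).p2.p1
  have h₃ : PolyTimeOn eσ fun z => z.2.2 := by simpa [heσ] using (PolyTimeOn.self eσ).p2.p2
  have hs : PolyTimeOn eσ fun z => eσ (step z) :=
    h₁.pr ((h₂.cons false).pr (h₃.append ((PolyTimeOn.pr (hf.comp (hQ.comp (.self eσ)))
      (.nil eσ)).pr (.nil eσ))))
  have heσ' : ∀ z, eσ z = pr z.1 (pr z.2.1 z.2.2) := fun _ => rfl
  have hs₂ : ∀ z, (step z).2.1 = false :: z.2.1 := fun _ => rfl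
  have hs₃ : ∀ z, (step z).2.2 = z.2.2 ++ pr (pr (f (Q (eσ z))) []) [] := fun _ => rfl
  have hinv : ∀ x i, (step^[i] (x, [], [])).1 = x ∧
      (step^[i] (x, [], [])).2.1 = List.replicate i false ∧
      (step^[i] (x, [], [])).2.2.length ≤ i * (4 * F.eval (N.eval x.length) + 3) := by
    intro x i
    induction i with
    | zero => simp
    | succ i ih =>
      rw [iterate_succ_apply']
      obtain ⟨g₁, g₂, g₃⟩ := ih
      refine ⟨g₁, by rw [hs₂, g₂, List.replicate_succ], ?_⟩
      have hq : (Q (eσ (step^[i] (x, [], [])))).length ≤ N.eval x.length := by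
        rw [heσ', g₁]
        exact hQN x _ _
      have := (hF (Q (eσ (step^[i] (x, [], []))))).trans (polynomial_eval_mono F hq)
      simp only [hs₃, List.length_append, length_pr, List.length_nil]
      nlinarith
  have hx := PolyTimeOn.self (id : Str → Str)
  have hit := PolyTimeOn.iterate (init := fun x => (x, [], [])) hs
    (hx.pr ((PolyTimeOn.nil _).pr (.nil _))) (hx.zeros_poly N)
    (2 * Polynomial.X + 1 + (2 * N + 1 + N * (4 * F.comp N + 3))) (by
      intro x i hi
      obtain ⟨g₁, g₂, g₃⟩ := hinv x i
      rw [List.length_replicate] at hi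
      have := g₃.trans (Nat.mul_le_mul_right _ hi)
      simp [heσ, g₁, g₂] at this hi ⊢
      omega)
  refine (hQ.comp hit).congr fun x => ?_
  obtain ⟨qs, hlen, -, hqs⟩ := hqs x
  have hans : ∀ i, ∃ L : List Str, L.length = i ∧ (step^[i] (x, [], [])).2.2 = encode L ∧
      Answers f (qs.take i) (encode L) := by
    intro i
    induction i with
    | zero => exact ⟨[], rfl, rfl, by simp [Answers]⟩
    | succ i ih =>
      obtain ⟨L, g₁, g₂, g₃⟩ := ih
      obtain ⟨g₄, g₅, -⟩ := hinv x i
      rw [iterate_succ_apply']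
      refine ⟨L ++ [pr (f (Q (eσ (step^[i] (x, [], []))))) []], by simp [g₁], ?_, ?_⟩
      · rw [encode_append, encode_singleton, ← g₂]
      · have g₃' := g₃
        rw [answers_encode (by simp [g₁])] at g₃ ⊢
        · rcases Nat.lt_or_ge i qs.length with hi | hi
          · have hq : Q (eσ (step^[i] (x, [], []))) = qs[i] := by
              rw [heσ', g₄, g₅, g₂]
              exact (hqs _).1 (qs.take i) _ (qs.drop (i + 1)) _ (by simp) g₃' (by simp [hi.le])
            rw [List.length_take, min_eq_left hi.le, ← g₁, List.take_length] at g₃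
            rw [hq, List.take_add_one, List.getElem?_eq_getElem hi, Option.toList_some,
              List.length_append, List.length_take, min_eq_left hi.le, List.take_of_length_le
              (by simp [g₁]), List.map_append, List.map_append, g₃]
            simp [g₁]
          -- All queries are answered already; further entries lie beyond those that `Answers`
          -- inspects.
          · rw [List.take_of_length_le hi] at g₃
            rw [List.take_of_length_le (hi.trans (Nat.le_succ i)),
              List.take_append_of_le_length (by omega), g₃]
  obtain ⟨L, -, g₂, g₃⟩ := hans (N.eval x.length)
  rw [List.take_of_length_le hlen] at g₃
  obtain ⟨g₄, g₅, -⟩ := hinv x (N.eval x.length)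
  rw [List.length_replicate]
  simp only [id, heσ']
  rw [g₄, g₅, g₂]
  exact (hqs _).2 g₃ _ (by simp)

/-- Without rounds the empty history is a rational play, so `f` is `φ` applied to the encoded input.
It is thus computable in polynomial time, and the oracle can be removed. -/
theorem pOracle_subset_dRMA_zero : POracle (FRMA 0) ⊆ DRMA 0 := by
  rintro S ⟨f, ⟨P, hP⟩, hS⟩
  have hf : PolyTimeOn id f := by
    have hx := PolyTimeOn.self (id : Str → Str)
    refine (P.φ_polyTime.on.comp (hx.pr (.nil _))).congr fun x => ?_
    rw [← hP x [] ⟨rfl, P.isRationalPrefix_nil⟩, Protocol.computedValue]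
    simp [History.flat, encode_singleton]
  have hx := PolyTimeOn.self (id : Str → Str)
  refine ⟨{ V := fun _ => []
            R := fun _ => 0
            φ := fun z => indicator S (p1 z)
            V_polyTime := (PolyTimeOn.nil id).polyTime
            R_polyTime := ⟨fun _ => [], (PolyTimeOn.nil id).polyTime, fun _ => rfl⟩
            R_mem := by simp
            φ_polyTime := ((polyTimeOn_indicator_of_oracle hf hS).comp hx.p1).polyTime
            msgLen := 0
            coinLen := 0 }, fun x h hh => ?_⟩
  rw [List.eq_nil_of_length_eq_zero hh.1]
  simp [Protocol.computedValue, encode_cons, History.flat]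

/-! ### Encoded histories and their components -/

theorem flat_append (h h' : History) : History.flat (h ++ h') = h.flat ++ h'.flat := by
  simp [History.flat]

theorem flat_singleton (p : Str × Str) : History.flat [p] = [p.1, p.2] := by
  simp [History.flat]

theorem flat_cons (p : Str × Str) (h : History) :
    History.flat (p :: h) = p.1 :: p.2 :: h.flat := by
  simp [History.flat]

theorem length_flat (h : History) : h.flat.length = 2 * h.length := by
  induction h with
  | nil => rfl
  | cons p h ih => rw [flat_cons]; simp [ih]; omega

theorem getD_flat_append (h : History) (l : List Str) (j : ℕ) :
    (h.flat ++ l).getD (2 * h.length + j) [] = l.getD j [] := by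
  rw [← length_flat, List.getD_append_right _ _ _ _ (by omega)]
  simp

theorem getD_flat_append_fst (h : History) (l : List Str) {j : ℕ} (hj : j < h.length) :
    (h.flat ++ l).getD (2 * j) [] = h[j].1 := by
  induction h generalizing j with
  | nil => simp at hj
  | cons p h ih =>
    cases j with
    | zero => simp [flat_cons]
    | succ j =>
      rw [List.length_cons] at hj
      simpa [flat_cons, mul_add] using ih (by omega)

theorem getD_flat_append_snd (h : History) (l : List Str) {j : ℕ} (hj : j < h.length) :
    (h.flat ++ l).getD (2 * j + 1) [] = h[j].2 := by
  induction h generalizing j with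
  | nil => simp at hj
  | cons p h ih =>
    cases j with
    | zero => simp [flat_cons]
    | succ j =>
      rw [List.length_cons] at hj
      simpa [flat_cons, mul_add] using ih (by omega)

section

variable {α : Type*} {e : α → Str}

theorem PolyTimeOn.encode_flat_range {F G : ℕ → α → Str} {n : ℕ}
    (hF : ∀ i < n, PolyTimeOn e (F i)) (hG : ∀ i < n, PolyTimeOn e (G i)) :
    PolyTimeOn e fun a => encode (History.flat ((List.range n).map fun i => (F i a, G i a))) := by
  induction n with
  | zero => exact .nil e
  | succ n ih =>
    simp only [List.range_succ, List.map_append, flat_append, encode_append, List.map_cons,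
      List.map_nil, flat_singleton, encode_cons, encode_nil]
    exact (ih (fun i hi => hF i (by omega)) fun i hi => hG i (by omega)).append
      ((hF n (by omega)).pr ((hG n (by omega)).pr (.nil e)))

theorem PolyTimeOn.drop_poly {f g : α → Str} (hf : PolyTimeOn e f) (hg : PolyTimeOn e g)
    (q : Polynomial ℕ) : PolyTimeOn e fun a => (g a).drop (q.eval (f a).length) := by
  simpa using (hf.zeros_poly q).drop hg

theorem PolyTimeOn.take_poly {f g : α → Str} (hf : PolyTimeOn e f) (hg : PolyTimeOn e g)
    (q : Polynomial ℕ) : PolyTimeOn e fun a => (g a).take (q.eval (f a).length) := by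
  simpa using (hf.zeros_poly q).take hg

end

namespace Protocol

variable {k : ℕ} (P : Protocol k)

/-- Arthur's messages, recomputed from Merlin's messages `μ` and the random strings `ρ`. -/
def replay (q : Str) (μ ρ : ℕ → Str) : ℕ → History
  | 0 => []
  | i + 1 => replay q μ ρ i ++ [(μ i, P.V (encode
      (q :: (replay q μ ρ i).flat ++ [μ i] ++ (List.range (i + 1)).map ρ)))]

theorem polyTimeOn_replay {α : Type*} {e q : α → Str} {μ ρ : ℕ → α → Str} {n : ℕ}
    (hq : PolyTimeOn e q) (hμ : ∀ i < n, PolyTimeOn e (μ i)) (hρ : ∀ i < n, PolyTimeOn e (ρ i)) :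
    PolyTimeOn e fun a => encode (P.replay (q a) (fun i => μ i a) (fun i => ρ i a) n).flat := by
  induction n with
  | zero => exact .nil e
  | succ n ih =>
    have ih := ih (fun i hi => hμ i (by omega)) fun i hi => hρ i (by omega)
    have hm := hμ n (by omega)
    have := P.V_polyTime.on.comp (hq.pr (ih.append ((hm.pr (.nil e)).append
      (.encode_map_range hρ))))
    refine PolyTimeOn.congr (ih.append (hm.pr (this.pr (.nil e)))) fun a => ?_
    simp [replay, flat_append, flat_singleton, encode_append, encode_cons, encode_nil, pr_append]

end Protocol

/-! ## Parallel execution of a protocol for adaptively chosen queries -/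

/-- A protocol together with a function `Q` that computes the next query from the input, a counter,
and a list of answers to the preceding queries. -/
structure QueryGame (k : ℕ) where
  P : Protocol k
  Q : Str → Str
  /-- bounds the number and the lengths of queries -/
  N : Polynomial ℕ
  /-- computes the rewards of `P` -/
  g : Str → Str
  /-- bounds the lengths of the values of `g` -/
  G : Polynomial ℕ
  Q_polyTime : PolyTimeOn id Q
  g_polyTime : PolyTimeOn id g
  R_eq : ∀ s, P.R s = binaryFraction (g s)
  Q_length : ∀ x u ans, (Q (pr x (pr u ans))).length ≤ N.eval x.length
  g_length : ∀ s, (g s).length ≤ G.eval s.length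

namespace QueryGame

variable {k : ℕ} (D : QueryGame k)

/-- The length of the random strings of the parallel execution. -/
noncomputable def coinLen : Polynomial ℕ := 2 * D.N + D.P.coinLen.comp D.N

/-- The length of the messages of the parallel execution. -/
noncomputable def msgLen : Polynomial ℕ :=
  -- The first product leaves room for `N` entries, each an answer of length at most `N` paired with
  -- a message of `P`. The remaining summands leave room for up to `N` empty entries followed by a
  -- single message of `P`.
  D.N * (4 * D.N + 2 * D.P.msgLen.comp D.N + 3) + D.N + 2 * D.P.msgLen.comp D.N + 3

/-- The number of binary digits of the rewards of `P`. -/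
noncomputable def prec : Polynomial ℕ :=
  D.G.comp (2 * D.N + 1 + k * (2 * D.P.msgLen.comp D.N + 2 * D.P.coinLen.comp D.N + 2))

/-- The exponent by which the weights of successive queries decrease. -/
noncomputable def c : Polynomial ℕ := D.prec + 2 * k * D.coinLen + 2

/-- The index of the query that is examined, in unary, as determined by Arthur's first random
string. -/
noncomputable def index (x r : Str) : Str := p1 (r.take ((2 * D.N).eval x.length))

/-- The query with index `u`, given the answers claimed in `m`. -/
def query (x u m : Str) : Str := D.Q (pr x (pr u m))

/-- The part of the message `m` that concerns the query `q` with index `u`. -/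
def msg (q u m : Str) : Str := (p2 (entry u.length m)).take (D.P.msgLen.eval q.length)

/-- The part of the random string `r` that is used for the query `q`. -/
noncomputable def coin (x q r : Str) : Str :=
  (r.drop ((2 * D.N).eval x.length)).take (D.P.coinLen.eval q.length)

/-- Arthur's reply after `i` rounds. -/
noncomputable def reply (i : ℕ) (z : Str) : Str :=
  let x := nth 0 z
  let u := D.index x (nth (2 * i + 2) z)
  let q := D.query x u (nth 1 z)
  pr u (D.P.V (encode (q :: History.flat ((List.range i).map fun j =>
    (D.msg q u (nth (2 * j + 1) z), p2 (nth (2 * j + 2) z))) ++ [D.msg q u (nth (2 * i + 1) z)] ++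
      (List.range (i + 1)).map fun j => D.coin x q (nth (2 * i + 2 + j) z))))

/-- Arthur's reply in one of the first `n` rounds. -/
noncomputable def V : ℕ → Str → Str
  | 0, _ => []
  -- In the round after `i` completed ones the tuple has `1 + 2i + 1 + (i + 1) = 3i + 3` components,
  -- so dropping `3n` of them leaves nothing exactly when `i < n`.
  | n + 1, z => if p2^[3 * n] z = [] then V n z else D.reply n z

/-- The binary expansion of the reward. -/
noncomputable def rewardStr (z : Str) : Str :=
  let x := nth 0 z
  let u := D.index x (nth 2 z)
  let q := D.query x u (nth 1 z)
  let μ := fun j => D.msg q u (nth (2 * j + 1) z)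
  let ρ := fun j => D.coin x q (nth (2 * j + 2) z)
  -- The reward sees the random strings but not Arthur's replies, which `φ` needs; they are
  -- therefore replayed. The last reply is not an argument of `φ`, hence `k - 1`.
  if D.P.φ (encode (q :: (D.P.replay q μ ρ (k - 1)).flat ++ [μ (k - 1)])) =
      p1 (entry u.length (nth 1 z)) then
    -- The digits `0.1` followed by those of `R` stand for `(2 + R) / 4`; the zeros in front shift
    -- this by the weight.
    List.replicate (D.c.eval x.length * u.length) false ++
      false :: true :: D.g (encode (q :: History.flat ((List.range k).map fun j => (μ j, ρ j))))
  else []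

section

variable {α : Type*} {e f₁ f₂ f₃ : α → Str}

theorem polyTimeOn_index (h₁ : PolyTimeOn e f₁) (h₂ : PolyTimeOn e f₂) :
    PolyTimeOn e fun a => D.index (f₁ a) (f₂ a) := (h₁.take_poly h₂ _).p1

theorem polyTimeOn_query (h₁ : PolyTimeOn e f₁) (h₂ : PolyTimeOn e f₂) (h₃ : PolyTimeOn e f₃) :
    PolyTimeOn e fun a => D.query (f₁ a) (f₂ a) (f₃ a) := D.Q_polyTime.comp (h₁.pr (h₂.pr h₃))

theorem polyTimeOn_msg (h₁ : PolyTimeOn e f₁) (h₂ : PolyTimeOn e f₂) (h₃ : PolyTimeOn e f₃) :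
    PolyTimeOn e fun a => D.msg (f₁ a) (f₂ a) (f₃ a) :=
  h₁.take_poly (h₂.iterate_p2 h₃).p1.p2 _

theorem polyTimeOn_coin (h₁ : PolyTimeOn e f₁) (h₂ : PolyTimeOn e f₂) (h₃ : PolyTimeOn e f₃) :
    PolyTimeOn e fun a => D.coin (f₁ a) (f₂ a) (f₃ a) :=
  h₂.take_poly (h₁.drop_poly h₃ _) _

theorem polyTimeOn_nth (i : ℕ) : PolyTimeOn id (nth i) := (PolyTimeOn.self id).nth i

theorem polyTimeOn_reply (i : ℕ) : PolyTimeOn id (D.reply i) := by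
  have hx := polyTimeOn_nth 0
  have hu := D.polyTimeOn_index hx (polyTimeOn_nth (2 * i + 2))
  have hq := D.polyTimeOn_query hx hu (polyTimeOn_nth 1)
  have := D.P.V_polyTime.on.comp (hq.pr ((PolyTimeOn.encode_flat_range (n := i)
    (fun j _ => D.polyTimeOn_msg hq hu (polyTimeOn_nth (2 * j + 1)))
    (fun j _ => (polyTimeOn_nth (2 * j + 2)).p2)).append
    (((D.polyTimeOn_msg hq hu (polyTimeOn_nth (2 * i + 1))).pr (.nil id)).append
      (PolyTimeOn.encode_map_range (n := i + 1)
        fun j _ => D.polyTimeOn_coin hx hq (polyTimeOn_nth (2 * i + 2 + j))))))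
  refine PolyTimeOn.congr (hu.pr this) fun z => ?_
  simp [reply, encode_append, encode_cons, pr_append]

theorem polyTimeOn_V (n : ℕ) : PolyTimeOn id (D.V n) := by
  induction n with
  | zero => exact .nil id
  | succ n ih =>
    refine PolyTimeOn.ite ?_ ih (D.polyTimeOn_reply n)
    have : PolyTimeOn id fun z => p2^[3 * n] z := by
      simpa using (PolyTimeOn.const id (List.replicate (3 * n) false)).iterate_p2 (.self id)
    exact this.eq_nil

theorem polyTimeOn_rewardStr : PolyTimeOn id D.rewardStr := by
  have hx := polyTimeOn_nth 0
  have hu := D.polyTimeOn_index hx (polyTimeOn_nth 2)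
  have hq := D.polyTimeOn_query hx hu (polyTimeOn_nth 1)
  have hμ := fun j => D.polyTimeOn_msg hq hu (polyTimeOn_nth (2 * j + 1))
  have hρ := fun j => D.polyTimeOn_coin hx hq (polyTimeOn_nth (2 * j + 2))
  have hφ := D.P.φ_polyTime.on.comp (hq.pr ((D.P.polyTimeOn_replay (n := k - 1) hq
    (fun j _ => hμ j) (fun j _ => hρ j)).append ((hμ (k - 1)).pr (.nil id))))
  have hy := (hu.iterate_p2 (polyTimeOn_nth 1)).p1.p1
  have hg := D.g_polyTime.comp (hq.pr (PolyTimeOn.encode_flat_range (n := k)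
    (fun j _ => hμ j) (fun j _ => hρ j)))
  have hw := (hx.zeros_poly D.c).zeros_mul hu
  refine PolyTimeOn.congr (.ite (hφ.eq hy) (hw.append ((hg.cons true).cons false)) (.nil id))
    fun z => ?_
  simp [rewardStr, encode_append, encode_cons, encode_nil, entry]

end

theorem binaryFraction_zeros_append (n : ℕ) (s : Str) :
    binaryFraction (List.replicate n false ++ s) = binaryFraction s / 2 ^ n := by
  induction n with
  | zero => simp
  | succ n ih =>
    rw [List.replicate_succ, List.cons_append, binaryFraction, ih, pow_succ]
    simp only [Bool.false_eq_true, if_false]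
    ring

theorem binaryFraction_shifted (n : ℕ) (s : Str) :
    binaryFraction (List.replicate n false ++ false :: true :: D.g s) =
      (1 / 2) ^ n / 4 * (2 + D.P.R s) := by
  rw [binaryFraction_zeros_append, binaryFraction, binaryFraction, D.R_eq, one_div, inv_pow]
  simp only [Bool.false_eq_true, if_false, if_true]
  ring

theorem binaryFraction_rewardStr_mem (z : Str) :
    binaryFraction (D.rewardStr z) ∈ Set.Icc (0 : ℚ) 1 := by
  simp only [rewardStr]
  split_ifs
  · rw [binaryFraction_shifted]
    generalize encode _ = s
    obtain ⟨h₀, h₁⟩ := D.P.R_mem s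
    have h₂ : (1 / 2 : ℚ) ^ (D.c.eval (nth 0 z).length *
      (D.index (nth 0 z) (nth 2 z)).length) ≤ 1 := pow_le_one₀ (by norm_num) (by norm_num)
    refine ⟨by positivity, ?_⟩
    nlinarith
  · simp [binaryFraction]

/-- The protocol in which Merlin claims the answers to all queries in his first message, and Arthur
examines one of the claims, at random, by running the protocol `P`. -/
noncomputable def protocol : Protocol k where
  V := D.V k
  R z := binaryFraction (D.rewardStr z)
  φ z := D.query (nth 0 z) (List.replicate (D.N.eval (nth 0 z).length) false) (nth 1 z)
  V_polyTime := (D.polyTimeOn_V k).polyTime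
  R_polyTime := ⟨D.rewardStr, D.polyTimeOn_rewardStr.polyTime, fun _ => rfl⟩
  R_mem := D.binaryFraction_rewardStr_mem
  φ_polyTime := (D.polyTimeOn_query (polyTimeOn_nth 0) ((polyTimeOn_nth 0).zeros_poly D.N)
    (polyTimeOn_nth 1)).polyTime
  msgLen := D.msgLen
  coinLen := D.coinLen

end QueryGame

/-- The expectation of a function of a component that is independent of the event `ι = u`. -/
theorem expect_comp_of_fibers {Ω' Ω U : Type*} [Fintype Ω'] [Fintype Ω] {π : Ω' → Ω} {ι : Ω' → U}
    {ov : Ω → Ω' → Ω'} (h₁ : ∀ ω ω', π (ov ω ω') = ω) (h₂ : ∀ ω ω', ι (ov ω ω') = ι ω')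
    (h₃ : ∀ ω ω', ov (π ω') (ov ω ω') = ω') {u : U} (hu : ∃ ω', ι ω' = u) {S : Finset Ω}
    {S' : Finset Ω'} (hS : ∀ ω', ω' ∈ S' ↔ ι ω' = u ∧ π ω' ∈ S) (F : Ω → ℚ) :
    𝔼 ω' ∈ S', F (π ω') = 𝔼 ω ∈ S, F ω := by
  classical
  set fib : Ω → Finset Ω' := fun ω => Finset.univ.filter fun ω' => ι ω' = u ∧ π ω' = ω with hfib
  -- Overriding with `ω₂` injects the fibre over `ω₁` into the fibre over `ω₂`, so all fibres within
  -- the event `ι = u` have the same size.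
  have hle : ∀ ω₁ ω₂, (fib ω₁).card ≤ (fib ω₂).card := by
    intro ω₁ ω₂
    refine Finset.card_le_card_of_injOn (ov ω₂) (fun ω' h => ?_) fun a ha b hb hab => ?_
    · simp only [hfib, Finset.coe_filter, Finset.mem_univ, true_and, Set.mem_ofPred_eq, h₁, h₂] at h ⊢
      exact ⟨h.1, trivial⟩
    · simp only [hfib, Finset.coe_filter, Finset.mem_univ, true_and, Set.mem_ofPred_eq] at ha hb
      rw [← h₃ ω₂ a, ← h₃ ω₂ b, hab, ha.2, hb.2]
  obtain ⟨ω₀, hω₀⟩ := hu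
  have hcard : ∀ ω, (fib ω).card = (fib (π ω₀)).card := fun ω => (hle _ _).antisymm (hle _ _)
  have hpos : 0 < (fib (π ω₀)).card := Finset.card_pos.2 ⟨ω₀, by simp [hfib, hω₀]⟩
  have hsum : ∀ F : Ω → ℚ, ∑ ω' ∈ S', F (π ω') = (fib (π ω₀)).card * ∑ ω ∈ S, F ω := by
    intro F
    rw [← Finset.sum_fiberwise_of_maps_to (g := π) (t := S) (fun ω' h => ((hS ω').1 h).2),
      Finset.mul_sum]
    refine Finset.sum_congr rfl fun ω hω => ?_
    have : S'.filter (fun ω' => π ω' = ω) = fib ω := by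
      ext ω'
      simp only [hfib, Finset.mem_filter, Finset.mem_univ, true_and, hS]
      constructor
      · rintro ⟨⟨h, -⟩, h'⟩; exact ⟨h, h'⟩
      · rintro ⟨h, rfl⟩; exact ⟨⟨h, hω⟩, rfl⟩
    rw [this, ← hcard ω, ← nsmul_eq_mul]
    refine Finset.sum_eq_card_nsmul fun ω' hω' => ?_
    rw [(Finset.mem_filter.1 hω').2.2]
  have h1 := hsum fun _ => 1
  simp only [Finset.sum_const, nsmul_eq_mul, mul_one] at h1
  rw [Finset.expect_eq_sum_div_card, Finset.expect_eq_sum_div_card, hsum, h1]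
  exact mul_div_mul_left _ _ (by exact_mod_cast hpos.ne')

theorem nth_cons_zero (x : Str) (l : List Str) : nth 0 (encode (x :: l)) = x := by
  simp [nth_encode]

theorem nth_cons_fst (x : Str) (h : History) (l : List Str) {j : ℕ} (hj : j < h.length) :
    nth (2 * j + 1) (encode (x :: (h.flat ++ l))) = h[j].1 := by
  rw [nth_encode, List.getD_cons_succ, getD_flat_append_fst h l hj]

theorem nth_cons_snd (x : Str) (h : History) (l : List Str) {j : ℕ} (hj : j < h.length) :
    nth (2 * j + 2) (encode (x :: (h.flat ++ l))) = h[j].2 := by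
  rw [nth_encode, List.getD_cons_succ, getD_flat_append_snd h l hj]

theorem nth_cons_append (x : Str) (h : History) (l : List Str) (j : ℕ) :
    nth (2 * h.length + j + 1) (encode (x :: (h.flat ++ l))) = l.getD j [] := by
  rw [nth_encode, List.getD_cons_succ, getD_flat_append]

theorem Protocol.length_coinList {k : ℕ} (P : Protocol k) {x : Str} (ω : P.Coins x) :
    (P.coinList ω).length = k := by
  simp [coinList]

/-- Consistency of `ω` with `h` says precisely that the recorded replies are the recomputed ones. -/
theorem Protocol.replay_eq_take {k : ℕ} (P : Protocol k) {q : Str} {h : History} {ω : P.Coins q}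
    (hω : ω ∈ P.consistent q h) (hk : h.length ≤ k) {μ ρ : ℕ → Str}
    (hμ : ∀ j (hj : j < h.length), μ j = h[j].1)
    (hρ : ∀ j < k, ρ j = (P.coinList ω).getD j []) {i : ℕ} (hi : i ≤ h.length) :
    P.replay q μ ρ i = h.take i := by
  induction i with
  | zero => rfl
  | succ i ih =>
    have hc : (List.range (i + 1)).map ρ = (P.coinList ω).take (i + 1) := by
      refine List.ext_getElem (by simp [P.length_coinList]; omega) fun j hj hj' => ?_
      simp only [List.length_map, List.length_range] at hj
      have : j < (P.coinList ω).length := by rw [P.length_coinList]; omega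
      rw [List.getElem_map, List.getElem_range, hρ j (by omega), List.getElem_take,
        List.getD_eq_getElem _ _ this]
    have := P.mem_consistent.1 hω i hi
    rw [arthur, List.length_take, min_eq_left (by omega), ← hμ i hi, ← hc] at this
    rw [replay, ih (by omega), ← this, hμ i hi, Prod.mk.eta, List.take_append_getElem]

/-! ### Random strings and replies of the parallel execution in terms of `P` -/

namespace QueryGame

variable {k : ℕ} (D : QueryGame k) {x : Str}

/-- The index of the query that is examined. -/
noncomputable def idx (ω : D.protocol.Coins x) : Str :=
  D.index x ((D.protocol.coinList ω).getD 0 [])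

/-- The random strings for the execution of `P` on `q`. -/
noncomputable def proj (q : Str) (ω : D.protocol.Coins x) : D.P.Coins q := fun i b =>
  (List.ofFn (ω i)).getD ((2 * D.N).eval x.length + b) false

/-- Replaces the random strings for the execution of `P` on `q`. -/
noncomputable def override (q : Str) (ω : D.P.Coins q) (ω' : D.protocol.Coins x) :
    D.protocol.Coins x := fun i b =>
  if h : (2 * D.N).eval x.length ≤ b ∧ b - (2 * D.N).eval x.length < D.P.coinLen.eval q.length then
    ω i ⟨b - (2 * D.N).eval x.length, h.2⟩ else ω' i b

theorem coinLen_le {q : Str} (hq : q.length ≤ D.N.eval x.length) :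
    (2 * D.N).eval x.length + D.P.coinLen.eval q.length ≤
      D.protocol.coinLen.eval x.length := by
  have := polynomial_eval_mono D.P.coinLen hq
  simpa [protocol, coinLen] using this

theorem coinList_proj {q : Str} (hq : q.length ≤ D.N.eval x.length) (ω : D.protocol.Coins x) :
    D.P.coinList (D.proj q ω) = (D.protocol.coinList ω).map (D.coin x q) := by
  have hl := D.coinLen_le hq
  rw [Protocol.coinList, Protocol.coinList, List.map_ofFn]
  congr 1
  ext1 i
  refine List.ext_getElem (by simp [coin] at hl ⊢; omega) fun j hj hj' => ?_
  rw [List.length_ofFn] at hj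
  simp only [List.getElem_ofFn, comp_apply, coin, List.getElem_take, List.getElem_drop, proj]
  rw [List.getD_eq_getElem _ _ (by simp only [List.length_ofFn]; omega), List.getElem_ofFn]

theorem proj_override {q : Str} (hq : q.length ≤ D.N.eval x.length) (ω : D.P.Coins q)
    (ω' : D.protocol.Coins x) : D.proj q (D.override q ω ω') = ω := by
  have hl := D.coinLen_le hq
  ext i b
  have hb := b.2
  rw [proj, List.getD_eq_getElem _ _ (by simp only [List.length_ofFn]; omega), List.getElem_ofFn]
  simp [override]

/-- The index is read from the first `2N` bits, and only later bits are overridden. This is the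
independence of the examined index and the coins for `P`. -/
theorem idx_override (q : Str) (ω : D.P.Coins q) (ω' : D.protocol.Coins x) :
    D.idx (D.override q ω ω') = D.idx ω' := by
  rcases Nat.eq_zero_or_pos k with rfl | hk
  · simp [idx, Protocol.coinList]
  have : ∀ ω : D.protocol.Coins x, (D.protocol.coinList ω).getD 0 [] = List.ofFn (ω ⟨0, hk⟩) := by
    intro ω
    rw [List.getD_eq_getElem _ _ (by rwa [D.protocol.length_coinList])]
    simp [Protocol.coinList]
  rw [idx, idx, this, this, index, index]
  congr 1
  refine List.ext_getElem (by simp) fun j hj hj' => ?_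
  simp only [List.getElem_take, List.getElem_ofFn, override]
  rw [List.length_take] at hj
  rw [dif_neg (by omega)]

theorem override_proj (q : Str) (ω : D.P.Coins q)
    (ω' : D.protocol.Coins x) : D.override q (D.proj q ω') (D.override q ω ω') = ω' := by
  ext i b
  rw [override]
  split_ifs with h
  · have hb : (2 * D.N).eval x.length + (b - (2 * D.N).eval x.length) = b := by omega
    simp only [proj, hb]
    rw [List.getD_eq_getElem _ _ (by simp only [List.length_ofFn]; exact b.2), List.getElem_ofFn]
  · rw [override, dif_neg h]

theorem length_idx_le (ω : D.protocol.Coins x) : (D.idx ω).length ≤ D.N.eval x.length := by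
  rw [idx, index]
  have h₁ := length_p1_add_length_p2_le
    (((D.protocol.coinList ω).getD 0 []).take ((2 * D.N).eval x.length))
  have h₂ := List.length_take_le ((2 * D.N).eval x.length) ((D.protocol.coinList ω).getD 0 [])
  -- At most `2N` bits are decoded, so twice the index is at most `2N + 1`; the extra `1` disappears
  -- on halving.
  simp only [Polynomial.eval_mul, Polynomial.eval_ofNat] at *
  omega

theorem exists_length_idx (hk : 0 < k) {n : ℕ} (hn : n < D.N.eval x.length) :
    ∃ ω : D.protocol.Coins x, (D.idx ω).length = n := by
  -- The random strings begin with the code of `n` in unary, of length `2n + 1 ≤ 2N` because `n <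
  -- N`, and are padded with zeros.
  set s : Str := pr (List.replicate n false) [] with hs
  refine ⟨fun _ b => s.getD b false, ?_⟩
  have hl : (2 * D.N).eval x.length ≤ D.protocol.coinLen.eval x.length := by
    simp [protocol, coinLen]
  rw [idx, List.getD_eq_getElem _ _ (by rwa [D.protocol.length_coinList])]
  have : ∃ l, (D.protocol.coinList (x := x) fun _ b => s.getD b false)[0]'(by
      rwa [D.protocol.length_coinList]) = pr (List.replicate n false) l := by
    refine ⟨List.replicate (D.protocol.coinLen.eval x.length - s.length) false, ?_⟩
    have hsl : s.length ≤ D.protocol.coinLen.eval x.length := by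
      simp [hs] at hl ⊢; omega
    have : pr (List.replicate n false)
        (List.replicate (D.protocol.coinLen.eval x.length - s.length) false) =
        s ++ List.replicate (D.protocol.coinLen.eval x.length - s.length) false := by
      rw [hs, pr_append, List.nil_append]
    rw [this]
    refine List.ext_getElem (by simp [Protocol.coinList]; omega) fun j hj hj' => ?_
    simp only [Protocol.coinList, List.getElem_ofFn]
    rw [List.getElem_append]
    split_ifs with h
    · rw [List.getD_eq_getElem _ _ h]
    · rw [List.getD_eq_default _ _ (by omega), List.getElem_replicate]
  obtain ⟨l, hl'⟩ := this
  rw [hl', index]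
  have : (pr (List.replicate n false) l).take ((2 * D.N).eval x.length) =
      pr (List.replicate n false) (l.take ((2 * D.N).eval x.length - (2 * n + 1))) := by
    have h₁ : pr (List.replicate n false) l = pr (List.replicate n false) [] ++ l := by
      rw [pr_append, List.nil_append]
    have h₂ : ∀ l', pr (List.replicate n false) l' = pr (List.replicate n false) [] ++ l' := by
      intro l'; rw [pr_append, List.nil_append]
    rw [h₂ l, h₂ (l.take _), List.take_append, List.take_of_length_le (by simp; omega)]
    simp
  rw [this, p1_pr, List.length_replicate]

/-- The history of the execution of `P` on `q`. -/
def hist (q u : Str) (h : History) : History := h.map fun p => (D.msg q u p.1, p2 p.2)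

theorem V_encode {n i : ℕ} (hi : i < n) {l : List Str} (hl : l.length = 3 * i + 3) :
    D.V n (encode l) = D.reply i (encode l) := by
  have hnil : ∀ m, p2^[m] (encode l) = [] ↔ l.length ≤ m := by
    intro m
    rw [iterate_p2_encode, ← List.drop_eq_nil_iff]
    constructor
    · intro h
      cases h' : l.drop m with
      | nil => rfl
      | cons a l => rw [h', encode_cons] at h; simp [pr] at h
    · intro h; rw [h]; rfl
  induction n with
  | zero => omega
  | succ n ih =>
    rw [V]
    rcases Nat.lt_succ_iff_lt_or_eq.1 hi with h | rfl
    · rw [if_pos ((hnil _).2 (by omega)), ih h]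
    · rw [if_neg (by rw [hnil]; omega)]

/-- Stating `hM` for `h` followed by `m` covers the first round as well, where `M` is `m` itself. -/
theorem arthur_eq {h : History} {m M u : Str} {ω : D.protocol.Coins x} (hh : h.length < k)
    (hM : (h.flat ++ [m]).head? = some M) (hu : D.idx ω = u) :
    D.protocol.arthur x h m ω = pr u (D.P.arthur (D.query x u M) (D.hist (D.query x u M) u h)
      (D.msg (D.query x u M) u m) (D.proj (D.query x u M) ω)) := by
  set cs := (D.protocol.coinList ω).take (h.length + 1) with hcs
  have hcl : cs.length = h.length + 1 := by
    rw [hcs, List.length_take, D.protocol.length_coinList]; omega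
  have hz : x :: h.flat ++ [m] ++ cs = x :: (h.flat ++ (m :: cs)) := by simp
  have hcj : ∀ j ≤ h.length, cs.getD j [] = (D.protocol.coinList ω).getD j [] := by
    intro j hj
    rw [List.getD_eq_getElem _ _ (by omega), List.getD_eq_getElem _ _
      (by rw [D.protocol.length_coinList]; omega)]
    simp [hcs]
  rw [Protocol.arthur, Protocol.arthur, ← hcs, hz]
  change D.V k _ = _
  rw [D.V_encode hh (by simp [length_flat, hcl]; omega), reply]
  have n0 := nth_cons_zero x (h.flat ++ (m :: cs))
  have nM : nth 1 (encode (x :: (h.flat ++ (m :: cs)))) = M := by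
    rw [nth_encode, List.getD_cons_succ]
    rcases h with _ | ⟨p, h⟩
    · simpa [History.flat] using hM
    · simpa [flat_cons] using hM
  have nm : nth (2 * h.length + 1) (encode (x :: (h.flat ++ (m :: cs)))) = m := by
    simpa using nth_cons_append x h (m :: cs) 0
  have nc : ∀ j, nth (2 * h.length + 2 + j) (encode (x :: (h.flat ++ (m :: cs)))) =
      cs.getD j [] := by
    intro j
    have := nth_cons_append x h (m :: cs) (j + 1)
    rwa [List.getD_cons_succ, show 2 * h.length + (j + 1) + 1 = 2 * h.length + 2 + j by ring] at this
  have nu := nc 0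
  rw [hcj 0 (by omega)] at nu
  have hidx : D.index x ((D.protocol.coinList ω).getD 0 []) = u := hu
  rw [add_zero] at nu
  have hq : (D.query x u M).length ≤ D.N.eval x.length := D.Q_length _ _ _
  have hA : ((List.range h.length).map fun j =>
      (D.msg (D.query x u M) u (nth (2 * j + 1) (encode (x :: (h.flat ++ (m :: cs))))),
        p2 (nth (2 * j + 2) (encode (x :: (h.flat ++ (m :: cs))))))) =
      D.hist (D.query x u M) u h := by
    refine List.ext_getElem (by simp [hist]) fun j hj hj' => ?_
    have hj : j < h.length := by simpa using hj
    rw [List.getElem_map, List.getElem_range, nth_cons_fst x h _ hj, nth_cons_snd x h _ hj]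
    simp [hist]
  have hB : ((List.range (h.length + 1)).map fun j => D.coin x (D.query x u M)
      (nth (2 * h.length + 2 + j) (encode (x :: (h.flat ++ (m :: cs)))))) =
      (D.P.coinList (D.proj (D.query x u M) ω)).take
        ((D.hist (D.query x u M) u h).length + 1) := by
    rw [D.coinList_proj hq]
    refine List.ext_getElem (by simp [hist, D.protocol.length_coinList]; omega) fun j hj hj' => ?_
    have hj : j < h.length + 1 := by simpa using hj
    rw [List.getElem_map, List.getElem_range, nc, hcj j (by omega), List.getElem_take,
      List.getElem_map, List.getD_eq_getElem]
  simp only [n0, nM, nm, nu, hidx, hA, hB]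

end QueryGame

/-! ### Conditional expectations and optimal rewards of the parallel execution -/

namespace QueryGame

variable {k : ℕ} (D : QueryGame k) {x : Str}

/-- A history of the parallel execution that starts with the message `M` and in which the query with
index `u` is examined. -/
structure IsHistory (M u : Str) (h : History) : Prop where
  head : ∃ a t, h = (M, a) :: t
  index : ∀ p ∈ h, p.2 = pr u (p2 p.2)

theorem IsHistory.head_take {M u : Str} {h : History} (hh : IsHistory M u h) {i : ℕ}
    (hi : i < h.length) : (History.flat (h.take i) ++ [h[i].1]).head? = some M := by
  obtain ⟨a, t, rfl⟩ := hh.head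
  cases i with
  | zero => simp [History.flat]
  | succ i => simp [flat_cons]

theorem IsHistory.concat {M u : Str} {h : History} (hh : IsHistory M u h) (m a : Str) :
    IsHistory M u (h ++ [(m, pr u a)]) := by
  obtain ⟨b, t, rfl⟩ := hh.head
  refine ⟨⟨b, t ++ [(m, pr u a)], rfl⟩, fun p hp => ?_⟩
  rcases List.mem_append.1 hp with hp | hp
  · exact hh.index p hp
  · rw [List.mem_singleton.1 hp, p2_pr]

/-- Every reply carries the index, so a nonempty history fixes it; what remains of consistency is
consistency in the run of `P` on the examined query. Conditioning thus leaves the coins for `P`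
distributed as in `P` alone. -/
theorem mem_consistent_iff {h : History} {M u : Str} {ω : D.protocol.Coins x} (hk : h.length ≤ k)
    (hh : IsHistory M u h) : ω ∈ D.protocol.consistent x h ↔ D.idx ω = u ∧
      D.proj (D.query x u M) ω ∈
        D.P.consistent (D.query x u M) (D.hist (D.query x u M) u h) := by
  have key : D.idx ω = u → ∀ i (hi : i < h.length),
      h[i].2 = D.protocol.arthur x (h.take i) h[i].1 ω ↔
        ((D.hist (D.query x u M) u h)[i]'(by simpa [hist] using hi)).2 =
          D.P.arthur (D.query x u M) ((D.hist (D.query x u M) u h).take i)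
            ((D.hist (D.query x u M) u h)[i]'(by simpa [hist] using hi)).1
            (D.proj (D.query x u M) ω) := by
    intro hu i hi
    rw [D.arthur_eq (by simp; omega) (hh.head_take hi) hu, hh.index _ (List.getElem_mem hi)]
    simp only [hist, List.getElem_map, List.map_take]
    constructor
    · intro h; simpa using congrArg p2 h
    · intro h; rw [h]
  rw [Protocol.mem_consistent, Protocol.mem_consistent]
  constructor
  · intro hc
    -- The first reply already determines the index.
    have hu : D.idx ω = u := by
      obtain ⟨a, t, rfl⟩ := hh.head
      have h₀ := hc 0 (by simp)
      rw [hh.index _ (List.getElem_mem (by simp)), D.arthur_eq (M := M) (u := D.idx ω)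
        (by simp at hk ⊢; omega) (by simp [History.flat]) rfl] at h₀
      simpa using (congrArg p1 h₀).symm
    refine ⟨hu, fun i hi => ?_⟩
    have hi' : i < h.length := by simpa [hist] using hi
    exact (key hu i hi').1 (hc i hi')
  · rintro ⟨hu, hc⟩ i hi
    exact (key hu i hi).2 (hc i (by simpa [hist] using hi))

/-- The weight of the query with index `u`. -/
noncomputable def weight (x u : Str) : ℚ := (1 / 2) ^ (D.c.eval x.length * u.length) / 4

/-- The reward in the execution of `P` on the query with index `u`, if the answers are claimed
in `M`. -/
noncomputable def queryReward (x M u : Str) (h : History)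
    (ω : D.P.Coins (D.query x u M)) : ℚ :=
  D.P.claimReward (D.query x u M) (p1 (entry u.length M)) h ω

theorem reward_eq {h : History} {M u : Str} {ω : D.protocol.Coins x} (hk : h.length = k)
    (hh : IsHistory M u h) (hω : ω ∈ D.protocol.consistent x h) :
    D.protocol.reward x h ω = D.weight x u *
      D.queryReward x M u (D.hist (D.query x u M) u h) (D.proj (D.query x u M) ω) := by
  obtain ⟨hu, hc⟩ := (D.mem_consistent_iff hk.le hh).1 hω
  set q := D.query x u M with hq
  have hqN : q.length ≤ D.N.eval x.length := D.Q_length _ _ _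
  have hlen : (D.hist q u h).length = k := by simpa [hist] using hk
  have hk0 : 0 < k := by
    obtain ⟨a, t, rfl⟩ := hh.head
    rw [← hk]; simp
  set hz : History := (h.zip (D.protocol.coinList ω)).map fun p => (p.1.1, p.2) with hhz
  have hzl : hz.length = k := by simp [hhz, D.protocol.length_coinList, hk]
  have hflat : x :: (h.zip (D.protocol.coinList ω)).flatMap (fun p => [p.1.1, p.2]) =
      x :: (hz.flat ++ []) := by
    simp [hhz, History.flat, List.flatMap_map]
  rw [Protocol.reward, hflat]
  change binaryFraction (D.rewardStr _) = _
  set z := encode (x :: (hz.flat ++ [])) with hzdef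
  have n0 : nth 0 z = x := nth_cons_zero _ _
  have nμ : ∀ j (hj : j < k), nth (2 * j + 1) z = (h[j]'(by omega)).1 := by
    intro j hj
    rw [hzdef, nth_cons_fst x hz _ (by omega)]
    simp [hhz]
  have nρ : ∀ j < k, nth (2 * j + 2) z = (D.protocol.coinList ω).getD j [] := by
    intro j hj
    rw [hzdef, nth_cons_snd x hz _ (by omega),
      List.getD_eq_getElem _ _ (by rwa [D.protocol.length_coinList])]
    simp [hhz]
  have n1 : nth 1 z = M := by
    have := nμ 0 hk0
    obtain ⟨a, t, rfl⟩ := hh.head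
    simpa using this
  have n2 : D.index x (nth 2 z) = u := by
    have := nρ 0 hk0
    rw [mul_zero, zero_add] at this
    rw [this]
    exact hu
  have hμ : ∀ j (hj : j < k), D.msg q u (nth (2 * j + 1) z) =
      ((D.hist q u h)[j]'(by omega)).1 := by
    intro j hj
    rw [nμ j hj]
    simp [hist]
  have hρ : ∀ j < k, D.coin x q (nth (2 * j + 2) z) = (D.P.coinList (D.proj q ω)).getD j [] := by
    intro j hj
    rw [nρ j hj, D.coinList_proj hqN, List.getD_eq_getElem _ _
      (by rwa [D.protocol.length_coinList]), List.getD_eq_getElem _ _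
      (by simpa [D.protocol.length_coinList] using hj), List.getElem_map]
  have hφ : D.P.φ (encode (q :: (D.P.replay q (fun j => D.msg q u (nth (2 * j + 1) z))
      (fun j => D.coin x q (nth (2 * j + 2) z)) (k - 1)).flat ++
        [D.msg q u (nth (2 * (k - 1) + 1) z)])) = D.P.computedValue q (D.hist q u h) := by
    rw [D.P.replay_eq_take hc hlen.le (fun j hj => hμ j (by omega)) hρ (by omega),
      hμ _ (by omega), Protocol.computedValue]
    congr 2
    have : D.hist q u h = (D.hist q u h).take (k - 1) ++
        [(D.hist q u h)[k - 1]'(by omega)] := by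
      rw [List.take_append_getElem, List.take_of_length_le (by omega)]
    conv_rhs => rw [this, flat_append, flat_singleton]
    rw [List.dropLast_append_cons]
    rfl
  have hR : encode (q :: History.flat ((List.range k).map fun j =>
      (D.msg q u (nth (2 * j + 1) z), D.coin x q (nth (2 * j + 2) z)))) =
      encode (q :: ((D.hist q u h).zip (D.P.coinList (D.proj q ω))).flatMap
        fun p => [p.1.1, p.2]) := by
    have : ((List.range k).map fun j =>
      (D.msg q u (nth (2 * j + 1) z), D.coin x q (nth (2 * j + 2) z))) =
        ((D.hist q u h).zip (D.P.coinList (D.proj q ω))).map fun p => (p.1.1, p.2) := by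
      refine List.ext_getElem (by simp [hlen, D.P.length_coinList]) fun j hj hj' => ?_
      have hj : j < k := by simpa using hj
      rw [List.getElem_map, List.getElem_range, hμ j hj, hρ j hj,
        List.getD_eq_getElem _ _ (by rwa [D.P.length_coinList])]
      simp
    rw [this, History.flat, List.flatMap_map]
  simp only [rewardStr, n0, n1, n2, ← hq, hφ, hR]
  rw [queryReward, Protocol.claimReward]
  split_ifs with h₁
  · rw [binaryFraction_shifted, Protocol.reward, weight]
  · simp [binaryFraction]

theorem msg_mem (q u m : Str) : D.msg q u m ∈ D.P.messages q := by
  rw [Protocol.mem_messages, msg]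
  exact List.length_take_le _ _

theorem exists_msg_eq {q u m : Str} (hq : q.length ≤ D.N.eval x.length)
    (hu : u.length ≤ D.N.eval x.length) (hm : m ∈ D.P.messages q) :
    ∃ m' ∈ D.protocol.messages x, D.msg q u m' = m := by
  rw [Protocol.mem_messages] at hm
  have hp : ∀ n s, p2^[n] (List.replicate n false ++ s) = s := by
    intro n s
    induction n with
    | zero => rfl
    | succ n ih => exact ih
  -- Each leading `false` encodes an empty entry, so the wanted message stands in the entry with
  -- index `u`.
  refine ⟨List.replicate u.length false ++ pr (pr [] m) [], ?_, ?_⟩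
  · have := hm.trans (polynomial_eval_mono D.P.msgLen hq)
    rw [Protocol.mem_messages]
    simp [protocol, msgLen]
    omega
  · rw [msg, entry, hp, p1_pr, p2_pr, List.take_of_length_le hm]

/-- Once the index is revealed, the game that remains is the game of `P` with the claim reward,
scaled by the weight. The map `msg` sends Merlin's messages onto those of `P`, so the maxima agree,
and `expect_comp_of_fibers` identifies the averages. -/
theorem optimum_eq {n : ℕ} {h : History} {M u : Str} (hn : h.length + n = k)
    (hh : IsHistory M u h) (hu : ∃ ω : D.protocol.Coins x, D.idx ω = u) :
    D.protocol.optimum x n h = D.weight x u *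
      D.P.gopt (D.query x u M) (D.queryReward x M u) n (D.hist (D.query x u M) u h) := by
  set q := D.query x u M with hq
  have hqN : q.length ≤ D.N.eval x.length := D.Q_length _ _ _
  have hE : ∀ {h : History}, h.length ≤ k → IsHistory M u h → ∀ F : D.P.Coins q → ℚ,
      𝔼 ω ∈ D.protocol.consistent x h, F (D.proj q ω) =
        𝔼 ω ∈ D.P.consistent q (D.hist q u h), F ω := fun hk hh F =>
    expect_comp_of_fibers (D.proj_override hqN) (D.idx_override q) (D.override_proj q) hu
      (fun ω => D.mem_consistent_iff hk hh) F
  induction n generalizing h with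
  | zero =>
    rw [Protocol.optimum, Protocol.gopt, Finset.mul_expect,
      ← hE (by omega) hh fun ω => D.weight x u * D.queryReward x M u (D.hist q u h) ω]
    exact Finset.expect_congr rfl fun ω hω => D.reward_eq hn hh hω
  | succ n ih =>
    have hm : ∀ m, 𝔼 ω ∈ D.protocol.consistent x h,
        D.protocol.optimum x n (h ++ [(m, D.protocol.arthur x h m ω)]) =
        D.weight x u * 𝔼 ω ∈ D.P.consistent q (D.hist q u h), D.P.gopt q (D.queryReward x M u) n
          (D.hist q u h ++ [(D.msg q u m, D.P.arthur q (D.hist q u h) (D.msg q u m) ω)]) := by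
      intro m
      rw [Finset.mul_expect, ← hE (by omega) hh]
      refine Finset.expect_congr rfl fun ω hω => ?_
      have hω := ((D.mem_consistent_iff (by omega) hh).1 hω).1
      have hM : (h.flat ++ [m]).head? = some M := by
        obtain ⟨a, t, rfl⟩ := hh.head
        simp [flat_cons]
      rw [D.arthur_eq (by omega) hM hω, ih (by simp; omega) (hh.concat _ _)]
      simp only [hist, List.map_append, List.map_cons, List.map_nil, p2_pr, mul_eq_mul_left_iff]
      exact Or.inl rfl
    rw [Protocol.optimum, Protocol.gopt]
    have hw : 0 ≤ D.weight x u := by rw [weight]; positivity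
    obtain ⟨ω₀, hω₀⟩ := hu
    apply le_antisymm
    · refine Finset.sup'_le _ _ fun m _ => ?_
      rw [hm]
      exact mul_le_mul_of_nonneg_left (Finset.le_sup' (fun m => 𝔼 ω ∈ D.P.consistent q
        (D.hist q u h), D.P.gopt q (D.queryReward x M u) n
          (D.hist q u h ++ [(m, D.P.arthur q (D.hist q u h) m ω)])) (D.msg_mem q u m)) hw
    · obtain ⟨m, hmem, hmax⟩ := Finset.exists_mem_eq_sup' (D.P.messages_nonempty q)
        fun m => 𝔼 ω ∈ D.P.consistent q (D.hist q u h), D.P.gopt q (D.queryReward x M u) n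
          (D.hist q u h ++ [(m, D.P.arthur q (D.hist q u h) m ω)])
      obtain ⟨m', hm', rfl⟩ := D.exists_msg_eq hqN (hω₀ ▸ D.length_idx_le ω₀) hmem
      rw [hmax, ← hm]
      exact Finset.le_sup' (fun m => 𝔼 ω ∈ D.protocol.consistent x h,
        D.protocol.optimum x n (h ++ [(m, D.protocol.arthur x h m ω)])) hm'

end QueryGame

theorem exists_first_wrong_answer {f : Str → Str} {qs : List Str} {ans : Str}
    (h : ¬ Answers f qs ans) : ∃ l q l', qs = l ++ q :: l' ∧ Answers f l ans ∧
      p1 (entry l.length ans) ≠ f q := by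
  induction qs generalizing ans with
  | nil => exact absurd trivial h
  | cons q qs ih =>
    by_cases hq : p1 (entry 0 ans) = f q
    · obtain ⟨l, q', l', h₁, h₂, h₃⟩ := ih fun h' => h ⟨hq, h'⟩
      exact ⟨q :: l, q', l', by rw [h₁]; rfl, ⟨hq, h₂⟩, h₃⟩
    · exact ⟨[], q, qs, rfl, trivial, hq⟩

/-! ### The value of a claim, and the gap between right and wrong claims -/

namespace Protocol

variable {k : ℕ} (P : Protocol k) {x : Str}

/-- The optimal expected reward for the claim that `y` is the computed value, when Merlin sends `m`
first. -/
noncomputable def claimValue (n : ℕ) (x y m : Str) : ℚ :=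
  𝔼 ω ∈ P.consistent x [], P.gopt x (P.claimReward x y) n [(m, P.arthur x [] m ω)]

theorem claimValue_le (n : ℕ) (y : Str) {m : Str} (hm : m ∈ P.messages x) :
    P.claimValue n x y m ≤ P.gopt x (P.claimReward x y) (n + 1) [] :=
  Finset.le_sup' (fun m => P.claimValue n x y m) hm

theorem exists_claimValue_eq (n : ℕ) (x y : Str) :
    ∃ m ∈ P.messages x, P.claimValue n x y m = P.gopt x (P.claimReward x y) (n + 1) [] := by
  obtain ⟨m, hm, h⟩ := Finset.exists_mem_eq_sup' (P.messages_nonempty x) (P.claimValue n x y)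
  exact ⟨m, hm, h.symm⟩

theorem claimReward_mem_Icc (y : Str) (h : History) (ω : P.Coins x) :
    P.claimReward x y h ω ∈ Set.Icc (0 : ℚ) 3 := by
  obtain ⟨h₀, h₁⟩ : P.reward x h ω ∈ Set.Icc (0 : ℚ) 1 := P.R_mem _
  rw [claimReward]
  split_ifs <;> constructor <;> linarith

theorem claimValue_le_three (n : ℕ) (y : Str) {m : Str} (hm : m ∈ P.messages x) :
    P.claimValue n x y m ≤ 3 :=
  (P.claimValue_le n y hm).trans
    (P.gopt_mem_Icc (P.claimReward_mem_Icc y) (by norm_num) (n + 1) []).2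

theorem claimValue_nonneg (n : ℕ) (x y m : Str) : 0 ≤ P.claimValue n x y m :=
  Finset.expect_nonneg fun _ _ => (P.gopt_mem_Icc (P.claimReward_mem_Icc y) (by norm_num) n _).1

theorem card_coins (x : Str) :
    Fintype.card (P.Coins x) = 2 ^ (k * P.coinLen.eval x.length) := by
  simp [Coins, ← pow_mul, mul_comm]

theorem length_encode_reward_le {h : History} {ω : P.Coins x} (hk : h.length = k)
    (hm : ∀ p ∈ h, p.1 ∈ P.messages x) :
    (encode (x :: (h.zip (P.coinList ω)).flatMap fun p => [p.1.1, p.2])).length ≤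
      2 * x.length + 1 +
        k * (2 * P.msgLen.eval x.length + 2 * P.coinLen.eval x.length + 2) := by
  have key : ∀ l : List ((Str × Str) × Str), (∀ p ∈ l, p.1.1.length ≤ P.msgLen.eval x.length ∧
      p.2.length ≤ P.coinLen.eval x.length) →
      (encode (l.flatMap fun p => [p.1.1, p.2])).length ≤
        l.length * (2 * P.msgLen.eval x.length + 2 * P.coinLen.eval x.length + 2) := by
    intro l hl
    induction l with
    | nil => simp [encode_nil]
    | cons p l ih =>
      have h₁ := hl p (by simp)
      have h₂ := ih fun p hp => hl p (by simp [hp])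
      simp only [List.flatMap_cons, List.cons_append, List.nil_append, encode_cons, length_pr,
        List.length_cons, add_mul, one_mul]
      omega
  have := key (h.zip (P.coinList ω)) fun p hp => by
    obtain ⟨h₁, h₂⟩ := List.of_mem_zip (a := p.1) (b := p.2) hp
    refine ⟨P.mem_messages.1 (hm _ h₁), ?_⟩
    obtain ⟨i, hi⟩ := (List.mem_ofFn' _ _).1 h₂
    rw [← hi, List.length_ofFn]
  rw [List.length_zip, P.length_coinList, hk, min_self] at this
  rw [encode_cons, length_pr]
  omega

end Protocol

namespace QueryGame

/-- Rewards have at most `prec` binary digits, and the averages refine this only by the number of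
coin outcomes. This granularity turns the strict loss of `gopt_claim_lt` into a quantitative one. -/
theorem card_mul_gopt_claim_eq_int {k : ℕ} (D : QueryGame k) {x q : Str}
    (hq : q.length ≤ D.N.eval x.length) (y : Str) :
    ∃ z : ℤ, 2 ^ (k * D.P.coinLen.eval q.length) *
      D.P.gopt q (D.P.claimReward q y) k [] * 2 ^ D.prec.eval x.length = z := by
  have := D.P.card_mul_gopt_eq_int (x := q) (rew := D.P.claimReward q y)
    (B := 2 ^ D.prec.eval x.length) (n := k) (h := []) ?_ (by simp) (by simp)
  · rw [Protocol.consistent_nil, Finset.card_univ, Protocol.card_coins] at this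
    exact_mod_cast this
  · intro h ω hk hm
    rw [Protocol.claimReward]
    split_ifs
    · set s := encode (q :: (h.zip (D.P.coinList ω)).flatMap fun p => [p.1.1, p.2]) with hs
      have hlen : (D.g s).length ≤ D.prec.eval x.length := by
        refine (D.g_length s).trans ?_
        rw [prec, Polynomial.eval_comp]
        refine polynomial_eval_mono _ ((D.P.length_encode_reward_le hk hm).trans ?_)
        have h₁ := polynomial_eval_mono D.P.coinLen hq
        have h₂ := polynomial_eval_mono D.P.msgLen hq
        simp only [Polynomial.eval_add, Polynomial.eval_mul, Polynomial.eval_ofNat,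
          Polynomial.eval_one, Polynomial.eval_natCast, Polynomial.eval_comp, Nat.cast_id]
        gcongr
      obtain ⟨z, hz⟩ := binaryFraction_mul_two_pow (D.g s)
      obtain ⟨d, hd⟩ := Nat.exists_eq_add_of_le hlen
      refine ⟨2 * 2 ^ D.prec.eval x.length + z * 2 ^ d, ?_⟩
      push_cast
      rw [← hz, Protocol.reward, ← hs, D.R_eq, hd]
      ring
    · exact ⟨0, by simp⟩

/-- The loss from a wrong claim. -/
theorem gopt_claim_add_le {k : ℕ} (D : QueryGame k) {f : Str → Str} (hf : D.P.Computes f)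
    {x q y : Str} (hq : q.length ≤ D.N.eval x.length) (hy : y ≠ f q) :
    D.P.gopt q (D.P.claimReward q y) k [] +
      1 / (2 ^ (k * D.coinLen.eval x.length) * 2 ^ D.prec.eval x.length) ≤
        2 + D.P.optimum q k [] := by
  have hlt := D.P.gopt_claim_lt hf hy (n := k) (h := []) (by simp) D.P.isRationalPrefix_nil
  rw [← D.P.gopt_claim_eq hf (by simp) D.P.isRationalPrefix_nil] at hlt ⊢
  obtain ⟨z₁, h₁⟩ := D.card_mul_gopt_claim_eq_int hq y
  obtain ⟨z₂, h₂⟩ := D.card_mul_gopt_claim_eq_int hq (f q)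
  set A : ℚ := 2 ^ (k * D.P.coinLen.eval q.length) with hA
  set B : ℚ := 2 ^ D.prec.eval x.length with hB
  have hA0 : 0 < A := by positivity
  have hB0 : 0 < B := by positivity
  have hle : A ≤ 2 ^ (k * D.coinLen.eval x.length) := by
    refine pow_le_pow_right₀ (by norm_num) (Nat.mul_le_mul_left _ ?_)
    have := D.coinLen_le hq
    simp only [protocol] at this
    omega
  -- Distinct multiples of `1 / (A * B)` differ by at least `1 / (A * B)`.
  have hz : z₁ + 1 ≤ z₂ := by
    have : (z₁ : ℚ) < z₂ := by
      rw [← h₁, ← h₂]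
      gcongr
    exact_mod_cast this
  have hz : (z₁ : ℚ) + 1 ≤ z₂ := by exact_mod_cast hz
  rw [← h₁, ← h₂] at hz
  refine le_trans (b := D.P.gopt q (D.P.claimReward q y) k [] + 1 / (A * B)) (by gcongr) ?_
  rw [← sub_nonneg] at hz ⊢
  have : D.P.gopt q (D.P.claimReward q (f q)) k [] -
      (D.P.gopt q (D.P.claimReward q y) k [] + 1 / (A * B)) =
      (A * D.P.gopt q (D.P.claimReward q (f q)) k [] * B -
        (A * D.P.gopt q (D.P.claimReward q y) k [] * B + 1)) / (A * B) := by
    field_simp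
  rw [this]
  positivity

end QueryGame

/-! ### Optimality of honest first messages -/

namespace QueryGame

variable {K : ℕ} (D : QueryGame (K + 1)) {x : Str}

/-- The contribution of the claim with index `u` to the value of the message `M`, up to the
weight. -/
noncomputable def value (x M u : Str) : ℚ :=
  D.P.claimValue K (D.query x u M) (p1 (entry u.length M)) (D.msg (D.query x u M) u M)

/-- Given the index, the runs do not interact: each one contributes its own weighted claim value, so
the value of the first message is an average over indices. -/
theorem messageValue_eq (M : Str) : D.protocol.messageValue x K [] M =
    𝔼 ω : D.protocol.Coins x, D.weight x (D.idx ω) * D.value x M (D.idx ω) := by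
  classical
  rw [Protocol.messageValue, Protocol.consistent_nil, Finset.expect_eq_sum_div_card,
    Finset.expect_eq_sum_div_card]
  congr 1
  have hmaps : ∀ ω ∈ (Finset.univ : Finset (D.protocol.Coins x)),
      D.idx ω ∈ Finset.univ.image (D.idx (x := x)) := fun ω h => Finset.mem_image_of_mem _ h
  rw [← Finset.sum_fiberwise_of_maps_to hmaps, ← Finset.sum_fiberwise_of_maps_to hmaps]
  refine Finset.sum_congr rfl fun u hu => ?_
  have hu : ∃ ω : D.protocol.Coins x, D.idx ω = u := by simpa using hu
  have hq : (D.query x u M).length ≤ D.N.eval x.length := D.Q_length _ _ _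
  have hR : ∑ ω : D.protocol.Coins x with D.idx ω = u,
      D.weight x (D.idx ω) * D.value x M (D.idx ω) =
      ∑ ω : D.protocol.Coins x with D.idx ω = u, D.weight x u * D.value x M u :=
    Finset.sum_congr rfl fun ω hω => by rw [(Finset.mem_filter.1 hω).2]
  rw [hR, Finset.sum_const, value, Protocol.claimValue, Finset.mul_expect,
    ← expect_comp_of_fibers (D.proj_override hq) (D.idx_override _) (D.override_proj _) hu
      (S' := Finset.univ.filter fun ω => D.idx ω = u) (by simp [Protocol.consistent_nil]),
    Finset.card_smul_expect]
  refine Finset.sum_congr rfl fun ω hω => ?_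
  rw [D.arthur_eq (M := M) (by simp) (by simp [History.flat]) (Finset.mem_filter.1 hω).2,
    List.nil_append, D.optimum_eq (M := M) (by simp; omega) ⟨⟨_, _, rfl⟩, by simp⟩ hu]
  simp [hist]
  exact Or.inl rfl

theorem value_le_three (M u : Str) : D.value x M u ≤ 3 :=
  D.P.claimValue_le_three _ _ (D.msg_mem _ _ _)

theorem value_nonneg (M u : Str) : 0 ≤ D.value x M u := D.P.claimValue_nonneg _ _ _ _

theorem value_le_gopt (M u : Str) : D.value x M u ≤
    D.P.gopt (D.query x u M) (D.P.claimReward _ (p1 (entry u.length M))) (K + 1) [] :=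
  D.P.claimValue_le _ _ (D.msg_mem _ _ _)

/-- This is where the choice of `c` enters: even if every coin outcome gained the maximal value `3`
at the next smaller weight, the total stays below the loss `δ` at a single outcome. -/
theorem card_mul_pow_c (x : Str) : (2 : ℚ) ^ ((K + 1) * D.coinLen.eval x.length) *
    (3 * (1 / 2) ^ D.c.eval x.length) <
      1 / (2 ^ ((K + 1) * D.coinLen.eval x.length) * 2 ^ D.prec.eval x.length) := by
  have : D.c.eval x.length =
      D.prec.eval x.length + 2 * ((K + 1) * D.coinLen.eval x.length) + 2 := by
    simp [c, mul_assoc]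
  rw [this]
  generalize (K + 1) * D.coinLen.eval x.length = a
  generalize D.prec.eval x.length = b
  rw [pow_add, pow_add, mul_comm 2 a, pow_mul, one_div_pow, one_div_pow]
  have ha : (0 : ℚ) < 2 ^ a := by positivity
  have hb : (0 : ℚ) < 2 ^ b := by positivity
  have : (2 : ℚ) ^ a * (3 * (1 / 2 ^ b * (1 / 2 ^ a) ^ 2 * (1 / 2) ^ 2)) =
      3 / 4 * (1 / (2 ^ a * 2 ^ b)) := by
    field_simp
    norm_num
  rw [this]
  have : (0 : ℚ) < 1 / (2 ^ a * 2 ^ b) := by positivity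
  linarith

section

variable {f : Str → Str} {qs : List Str}

/-- `qs` are the queries that arise from the input `x` if all answers are correct. -/
def IsQueryList (x : Str) (f : Str → Str) (qs : List Str) : Prop :=
  ∀ ans l q l' u, qs = l ++ q :: l' → Answers f l ans → u.length = l.length →
    D.Q (pr x (pr u ans)) = q

/-- One message can be optimal for all queries at once, since it contains a separate entry for each:
the true answer and a best first message for that claim. -/
theorem exists_honest_message (hf : D.P.Computes f) (hlen : qs.length ≤ D.N.eval x.length)
    (hfq : ∀ q ∈ qs, (f q).length ≤ D.N.eval x.length) (hQ : D.IsQueryList x f qs) :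
    ∃ M ∈ D.protocol.messages x, ∀ l q l' u, qs = l ++ q :: l' → u.length = l.length →
      D.value x M u = 2 + D.P.optimum q (K + 1) [] := by
  choose best hbest hmax using fun q => D.P.exists_claimValue_eq K q (f q)
  set L := qs.map fun q => pr (f q) (best q) with hL
  have hans : ∀ l l', qs = l ++ l' → Answers f l (encode L) := by
    rintro l l' rfl
    rw [answers_encode (by simp [hL])]
    simp [hL]
  have hqN : ∀ q ∈ qs, q.length ≤ D.N.eval x.length := by
    intro q hq
    obtain ⟨l, l', h⟩ := List.append_of_mem hq
    rw [← hQ _ l q l' (List.replicate l.length false) h (hans l _ h) (by simp)]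
    exact D.Q_length _ _ _
  refine ⟨encode L, ?_, fun l q l' u h hu => ?_⟩
  · have hsum : (encode L).length ≤ qs.length *
        (4 * D.N.eval x.length + 2 * D.P.msgLen.eval (D.N.eval x.length) + 3) := by
      rw [length_encode, ← smul_eq_mul, ← List.length_map (as := qs) (fun q => pr (f q) (best q)),
        ← hL, ← List.length_map (as := L) (fun s => 2 * s.length + 1)]
      refine List.sum_le_card_nsmul _ _ fun n hn => ?_
      simp only [hL, List.map_map, List.mem_map, comp_apply, length_pr] at hn
      obtain ⟨q, hq, rfl⟩ := hn
      have h₁ := hfq q hq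
      have h₂ := (D.P.mem_messages.1 (hbest q)).trans
        (polynomial_eval_mono D.P.msgLen (hqN q hq))
      omega
    rw [Protocol.mem_messages]
    refine hsum.trans ?_
    simp only [protocol, msgLen, Polynomial.eval_add, Polynomial.eval_mul, Polynomial.eval_ofNat,
      Polynomial.eval_comp]
    nlinarith
  · have hq : D.query x u (encode L) = q := hQ _ l q l' u h (hans l _ h) hu
    have he : entry u.length (encode L) = pr (f q) (best q) := by
      have := nth_encode L u.length
      rw [hL, h, hu] at this
      rw [hL, h, hu]
      simpa [nth, entry] using this
    have hm : D.msg q u (encode L) = best q := by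
      rw [msg, he, p2_pr, List.take_of_length_le (D.P.mem_messages.1 (hbest q))]
    rw [value, hq, he, hm, p1_pr, hmax, D.P.gopt_claim_eq hf (by simp) D.P.isRationalPrefix_nil]

theorem exists_messageValue_lt (hf : D.P.Computes f) (hlen : qs.length ≤ D.N.eval x.length)
    (hfq : ∀ q ∈ qs, (f q).length ≤ D.N.eval x.length) (hQ : D.IsQueryList x f qs) {M : Str}
    (hM : ¬ Answers f qs M) : ∃ M' ∈ D.protocol.messages x,
      D.protocol.messageValue x K [] M < D.protocol.messageValue x K [] M' := by
  obtain ⟨M', hM', hval⟩ := D.exists_honest_message hf hlen hfq hQ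
  obtain ⟨l₁, q₁, l₂, hqs, hans, hne⟩ := exists_first_wrong_answer hM
  refine ⟨M', hM', ?_⟩
  rw [messageValue_eq, messageValue_eq, Finset.expect_eq_sum_div_card,
    Finset.expect_eq_sum_div_card]
  refine div_lt_div_of_pos_right ?_ (by simp [Finset.card_univ])
  rw [← sub_pos, ← Finset.sum_sub_distrib]
  set n := l₁.length with hn
  set e : ℚ := (1 / 2) ^ D.c.eval x.length with he
  have he0 : 0 < e := by positivity
  have he1 : e ≤ 1 := pow_le_one₀ (by norm_num) (by norm_num)
  have hw : ∀ u, D.weight x u = e ^ u.length / 4 := fun u => by rw [weight, pow_mul]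
  have hwn : ∀ u, 0 ≤ D.weight x u := fun u => by rw [hw]; positivity
  -- One coin outcome that examines the first wrong answer is enough; its index `n` is below the
  -- number of queries and so below `N`.
  obtain ⟨ω₀, hω₀⟩ := D.exists_length_idx (x := x) K.succ_pos (n := n)
    (lt_of_lt_of_le (by rw [hqs]; simp [hn]) hlen)
  set δ : ℚ := 1 / (2 ^ ((K + 1) * D.coinLen.eval x.length) * 2 ^ D.prec.eval x.length) with hδ
  -- Up to and including index `n` the preceding claims in `M` are correct, so the query is the true
  -- one and the honest claim has the largest possible value.
  have hbefore : ∀ u : Str, u.length ≤ n → D.value x M u ≤ D.value x M' u := by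
    intro u hu
    have hlt : u.length < qs.length := by rw [hqs]; simp; omega
    have hsplit : qs = qs.take u.length ++ qs[u.length] :: qs.drop (u.length + 1) := by
      rw [← List.drop_eq_getElem_cons, List.take_append_drop]
    have hlen' : u.length = (qs.take u.length).length := by simp; omega
    have hA : Answers f (qs.take u.length) M := by
      have : l₁ = qs.take u.length ++ l₁.drop u.length := by
        conv_lhs => rw [← List.take_append_drop u.length l₁]
        rw [hqs, List.take_append_of_le_length hu]
      rw [this] at hans
      exact (answers_append.1 hans).1
    rw [hval _ _ _ u hsplit hlen']
    refine (D.value_le_gopt M u).trans ((D.P.gopt_claim_le _ _ _).trans ?_)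
    rw [show D.query x u M = _ from hQ M _ _ _ u hsplit hA hlen']
  -- At index `n` the query is still correct but its claimed answer is not.
  have hwrong : ∀ u : Str, u.length = n → D.value x M u + δ ≤ D.value x M' u := by
    intro u hu
    have hq : D.query x u M = q₁ := hQ M _ _ _ u hqs hans hu
    have hqN : q₁.length ≤ D.N.eval x.length := hq ▸ D.Q_length _ _ _
    rw [hval _ _ _ u hqs hu]
    have h₁ := D.value_le_gopt (x := x) M u
    rw [hq, hu] at h₁
    have h₂ := D.gopt_claim_add_le hf hqN hne
    linarith
  -- Later indices may have quite different queries under `M`, but there the advantage of `M` is at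
  -- most `3` times a weight of at most `e ^ (n + 1) / 4`.
  have hall : ∀ ω : D.protocol.Coins x,
      -(3 * e ^ (n + 1) / 4) + (if ω = ω₀ then e ^ n * δ / 4 else 0) ≤ D.weight x (D.idx ω) * D.value x M' (D.idx ω) -
        D.weight x (D.idx ω) * D.value x M (D.idx ω) := by
    intro ω
    rw [← mul_sub]
    have hpos : 0 < e ^ (n + 1) := by positivity
    split_ifs with h
    · rw [h, hw, hω₀]
      have := mul_le_mul_of_nonneg_left (le_sub_iff_add_le'.2 (hwrong _ hω₀))
        (by positivity : 0 ≤ e ^ n / 4)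
      linarith
    · rw [add_zero]
      rcases le_or_gt (D.idx ω).length n with hle | hlt
      · have := mul_nonneg (hwn (D.idx ω)) (sub_nonneg.2 (hbefore _ hle))
        linarith
      · have h₁ : D.weight x (D.idx ω) ≤ e ^ (n + 1) / 4 := by
          rw [hw]
          exact div_le_div_of_nonneg_right (pow_le_pow_of_le_one he0.le he1 hlt) (by norm_num)
        have h₂ := D.value_le_three (x := x) M (D.idx ω)
        have h₃ := D.value_nonneg (x := x) M' (D.idx ω)
        have := mul_le_mul_of_nonneg_left (by linarith : D.value x M (D.idx ω) -
          D.value x M' (D.idx ω) ≤ 3) (hwn (D.idx ω))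
        linarith
  refine lt_of_lt_of_le ?_ (Finset.sum_le_sum fun ω _ => hall ω)
  rw [Finset.sum_add_distrib, Finset.sum_ite_eq', if_pos (Finset.mem_univ _), Finset.sum_const,
    Finset.card_univ, Protocol.card_coins, nsmul_eq_mul]
  -- The comparison of `card_mul_pow_c`, scaled to the weight of index `n`.
  have hc := mul_lt_mul_of_pos_left (D.card_mul_pow_c x) (by positivity : 0 < e ^ n / 4)
  rw [← he, ← hδ] at hc
  have : D.protocol.coinLen = D.coinLen := rfl
  rw [this, pow_succ]
  push_cast
  linarith

/-- Rationality is used only for the first message: it forces correct answers, and `Q` with a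
counter as large as the number of queries then returns the decision. -/
theorem protocol_computes {S : Language Bool} (hf : D.P.Computes f)
    (hqs : ∀ x, ∃ qs : List Str, qs.length ≤ D.N.eval x.length ∧
      (∀ q ∈ qs, (f q).length ≤ D.N.eval x.length) ∧ D.IsQueryList x f qs ∧
      ∀ ans, Answers f qs ans → ∀ u, D.N.eval x.length ≤ u.length →
        D.Q (pr x (pr u ans)) = indicator S x) :
    D.protocol.Computes (indicator S) := by
  rintro x h ⟨hk, -, hh⟩
  obtain ⟨qs, hlen, hfq, hQ, hS⟩ := hqs x
  rcases h with _ | ⟨⟨M, a⟩, t⟩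
  · simp at hk
  have hA : Answers f qs M := by
    by_contra hM
    obtain ⟨M', hM', hlt⟩ := D.exists_messageValue_lt hf hlen hfq hQ hM
    exact hlt.not_ge (by simpa using (hh ⟨0, by simp⟩).2 M' hM')
  have hflat : ∃ l, (History.flat ((M, a) :: t)).dropLast = M :: l := by
    rw [flat_cons]
    exact ⟨_, rfl⟩
  obtain ⟨l, hl⟩ := hflat
  rw [Protocol.computedValue, hl]
  change D.query (nth 0 _) (List.replicate (D.N.eval (nth 0 _).length) false) (nth 1 _) = _
  rw [show nth 0 (encode (x :: M :: l)) = x by simp [nth_encode],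
    show nth 1 (encode (x :: M :: l)) = M by simp [nth_encode]]
  exact hS M hA _ (by simp)

end

end QueryGame

/-! ### Conclusion -/

theorem pOracle_subset_dRMA_succ (K : ℕ) : POracle (FRMA (K + 1)) ⊆ DRMA (K + 1) := by
  rintro S ⟨f, ⟨P, hP⟩, hS⟩
  obtain ⟨Q, N, hQ, hQN, hqs⟩ := exists_query_function hS
  obtain ⟨g, hg, hR⟩ := P.R_polyTime
  obtain ⟨G, hG⟩ := hg.on.length_le
  set D : QueryGame (K + 1) :=
    { P := P, Q := Q, N := N, g := g, G := G, Q_polyTime := hQ, g_polyTime := hg.on, R_eq := hR,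
      Q_length := hQN, g_length := hG }
  refine ⟨D.protocol, D.protocol_computes hP fun x => ?_⟩
  obtain ⟨qs, h₁, h₂, h₃⟩ := hqs x
  exact ⟨qs, h₁, h₂, fun ans l q l' u => (h₃ ans).1 l q l' u, fun ans => (h₃ ans).2⟩

end RationalProofs

theorem mainTheorem1 (k : ℕ) :
    RationalProofs.POracle (RationalProofs.FRMA k) = RationalProofs.DRMA k := by
  refine Set.Subset.antisymm ?_ (RationalProofs.dRMA_subset_pOracle k)
  cases k with
  | zero => exact RationalProofs.pOracle_subset_dRMA_zero
  | succ K => exact RationalProofs.pOracle_subset_dRMA_succ K
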